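/- Let $\pi:Y\to X$ be a fibred manifold (a smooth surjective submersion of second countable Hausdorff manifolds, $n=\dim X$) with fibred coordinates $(x^\lambda,y^i)$. Let $J^1Y\to Y$ be its first jet bundle, with coordinates $(x^\lambda,y^i,y^i_\lambda)$, and let $\Pi=\wedge^nT^*X\otimes TX\otimes V^*Y\to Y$ be its Legendre bundle, with coordinates $(x^\lambda,y^i,p^\lambda_i)$. Put $\omega=dx^1\wedge\dots\wedge dx^n$ and $\omega_\lambda=\partial_\lambda\rfloor\omega$. Let $$L=\mathcal L\omega,\qquad \mathcal L=\tfrac12a^{\lambda\mu}_{ij}(y)y^i_\lambda y^j_\mu+b^\lambda_i(y)y^i_\lambda+c(y),\qquad a^{\lambda\mu}_{ij}=a^{\mu\lambda}_{ji},$$ be a smooth quadratic Lagrangian density with Legendre morphism $\widehat L:J^1Y\to\Pi$, $p^\lambda_i\circ\widehat L=a^{\lambda\mu}_{ij}y^j_\mu+b^\lambda_i$, and linear part $\overline L:T^*X\otimes VY\to\Pi$, $p^\lambda_i\circ\overline L=a^{\lambda\mu}_{ij}y^j_\mu$. Let $Q=\widehat L(J^1Y)$ be the constraint space, $i_Q:Q\to\Pi$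 the inclusion, and $\mathrm{Ker}\,\widehat L$ the preimage under $\widehat L$ of the zero section of $\Pi\to Y$. Suppose that $L$ is almost regular ($Q$ is an embedded submanifold of $\Pi$ and $\widehat L:J^1Y\to Q$ is a submersion) and that $Q$ contains the zero section of $\Pi\to Y$. A Hamiltonian form is a form $H=p^\lambda_idy^i\wedge\omega_\lambda-\mathcal H\omega$ on $\Pi$ with smooth local functions $\mathcal H(x,y,p)$. Its momentum morphism $\widehat H:\Pi\to J^1Y$ is given by $y^i_\lambda\circ\widehat H=\partial\mathcal H/\partial p^\lambda_i$. For a morphism $\Phi:\Pi\to J^1Y$ over $Y$ put $H_\Phi=p^\lambda_idy^i\wedge\omega_\lambda-p^\lambda_i\Phi^i_\lambda\omega$. The form $H$ is associated with $L$ if $\widehat L\circ\widehat H|_Q=\mathrm{Id}_Q$ and $H=H_{\widehat H}+L\circ\widehat H$. The Hamilton equations for a section $r$ of $\Pi\to X$ are $\partial_\lambda r^i=\partial\mathcal H/\partial p^\lambda_i$ (first group) and $\partial_\lambda r^\lambda_i=-\partial\mathcal H/\partial y^i$ (second group). Consider connections $\Gamma:Y\to\mathrm{Ker}\,\widehat L\subset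 J^1Y$ and smooth fibrewise linear morphisms $\sigma:\Pi\to T^*X\otimes VY$ over $Y$, $y^i_\lambda\circ\sigma=\sigma^{ij}_{\lambda\mu}p^\mu_j$. Call $\sigma$ symmetric if $\sigma^{ij}_{\lambda\mu}=\sigma^{ji}_{\mu\lambda}$. Put $\Phi=\Gamma+\sigma$ and $$H=p^\lambda_idy^i\wedge\omega_\lambda-\Bigl(\Gamma^i_\lambda(p^\lambda_i-\tfrac12b^\lambda_i)+\tfrac12\sigma^{ij}_{\lambda\mu}p^\lambda_ip^\mu_j-c\Bigr)\omega .$$ Then: 1. There exist a connection $\Gamma$ with values in $\mathrm{Ker}\,\widehat L$ and a symmetric linear $\sigma$ with $\overline L\circ\sigma\circ i_Q=i_Q$ and $\sigma=\sigma\circ\overline L\circ\sigma$. 2. For every $\Gamma$ with values in $\mathrm{Ker}\,\widehat L$ and every linear $\sigma$, the expression $H$ is a globally well-defined Hamiltonian form. If $\sigma$ is symmetric and $\overline L\circ\sigma\circ i_Q=i_Q$, then $\widehat H=\Phi$, $\widehat L\circ\Phi|_Q=\mathrm{Id}_Q$, and $H$ is associated with $L$ if and only if $\sigma=\sigma\circ\overline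 L\circ\sigma$. Now fix a symmetric $\sigma$ with $\overline L\circ\sigma\circ i_Q=i_Q$ and $\sigma=\sigma\circ\overline L\circ\sigma$, and put $\mathcal F=\sigma\circ\widehat L$ and $\mathcal S(j)=j-\mathcal F(j)$ for $j\in J^1Y$. 3. $Q=\mathrm{Im}\,\overline L$, $\Pi=\mathrm{Ker}\,\sigma\oplus_YQ$ and $J^1Y=\mathrm{Ker}\,\widehat L\oplus_Y\mathrm{Im}\,\sigma$. In the last splitting the components of $j$ are $\mathcal S(j)$ and $\mathcal F(j)$. 4. For every $\Gamma$ with values in $\mathrm{Ker}\,\widehat L$ we have $H=H_\Phi+L\circ\Phi$, and $H$ is associated with $L$. For a section $r$ of $\Pi\to X$ with projection $s$ to $Y$, the first group of Hamilton equations for $H$ is equivalent to $J^1s=(\Gamma+\sigma)\circ r$. It is also equivalent to the pair consisting of the gauge-type conditions $\mathcal S\circ J^1s=\Gamma\circ s$ and the equation $\mathcal F\circ J^1s=\sigma\circ r$. 5. For every section $s$ of $Y\to X$ there is a connection $\Gamma$ with values in $\mathrm{Ker}\,\widehat L$ such that $\mathcal S\circ J^1s=\Gamma\circ s$ and $\Phi\circ\widehat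 L\circ J^1s=J^1s$. 6. As $\Gamma$ varies (with $\sigma$ fixed), the forms $H$ make a complete family. That is, $L$ is semiregular (for each $p\in Q$ the set $\widehat L^{-1}(p)$ is a connected submanifold of $J^1Y$), all these $H$ are associated with $L$, and for every section $\overline s$ of $J^1Y\to X$ which solves the first order Euler–Lagrange equations $$\partial_\lambda\overline s^i=\overline s^i_\lambda,\qquad \partial_i\mathcal L-(\partial_\lambda+\overline s^j_\lambda\partial_j+\partial_\lambda\overline s^j_\mu\,\partial^\mu_j)\partial^\lambda_i\mathcal L=0\qquad(\partial^\lambda_i=\partial/\partial y^i_\lambda),$$ there are a form $H$ of the family and a solution $r$ of both groups of its Hamilton equations such that $r=\widehat L\circ\overline s$, $\overline s=\widehat H\circ r$ and $\overline s=J^1s$, where $s$ is the projection of $r$ to $Y$. -/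

import Mathlib

open scoped Manifold ContDiff

noncomputable section

namespace Multimomentum

/-- The model space of the base manifold. -/
abbrev Base (n : ℕ) := EuclideanSpace ℝ (Fin n)

/-- The model space of the fibres. -/
abbrev Fib (m : ℕ) := EuclideanSpace ℝ (Fin m)

abbrev IX (n : ℕ) := 𝓘(ℝ, Base n)

abbrev IY (n m : ℕ) := 𝓘(ℝ, Base n × Fib m)

/-- The space of coordinates `(x^μ, y^i, z)`, where the array `z` stands for the coordinates
`y^i_λ` of a jet or for the coordinates `p^λ_i` of a momentum (entry `λ i` in both cases). -/
abbrev Coord (n m : ℕ) := (Base n × Fib m) × (Fin n → Fin m → ℝ)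

/-- The coordinate vector `∂/∂y^i` in the space of coordinates. -/
def dirY {n m : ℕ} (i : Fin m) : Coord n m := ((0, EuclideanSpace.single i 1), 0)

/-- The coordinate vector `∂/∂x^lam`. -/
def dirX {n m : ℕ} (lam : Fin n) : Coord n m := ((EuclideanSpace.single lam 1, 0), 0)

/-- The coordinate vector `∂/∂y^i_lam`, respectively `∂/∂p^lam_i`. -/
def dirZ {n m : ℕ} (lam : Fin n) (i : Fin m) : Coord n m :=
  ((0, 0), Pi.single lam (Pi.single i 1))

/-- Partial derivative of `f` at `c` in the direction `v`. -/
def pd {n m : ℕ} (f : Coord n m → ℝ) (c v : Coord n m) : ℝ := fderiv ℝ f c v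

/-- Partial derivative `∂_lam f` of a function of the base coordinates. -/
def pdBase {n : ℕ} (f : Base n → ℝ) (u : Base n) (lam : Fin n) : ℝ :=
  fderiv ℝ f u (EuclideanSpace.single lam 1)

/-! ### Embedded submanifolds of a normed space -/

/-- `Φ` is a smooth local diffeomorphism of `V`, defined around `p`, which straightens the set `S`
to the linear subspace `K`. -/
def IsSliceChart {V : Type*} [NormedAddCommGroup V] [NormedSpace ℝ V]
    (S : Set V) (p : V) (Φ : OpenPartialHomeomorph V V) (K : Submodule ℝ V) : Prop :=
  p ∈ Φ.source ∧ ContDiffOn ℝ ∞ Φ Φ.source ∧ ContDiffOn ℝ ∞ Φ.symm Φ.target ∧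
    ∀ q ∈ Φ.source, q ∈ S ↔ Φ q ∈ K

/-- `S` is an embedded smooth submanifold of the normed space `V`. -/
def IsEmbeddedSubmanifold {V : Type*} [NormedAddCommGroup V] [NormedSpace ℝ V]
    (S : Set V) : Prop :=
  ∀ p ∈ S, ∃ (Φ : OpenPartialHomeomorph V V) (K : Submodule ℝ V), IsSliceChart S p Φ K

/-! ### Fibred manifolds, jets, momenta -/

/-- A fibred manifold: a smooth surjective submersion `Y → X`, where `dim X = n` and
`dim Y = n + m`. -/
structure FibredManifold (n m : ℕ) (X Y : Type*) [TopologicalSpace X] [ChartedSpace (Base n) X]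
    [TopologicalSpace Y] [ChartedSpace (Base n × Fib m) Y] where
  proj : Y → X
  surjective : Function.Surjective proj
  submersion : Manifold.IsSubmersion (IY n m) (IX n) ∞ proj

section

variable {n m : ℕ} {X Y : Type*}
  [TopologicalSpace X] [ChartedSpace (Base n) X]
  [TopologicalSpace Y] [ChartedSpace (Base n × Fib m) Y]

namespace FibredManifold

/-- `T_x X` at the point `x = π(y)`. -/
abbrev TX (P : FibredManifold n m X Y) (y : Y) : Type := TangentSpace (IX n) (P.proj y)

/-- `T_y Y`. -/
abbrev TY (_P : FibredManifold n m X Y) (y : Y) : Type := TangentSpace (IY n m) y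

/-- The tangent map `T_y Y → T_x X` of the projection. -/
def dproj (P : FibredManifold n m X Y) (y : Y) : P.TY y →L[ℝ] P.TX y :=
  mfderiv (IY n m) (IX n) P.proj y

/-- The vertical tangent space `V_y Y`. -/
abbrev VY (P : FibredManifold n m X Y) (y : Y) : Submodule ℝ (P.TY y) :=
  LinearMap.ker (P.dproj y : P.TY y →ₗ[ℝ] P.TX y)

/-- The fibre at `y` of the vector bundle `T*X ⊗ VY`. -/
abbrev Sold (P : FibredManifold n m X Y) (y : Y) : Type := P.TX y →L[ℝ] P.VY y

/-- The fibre at `y` of `Λⁿ T*X`, with `n = dim X`. -/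
abbrev Density (P : FibredManifold n m X Y) (y : Y) : Type := P.TX y [⋀^Fin n]→ₗ[ℝ] ℝ

/-- The fibre at `y` of the Legendre bundle
`Π = Λⁿ T*X ⊗ TX ⊗ V*Y = Hom (T*X ⊗ VY, Λⁿ T*X)`. -/
abbrev Mom (P : FibredManifold n m X Y) (y : Y) : Type := P.Sold y →ₗ[ℝ] P.Density y

/-- The fibre at `y` of the jet bundle `J¹Y → Y`: the jet of a section `s` through `y` is
identified with the tangent map of `s`, which is a linear right inverse of `T_y Y → T_x X`. -/
@[ext]
structure Jet (P : FibredManifold n m X Y) (y : Y) where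
  toLin : P.TX y →L[ℝ] P.TY y
  isSection : (P.dproj y).comp toLin = ContinuousLinearMap.id ℝ (P.TX y)

variable {P : FibredManifold n m X Y} {y : Y}

/-- `J¹Y → Y` is an affine bundle modelled on `T*X ⊗ VY`: translations. -/
instance : VAdd (P.Sold y) (P.Jet y) where
  vadd v j :=
    { toLin := (P.VY y).subtypeL.comp v + j.toLin
      isSection := by
        ext u
        have h1 : P.dproj y ((v u : P.VY y) : P.TY y) = 0 := (v u).2
        have h2 : P.dproj y (j.toLin u) = u := by
          simpa using congrArg (fun f => f u) j.isSection
        simp [h1, h2] }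

/-- `J¹Y → Y` is an affine bundle modelled on `T*X ⊗ VY`: differences. -/
instance : VSub (P.Sold y) (P.Jet y) where
  vsub j k := (j.toLin - k.toLin).codRestrict (P.VY y) (by
    intro u
    have h1 : P.dproj y (j.toLin u) = u := by
      simpa using congrArg (fun f => f u) j.isSection
    have h2 : P.dproj y (k.toLin u) = u := by
      simpa using congrArg (fun f => f u) k.isSection
    simp [h1, h2])

theorem vsub_vadd_jet (j k : P.Jet y) : (j -ᵥ k) +ᵥ k = j := by
  apply Jet.ext
  ext u
  change (j.toLin u - k.toLin u) + k.toLin u = j.toLin u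
  simp

end FibredManifold

/-! ### Fibred coordinates -/

/-- A chart of `Y` with fibred coordinates `(x^λ, y^i)`, together with the chart of `X` with
coordinates `(x^λ)`; both belong to the maximal smooth atlases. -/
structure FibredChart (P : FibredManifold n m X Y) where
  base : OpenPartialHomeomorph X (Base n)
  total : OpenPartialHomeomorph Y (Base n × Fib m)
  base_mem : base ∈ IsManifold.maximalAtlas (IX n) ∞ X
  total_mem : total ∈ IsManifold.maximalAtlas (IY n m) ∞ Y
  mapsTo : ∀ y ∈ total.source, P.proj y ∈ base.source
  fst_eq : ∀ y ∈ total.source, (total y).1 = base (P.proj y)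

namespace FibredChart

variable {P : FibredManifold n m X Y}

/-- The tangent map `T_x X → ℝⁿ` of the chart of the base. -/
def dBase (φ : FibredChart P) (y : Y) : P.TX y →L[ℝ] Base n :=
  (NormedSpace.fromTangentSpace (𝕜 := ℝ) (φ.base (P.proj y))).toContinuousLinearMap.comp
    (mfderiv (IX n) (IX n) φ.base (P.proj y))

/-- The tangent map `T_y Y → ℝⁿ × ℝᵐ` of the chart of the total space. -/
def dTotal (φ : FibredChart P) (y : Y) : P.TY y →L[ℝ] Base n × Fib m :=
  (NormedSpace.fromTangentSpace (𝕜 := ℝ) (φ.total y)).toContinuousLinearMap.comp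
    (mfderiv (IY n m) (IY n m) φ.total y)

theorem dBase_isInvertible (φ : FibredChart P) {y : Y} (hy : y ∈ φ.total.source) :
    (φ.dBase y).IsInvertible := by
  have hd : φ.base.MDifferentiable (IX n) (IX n) :=
    ⟨fun x hx => ((contMDiffOn_of_mem_maximalAtlas φ.base_mem) x hx).mdifferentiableWithinAt
        (by simp),
      fun x hx => ((contMDiffOn_symm_of_mem_maximalAtlas φ.base_mem) x hx).mdifferentiableWithinAt
        (by simp)⟩
  refine ⟨(hd.mfderiv (φ.mapsTo y hy)).trans (NormedSpace.fromTangentSpace _), ?_⟩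
  rfl

theorem dTotal_isInvertible (φ : FibredChart P) {y : Y} (hy : y ∈ φ.total.source) :
    (φ.dTotal y).IsInvertible := by
  have hd : φ.total.MDifferentiable (IY n m) (IY n m) :=
    ⟨fun x hx => ((contMDiffOn_of_mem_maximalAtlas φ.total_mem) x hx).mdifferentiableWithinAt
        (by simp),
      fun x hx => ((contMDiffOn_symm_of_mem_maximalAtlas φ.total_mem) x hx).mdifferentiableWithinAt
        (by simp)⟩
  refine ⟨(hd.mfderiv hy).trans (NormedSpace.fromTangentSpace _), ?_⟩
  rfl

/-- The coordinate frame `∂_1, …, ∂_n` of `T_x X`. -/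
def frame (φ : FibredChart P) (y : Y) (lam : Fin n) : P.TX y :=
  (φ.dBase y).inverse (EuclideanSpace.single lam 1)

/-- The coordinate vector `∂_i = ∂/∂y^i` in `T_y Y`. -/
def vertVec (φ : FibredChart P) (y : Y) (i : Fin m) : P.TY y :=
  (φ.dTotal y).inverse (0, EuclideanSpace.single i 1)

theorem dBase_dproj (φ : FibredChart P) {y : Y} (hy : y ∈ φ.total.source) (w : P.TY y) :
    φ.dBase y (P.dproj y w) = (φ.dTotal y w).1 := by
  have hb : MDifferentiableAt (IX n) (IX n) φ.base (P.proj y) :=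
    (contMDiffAt_of_mem_maximalAtlas φ.base_mem (φ.mapsTo y hy)).mdifferentiableAt (by simp)
  have ht : MDifferentiableAt (IY n m) (IY n m) φ.total y :=
    (contMDiffAt_of_mem_maximalAtlas φ.total_mem hy).mdifferentiableAt (by simp)
  have hP : MDifferentiableAt (IY n m) (IX n) P.proj y :=
    (P.submersion.contMDiff y).mdifferentiableAt (by simp)
  have hf : MDifferentiableAt (IY n m) (IX n) (Prod.fst : Base n × Fib m → Base n)
      (φ.total y) := differentiableAt_fst.mdifferentiableAt
  have heq : (φ.base ∘ P.proj) =ᶠ[nhds y] (Prod.fst ∘ φ.total) := by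
    filter_upwards [φ.total.open_source.mem_nhds hy] with z hz
    exact (φ.fst_eq z hz).symm
  have h1 := mfderiv_comp y hb hP
  have h2 := mfderiv_comp y hf ht
  rw [heq.mfderiv_eq, h2, mfderiv_eq_fderiv, fderiv_fst] at h1
  have h3 := congrArg (fun f => f w) h1
  exact h3.symm

theorem vertVec_mem (φ : FibredChart P) {y : Y} (hy : y ∈ φ.total.source) (i : Fin m) :
    φ.vertVec y i ∈ P.VY y := by
  have h : φ.dBase y (P.dproj y (φ.vertVec y i)) = 0 := by
    rw [φ.dBase_dproj hy, vertVec]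
    obtain ⟨e, he⟩ := φ.dTotal_isInvertible hy
    rw [← he]
    simp
  obtain ⟨e, he⟩ := φ.dBase_isInvertible hy
  rw [← he] at h
  simpa using h

/-- The coordinates `y^i_lam` of an element of `T*X ⊗ VY`. -/
def soldCoord (φ : FibredChart P) (y : Y) (v : P.Sold y) (lam : Fin n) (i : Fin m) : ℝ :=
  (φ.dTotal y (v (φ.frame y lam) : P.TY y)).2 i

/-- The coordinates `y^i_lam` of a jet `dx^lam ⊗ (∂_lam + y^i_lam ∂_i)`. -/
def jetCoord (φ : FibredChart P) (y : Y) (j : P.Jet y) (lam : Fin n) (i : Fin m) : ℝ :=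
  (φ.dTotal y (j.toLin (φ.frame y lam))).2 i

open Classical in
/-- The basis element `dx^lam ⊗ ∂_i` of `T*X ⊗ VY` (over the domain of the chart). -/
def unitSold (φ : FibredChart P) (y : Y) (lam : Fin n) (i : Fin m) : P.Sold y :=
  if hy : y ∈ φ.total.source then
    ((EuclideanSpace.proj lam : Base n →L[ℝ] ℝ).comp (φ.dBase y)).smulRight
      (⟨φ.vertVec y i, φ.vertVec_mem hy i⟩ : P.VY y)
  else 0

/-- The coordinates `p^lam_i` of a momentum: its value on `dx^lam ⊗ ∂_i` is `p^lam_i ω`, where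
`ω = dx^1 ∧ … ∧ dx^n`. -/
def momCoord (φ : FibredChart P) (y : Y) (p : P.Mom y) (lam : Fin n) (i : Fin m) : ℝ :=
  p (φ.unitSold y lam i) (φ.frame y)

/-- The set of all `(x^μ, y^i, z)` with `(x^μ, y^i)` in the range of the chart. -/
def dom (φ : FibredChart P) : Set (Coord n m) := {c | c.1 ∈ φ.total.target}

end FibredChart

/-! ### Sections -/

/-- A (global, smooth) section of `Y → X`. -/
structure Sec (P : FibredManifold n m X Y) where
  toFun : X → Y
  isSection : ∀ x, P.proj (toFun x) = x
  smooth : ContMDiff (IX n) (IY n m) ∞ toFun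

/-- A section of `J¹Y → X`. -/
structure JetSec (P : FibredManifold n m X Y) where
  toFun : X → Σ y : Y, P.Jet y
  isSection : ∀ x, P.proj (toFun x).1 = x
  smooth_base : ContMDiff (IX n) (IY n m) ∞ fun x => (toFun x).1
  smooth_coord : ∀ (φ : FibredChart P) (lam : Fin n) (i : Fin m),
    ContMDiffOn (IX n) 𝓘(ℝ, ℝ) ∞ (fun x => φ.jetCoord (toFun x).1 (toFun x).2 lam i)
      {x | (toFun x).1 ∈ φ.total.source}

/-- A section of `Π → X`. -/
structure MomSec (P : FibredManifold n m X Y) where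
  toFun : X → Σ y : Y, P.Mom y
  isSection : ∀ x, P.proj (toFun x).1 = x
  smooth_base : ContMDiff (IX n) (IY n m) ∞ fun x => (toFun x).1
  smooth_coord : ∀ (φ : FibredChart P) (lam : Fin n) (i : Fin m),
    ContMDiffOn (IX n) 𝓘(ℝ, ℝ) ∞ (fun x => φ.momCoord (toFun x).1 (toFun x).2 lam i)
      {x | (toFun x).1 ∈ φ.total.source}

/-- The projection `s = π_{ΠY} ∘ r` of a section of `Π → X` to a section of `Y → X`. -/
def MomSec.toSec {P : FibredManifold n m X Y} (r : MomSec P) : Sec P :=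
  ⟨fun x => (r.toFun x).1, r.isSection, r.smooth_base⟩

/-- The identification of the tangent spaces at two equal points. -/
def tangentCongr {x x' : X} (h : x = x') : TangentSpace (IX n) x →L[ℝ] TangentSpace (IX n) x' :=
  h ▸ ContinuousLinearMap.id ℝ (TangentSpace (IX n) x)

theorem mfderiv_eq_id_comp_tangentCongr {f : X → X} (hf : f = id) (x : X) (h : f x = x) :
    (mfderiv (IX n) (IX n) f x).comp (tangentCongr h) =
      ContinuousLinearMap.id ℝ (TangentSpace (IX n) (f x)) := by
  subst hf
  rw [mfderiv_id]
  rfl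

/-- The jet prolongation `J¹s` of a section `s`. -/
def Sec.prolong {P : FibredManifold n m X Y} (s : Sec P) (x : X) : P.Jet (s.toFun x) where
  toLin := (mfderiv (IX n) (IY n m) s.toFun x).comp (tangentCongr (s.isSection x))
  isSection := by
    have hs : MDifferentiableAt (IX n) (IY n m) s.toFun x :=
      (s.smooth x).mdifferentiableAt (by simp)
    have hP : MDifferentiableAt (IY n m) (IX n) P.proj (s.toFun x) :=
      (P.submersion.contMDiff (s.toFun x)).mdifferentiableAt (by simp)
    have hid : P.proj ∘ s.toFun = id := funext s.isSection
    have h := mfderiv_eq_id_comp_tangentCongr (n := n) hid x (s.isSection x)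
    rw [mfderiv_comp x hP hs] at h
    exact h

/-! ### Connections, Lagrangian densities, linear pullback-valued forms -/

/-- A connection on `Y → X`: a global smooth section `Γ` of the jet bundle `J¹Y → Y`. -/
structure Connection (P : FibredManifold n m X Y) where
  toFun : ∀ y : Y, P.Jet y
  smooth : ∀ (φ : FibredChart P) (lam : Fin n) (i : Fin m),
    ContMDiffOn (IY n m) 𝓘(ℝ, ℝ) ∞ (fun y => φ.jetCoord y (toFun y) lam i) φ.total.source

/-- In the chart `φ`, the linear maps `σ` are `y^i_λ ∘ σ = s^{ij}_{λμ} p^μ_j`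
(the coefficient is written `s y λ i μ j`). -/
def IsFormExpr {P : FibredManifold n m X Y} (φ : FibredChart P)
    (σ : ∀ y : Y, P.Mom y →ₗ[ℝ] P.Sold y) (s : Y → Fin n → Fin m → Fin n → Fin m → ℝ) : Prop :=
  ∀ y ∈ φ.total.source, ∀ (p : P.Mom y) (lam : Fin n) (i : Fin m),
    φ.soldCoord y (σ y p) lam i = ∑ mu, ∑ j, s y lam i mu j * φ.momCoord y p mu j

/-- A linear pullback-valued horizontal 1-form `σ : Π → T*X ⊗ VY` over `Y`. -/
structure LinForm (P : FibredManifold n m X Y) where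
  toFun : ∀ y : Y, P.Mom y →ₗ[ℝ] P.Sold y
  smooth : ∀ φ : FibredChart P, ∃ s : Y → Fin n → Fin m → Fin n → Fin m → ℝ,
    IsFormExpr φ toFun s ∧ ∀ lam i mu j,
      ContMDiffOn (IY n m) 𝓘(ℝ, ℝ) ∞ (fun y => s y lam i mu j) φ.total.source

/-- Symmetry `σ^{ij}_{λμ} = σ^{ji}_{μλ}`, that is `⟨q, σ p⟩ = ⟨p, σ q⟩`. -/
def LinForm.IsSymm {P : FibredManifold n m X Y} (σ : LinForm P) : Prop :=
  ∀ (y : Y) (p q : P.Mom y), q (σ.toFun y p) = p (σ.toFun y q)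

/-- A first order Lagrangian density `L : J¹Y → Λⁿ T*X` (over `Y`). -/
abbrev LagDensity (P : FibredManifold n m X Y) := ∀ y : Y, P.Jet y → P.Density y

/-- `L = ℓ(x^μ, y^i, y^i_λ) ω` in the chart `φ`. -/
def IsLagExpr {P : FibredManifold n m X Y} (φ : FibredChart P) (L : LagDensity P)
    (l : Coord n m → ℝ) : Prop :=
  ∀ y ∈ φ.total.source, ∀ j : P.Jet y,
    L y j (φ.frame y) = l (φ.total y, φ.jetCoord y j)

/-- `L = (½ a^{λμ}_{ij} y^i_λ y^j_μ + b^λ_i y^i_λ + c) ω` in the chart `φ`, with functions `a`, `b`,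
`c` on the domain of `φ`; `a` is symmetric, and `a^{λμ}_{ij}` is written `a y λ i μ j`. -/
def IsQuadExpr {P : FibredManifold n m X Y} (φ : FibredChart P) (L : LagDensity P)
    (a : Y → Fin n → Fin m → Fin n → Fin m → ℝ) (b : Y → Fin n → Fin m → ℝ) (c : Y → ℝ) : Prop :=
  (∀ y lam i mu j, a y lam i mu j = a y mu j lam i) ∧
  ∀ y ∈ φ.total.source, ∀ jt : P.Jet y,
    L y jt (φ.frame y) =
      1 / 2 * (∑ lam, ∑ i, ∑ mu, ∑ j,
        a y lam i mu j * φ.jetCoord y jt lam i * φ.jetCoord y jt mu j)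
      + (∑ lam, ∑ i, b y lam i * φ.jetCoord y jt lam i) + c y

/-- A (smooth) quadratic Lagrangian density. -/
def IsQuadratic {P : FibredManifold n m X Y} (L : LagDensity P) : Prop :=
  ∀ φ : FibredChart P, ∃ (a : Y → Fin n → Fin m → Fin n → Fin m → ℝ)
    (b : Y → Fin n → Fin m → ℝ) (c : Y → ℝ), IsQuadExpr φ L a b c ∧
    (∀ lam i mu j,
      ContMDiffOn (IY n m) 𝓘(ℝ, ℝ) ∞ (fun y => a y lam i mu j) φ.total.source) ∧
    (∀ lam i, ContMDiffOn (IY n m) 𝓘(ℝ, ℝ) ∞ (fun y => b y lam i) φ.total.source) ∧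
    ContMDiffOn (IY n m) 𝓘(ℝ, ℝ) ∞ c φ.total.source

open Classical in
/-- The Legendre morphism `J¹Y → Π` over `Y`: the derivative of `L` along the fibres of
`J¹Y → Y`, in coordinates `p^λ_i = ∂ℓ/∂y^i_λ`. (The value `0` is taken at jets where `L` has no
fibre derivative; there are none for a quadratic `L`.) -/
def legendre {P : FibredManifold n m X Y} (L : LagDensity P) (y : Y) (j : P.Jet y) : P.Mom y :=
  if h : ∃ p : P.Mom y, ∀ (v : P.Sold y) (w : Fin n → P.TX y),
      HasDerivAt (fun t : ℝ => L y ((t • v) +ᵥ j) w) (p v w) 0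
  then h.choose else 0

theorem legendre_eq {P : FibredManifold n m X Y} (L : LagDensity P) (y : Y) (j : P.Jet y)
    (p : P.Mom y) (hp : ∀ (v : P.Sold y) (w : Fin n → P.TX y),
      HasDerivAt (fun t : ℝ => L y ((t • v) +ᵥ j) w) (p v w) 0) : legendre L y j = p := by
  have h : ∃ p : P.Mom y, ∀ (v : P.Sold y) (w : Fin n → P.TX y),
      HasDerivAt (fun t : ℝ => L y ((t • v) +ᵥ j) w) (p v w) 0 := ⟨p, hp⟩
  rw [legendre, dif_pos h]
  ext v w
  exact (h.choose_spec v w).unique (hp v w)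

open Classical in
/-- The linear morphism `T*X ⊗ VY → Π` over `Y` underlying an affine Legendre morphism,
in coordinates `p^λ_i = a^{λμ}_{ij} y^j_μ`. -/
def linLegendre {P : FibredManifold n m X Y} (L : LagDensity P) (y : Y) :
    P.Sold y →ₗ[ℝ] P.Mom y :=
  if h : ∃ A : P.Sold y →ₗ[ℝ] P.Mom y, ∀ (v : P.Sold y) (j : P.Jet y),
      legendre L y (v +ᵥ j) = A v + legendre L y j
  then h.choose else 0

/-- The fibre at `y` of the constraint space `Q`, the image of the Legendre morphism. -/
def constraint {P : FibredManifold n m X Y} (L : LagDensity P) (y : Y) : Set (P.Mom y) :=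
  Set.range (legendre L y)

/-- The connection `Γ` takes values in the kernel of the Legendre morphism. -/
def Connection.InKer {P : FibredManifold n m X Y} (Γ : Connection P) (L : LagDensity P) : Prop :=
  ∀ y, legendre L y (Γ.toFun y) = 0

/-- `L` is semiregular: the preimage under the Legendre morphism of every point of the constraint
space is a connected submanifold of `J¹Y`. (The preimage of a point over `y` lies over `y`.) -/
def IsSemiregular {P : FibredManifold n m X Y} (L : LagDensity P) : Prop :=
  ∀ (φ : FibredChart P), ∀ y ∈ φ.total.source, ∀ p ∈ constraint L y,
    IsConnected ((fun j : P.Jet y => ((φ.total y, φ.jetCoord y j) : Coord n m)) ''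
      {j | legendre L y j = p}) ∧
    IsEmbeddedSubmanifold ((fun j : P.Jet y => ((φ.total y, φ.jetCoord y j) : Coord n m)) ''
      {j | legendre L y j = p})

/-- `L` is almost regular: the constraint space `Q` is an embedded submanifold of `Π`, and the
Legendre morphism `J¹Y → Q` is a submersion (it is surjective by definition of `Q`). In the
coordinates of a chart, `g` is the Legendre morphism, and the image of its differential has to
be the tangent space of `Q`, which a straightening `Φ` of `Q` maps onto `K`. -/
def IsAlmostRegular {P : FibredManifold n m X Y} (L : LagDensity P) : Prop :=
  ∀ (φ : FibredChart P) (g : Coord n m → Coord n m),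
    (∀ y ∈ φ.total.source, ∀ j : P.Jet y,
      g (φ.total y, φ.jetCoord y j) = (φ.total y, φ.momCoord y (legendre L y j))) →
    IsEmbeddedSubmanifold (g '' φ.dom) ∧
    ∀ c ∈ φ.dom, ∀ (Φ : OpenPartialHomeomorph (Coord n m) (Coord n m))
      (K : Submodule ℝ (Coord n m)), IsSliceChart (g '' φ.dom) (g c) Φ K →
      LinearMap.range (fderiv ℝ (Φ ∘ g) c : Coord n m →ₗ[ℝ] Coord n m) = K

/-! ### Hamiltonian forms -/

/-- A momentum morphism `Π → J¹Y` over `Y` (smoothness is not part of this definition). -/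
abbrev MomMorphism (P : FibredManifold n m X Y) := ∀ y : Y, P.Mom y → P.Jet y

/-- The type of (not necessarily smooth) forms `H` on `Π`. A form
`H = p^λ_i dy^i ∧ ω_λ - η ω` is recorded through its pullbacks along jets: the pullback of `H` at
the momentum `p` along the jet `j` (the substitution `dy^i = y^i_λ dx^λ`) is the density
`H y p j = (p^λ_i y^i_λ - η) ω`. This is an affine function of `j` with linear part `p`, and it is
the description of `H` as a section of the bundle `Z → Π`, `Z = Λⁿ⁻¹ T*X ∧ T*Y`, whose fibre over
`y` consists of the affine maps from `J¹Y` to `Λⁿ T*X` over `y`. -/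
abbrev HamForm (P : FibredManifold n m X Y) := ∀ y : Y, P.Mom y → P.Jet y → P.Density y

/-- `H = p^λ_i dy^i ∧ ω_λ - η(x^μ, y^i, p^λ_i) ω` in the chart `φ`. -/
def IsHamExpr {P : FibredManifold n m X Y} (φ : FibredChart P) (H : HamForm P)
    (η : Coord n m → ℝ) : Prop :=
  ∀ y ∈ φ.total.source, ∀ (p : P.Mom y) (j : P.Jet y),
    H y p j (φ.frame y) =
      (∑ lam, ∑ i, φ.momCoord y p lam i * φ.jetCoord y j lam i) - η (φ.total y, φ.momCoord y p)

/-- `H` is a Hamiltonian form: `H = p^λ_i dy^i ∧ ω_λ - η ω` with smooth local functions `η`. -/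
def IsHamiltonian {P : FibredManifold n m X Y} (H : HamForm P) : Prop :=
  (∀ (y : Y) (p : P.Mom y) (v : P.Sold y) (j : P.Jet y), H y p (v +ᵥ j) = p v + H y p j) ∧
  ∀ φ : FibredChart P, ∃ η : Coord n m → ℝ, IsHamExpr φ H η ∧ ContDiffOn ℝ ∞ η φ.dom

/-- `Φ` is the momentum morphism of `H`: `y^i_λ ∘ Φ = ∂η/∂p^λ_i`. -/
def IsMomMorphismOf {P : FibredManifold n m X Y} (H : HamForm P) (Φ : MomMorphism P) : Prop :=
  ∀ (φ : FibredChart P) (η : Coord n m → ℝ), IsHamExpr φ H η →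
    ∀ y ∈ φ.total.source, ∀ (p : P.Mom y) (lam : Fin n) (i : Fin m),
      φ.jetCoord y (Φ y p) lam i = pd η (φ.total y, φ.momCoord y p) (dirZ lam i)

/-- The form `H_Φ + L ∘ Φ` of a momentum morphism `Φ`, where
`H_Φ = p^λ_i dy^i ∧ ω_λ - p^λ_i Φ^i_λ ω`. -/
def hamOf {P : FibredManifold n m X Y} (L : LagDensity P) (Φ : MomMorphism P) : HamForm P :=
  fun y p j => p (j -ᵥ Φ y p) + L y (Φ y p)

/-- The Hamiltonian form `H` is associated with `L`: if `Φ` is the momentum morphism of `H`, then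
the Legendre morphism composed with `Φ` is the identity on the constraint space, and
`H = H_Φ + L ∘ Φ`. -/
def IsAssociated {P : FibredManifold n m X Y} (L : LagDensity P) (H : HamForm P) : Prop :=
  IsHamiltonian H ∧ ∃ Φ : MomMorphism P, IsMomMorphismOf H Φ ∧
    (∀ (y : Y), ∀ p ∈ constraint L y, legendre L y (Φ y p) = p) ∧ H = hamOf L Φ

/-- The affine momentum morphism `Φ = Γ + σ`. -/
def affMor {P : FibredManifold n m X Y} (Γ : Connection P) (σ : LinForm P) : MomMorphism P :=
  fun y p => σ.toFun y p +ᵥ Γ.toFun y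

/-- The form `H` built from a connection `Γ` with values in the kernel of the Legendre morphism and
from a linear `σ`; since `L ∘ Γ = (½ b^λ_i Γ^i_λ + c) ω`, its coordinate expression is
`p^λ_i dy^i ∧ ω_λ - (Γ^i_λ (p^λ_i - ½ b^λ_i) + ½ σ^{ij}_{λμ} p^λ_i p^μ_j - c) ω`. -/
def quadHam {P : FibredManifold n m X Y} (L : LagDensity P) (Γ : Connection P) (σ : LinForm P) :
    HamForm P :=
  fun y p j => p (j -ᵥ Γ.toFun y) - (1 / 2 : ℝ) • p (σ.toFun y p) + L y (Γ.toFun y)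

/-- In the chart `φ`, the form `H` is
`p^λ_i dy^i ∧ ω_λ - (Γ^i_λ (p^λ_i - ½ b^λ_i) + ½ σ^{ij}_{λμ} p^λ_i p^μ_j - c) ω`. -/
def IsQuadHamExpr {P : FibredManifold n m X Y} (φ : FibredChart P) (H : HamForm P)
    (Γ : Connection P) (s : Y → Fin n → Fin m → Fin n → Fin m → ℝ)
    (b : Y → Fin n → Fin m → ℝ) (c : Y → ℝ) : Prop :=
  ∀ y ∈ φ.total.source, ∀ (p : P.Mom y) (jt : P.Jet y),
    H y p jt (φ.frame y) =
      (∑ lam, ∑ i, φ.momCoord y p lam i * φ.jetCoord y jt lam i) -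
      ((∑ lam, ∑ i, φ.jetCoord y (Γ.toFun y) lam i * (φ.momCoord y p lam i - 1 / 2 * b y lam i))
        + 1 / 2 * (∑ lam, ∑ i, ∑ mu, ∑ j,
            s y lam i mu j * φ.momCoord y p lam i * φ.momCoord y p mu j)
        - c y)

/-! ### Equations -/

/-- The coordinate expression of a section of `J¹Y → X`. -/
def JetSec.rep {P : FibredManifold n m X Y} (sb : JetSec P) (φ : FibredChart P) (u : Base n) :
    Coord n m :=
  (φ.total (sb.toFun (φ.base.symm u)).1,
    φ.jetCoord (sb.toFun (φ.base.symm u)).1 (sb.toFun (φ.base.symm u)).2)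

/-- The coordinate expression of a section of `Π → X`. -/
def MomSec.rep {P : FibredManifold n m X Y} (r : MomSec P) (φ : FibredChart P) (u : Base n) :
    Coord n m :=
  (φ.total (r.toFun (φ.base.symm u)).1,
    φ.momCoord (r.toFun (φ.base.symm u)).1 (r.toFun (φ.base.symm u)).2)

/-- The first order Euler-Lagrange equations for a section `(s^i, s^i_λ)` of `J¹Y → X`:
`∂_λ s^i = s^i_λ` and
`∂_i ℓ - (∂_λ + s^j_λ ∂_j + ∂_λ s^j_μ ∂/∂y^j_μ) (∂ℓ/∂y^i_λ) = 0`. -/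
def SolvesEulerLagrange {P : FibredManifold n m X Y} (L : LagDensity P) (sb : JetSec P) : Prop :=
  ∀ (φ : FibredChart P) (l : Coord n m → ℝ), IsLagExpr φ L l →
    ∀ x : X, (sb.toFun x).1 ∈ φ.total.source →
      let u := φ.base x
      let q := sb.rep φ u
      let mom : Fin n → Fin m → Coord n m → ℝ := fun lam i c => pd l c (dirZ lam i)
      (∀ (lam : Fin n) (i : Fin m), pdBase (fun u' => (sb.rep φ u').1.2 i) u lam = q.2 lam i) ∧
      ∀ i : Fin m,
        pd l q (dirY i) - (∑ lam,
          (pd (mom lam i) q (dirX lam)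
            + (∑ j, q.2 lam j * pd (mom lam i) q (dirY j))
            + ∑ mu, ∑ j, pdBase (fun u' => (sb.rep φ u').2 mu j) u lam
                * pd (mom lam i) q (dirZ mu j))) = 0

/-- The first group of Hamilton equations: `∂_λ r^i = ∂η/∂p^λ_i`. -/
def SolvesHamiltonFst {P : FibredManifold n m X Y} (H : HamForm P) (r : MomSec P) : Prop :=
  ∀ (φ : FibredChart P) (η : Coord n m → ℝ), IsHamExpr φ H η →
    ∀ x : X, (r.toFun x).1 ∈ φ.total.source → ∀ (lam : Fin n) (i : Fin m),
      pdBase (fun u' => (r.rep φ u').1.2 i) (φ.base x) lam =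
        pd η (r.rep φ (φ.base x)) (dirZ lam i)

/-- The second group of Hamilton equations: `∂_λ r^λ_i = - ∂η/∂y^i`. -/
def SolvesHamiltonSnd {P : FibredManifold n m X Y} (H : HamForm P) (r : MomSec P) : Prop :=
  ∀ (φ : FibredChart P) (η : Coord n m → ℝ), IsHamExpr φ H η →
    ∀ x : X, (r.toFun x).1 ∈ φ.total.source → ∀ i : Fin m,
      (∑ lam, pdBase (fun u' => (r.rep φ u').2 lam i) (φ.base x) lam) =
        - pd η (r.rep φ (φ.base x)) (dirY i)

/-- A family `F` of Hamiltonian forms associated with the semiregular Lagrangian density `L` is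
complete if, for every solution `sb` of the first order Euler-Lagrange equations, there is a
solution `r` of the Hamilton equations of some `H` in `F`, with momentum morphism `Φ`, such that
`r` is the image of `sb` under the Legendre morphism, `sb = Φ ∘ r` and
`sb = J¹(π_{ΠY} ∘ r)`. -/
def IsCompleteFamily {P : FibredManifold n m X Y} (L : LagDensity P) (F : Set (HamForm P)) :
    Prop :=
  IsSemiregular L ∧ (∀ H ∈ F, IsAssociated L H) ∧
  ∀ sb : JetSec P, SolvesEulerLagrange L sb →
    ∃ H ∈ F, ∃ (Φ : MomMorphism P) (r : MomSec P), IsMomMorphismOf H Φ ∧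
      SolvesHamiltonFst H r ∧ SolvesHamiltonSnd H r ∧
      ∀ x : X, r.toFun x = ⟨(sb.toFun x).1, legendre L _ (sb.toFun x).2⟩ ∧
        sb.toFun x = ⟨(r.toFun x).1, Φ _ (r.toFun x).2⟩ ∧
        sb.toFun x = ⟨r.toSec.toFun x, r.toSec.prolong x⟩

/-! ### The two projections of the jet bundle -/

/-- `F = σ ∘ (Legendre morphism)`, with values in `Im σ`. -/
def dynProj {P : FibredManifold n m X Y} (L : LagDensity P) (σ : LinForm P) (y : Y)
    (j : P.Jet y) : P.Sold y :=
  σ.toFun y (legendre L y j)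

/-- `S : y^i_λ ↦ y^i_λ - σ^{ik}_{λα} (a^{αμ}_{kj} y^j_μ + b^α_k)`. -/
def gaugeProj {P : FibredManifold n m X Y} (L : LagDensity P) (σ : LinForm P) (y : Y)
    (j : P.Jet y) : P.Jet y :=
  (-dynProj L σ y j) +ᵥ j

/-- `L̄ ∘ σ ∘ i_Q = i_Q`, where `L̄` is the linear part of the Legendre morphism. -/
def LinForm.SectionOn {P : FibredManifold n m X Y} (σ : LinForm P) (L : LagDensity P) : Prop :=
  ∀ (y : Y), ∀ p ∈ constraint L y, linLegendre L y (σ.toFun y p) = p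

/-- `σ = σ ∘ L̄ ∘ σ`. -/
def LinForm.Reflexive {P : FibredManifold n m X Y} (σ : LinForm P) (L : LagDensity P) : Prop :=
  ∀ (y : Y) (p : P.Mom y), σ.toFun y (linLegendre L y (σ.toFun y p)) = σ.toFun y p

end

end Multimomentum

end

noncomputable section

namespace Multimomentum

/-! ### Adapted charts and the linear coordinates of jets, momenta and densities -/

section

variable {n m : ℕ} {X Y : Type*}
  [TopologicalSpace X] [ChartedSpace (Base n) X]
  [TopologicalSpace Y] [ChartedSpace (Base n × Fib m) Y]

/-! Over a fixed point `y` the theorem is linear algebra. Write `A` for `linLegendre L y`. As `L` is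
quadratic, the Legendre morphism is affine with symmetric linear part `A`, and the Taylor expansion
of `L` along the fibre stops at second order (`IsQuadratic.legendre_vadd`,
`IsQuadratic.linLegendre_symm`, `IsQuadratic.apply_vadd`). Since the Legendre morphism vanishes
somewhere in every fibre, `Q = Im A`, and `σ` is a section of `A` over `Q` exactly when `A σ A = A`:
it is a generalized inverse. The splittings follow from `A σ A = A` and `σ A σ = σ`. For symmetric
`σ` the forms `hamOf L (affMor Γ σ)` and `quadHam L Γ σ` differ by the quadratic form `½ p(σ A σ p -
σ p)` (`hamOf_affMor_apply`), and polarization turns its vanishing into `σ A σ = σ`.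

The analytic core is the existence of a smooth `σ`. Almost regularity forces the rank of `A` to be
locally constant (`IsQuadExpr.eventually_finrank_ker`). Near an operator `A₀`, the operators of the
same rank have a smooth generalized inverse, obtained by compressing to the range of `A₀` and
inverting there (`exists_smooth_generalized_inverse`). Symmetry and `A σ A = A` are convex
conditions, so a partition of unity glues the local solutions, and `σ A σ` is then reflexive as well
(`exists_linForm`). Connections are glued in the same way, if desired under the convex condition `Γ
∘ s = J¹s`; composing with the projection `S` moves them into the kernel of the Legendre morphism
(`exists_connection_gaugeProj`).

For completeness, a solution of the Euler-Lagrange equations is `J¹s` by the first group. Choose `Γ`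
with `S ∘ J¹s = Γ ∘ s` and let `r` be the Legendre image of `J¹s`. Then `Φ ∘ r = J¹s`, which is the
first group of Hamilton equations. For the second group, the Hamiltonian is `p·Φ - ℓ(Φ)`; on `Q` the
fibre derivative of `ℓ` at `Φ(p)` is `p`, so the variation of `Φ` cancels and `∂η/∂y = -∂ℓ/∂y`
(`pd_quadHam_dirY`). The second Euler-Lagrange group says that the divergence of the momenta of `r`
is `∂ℓ/∂y` (`SolvesEulerLagrange.sum_pdBase_legendreSec`). -/

theorem FibredManifold.exists_chart [IsManifold (IY n m) ∞ Y] (P : FibredManifold n m X Y) (y : Y) :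
    ∃ φ : FibredChart P, y ∈ φ.total.source := by
  have h := P.submersion.isSubmersionAt y
  let F := h.complement
  have : FiniteDimensional ℝ F :=
    Module.Finite.of_surjective
      ((LinearMap.snd ℝ (Base n) F).comp (h.equiv : (Base n × Fib m) →ₗ[ℝ] Base n × F))
      (Prod.snd_surjective.comp h.equiv.surjective)
  -- The normal form of the submersion yields a product of `Base n` with some complement `F`;
  -- counting dimensions identifies `F` with `Fib m`, and `T` corrects the chart of `Y` accordingly.
  have hdim : Module.finrank ℝ F = Module.finrank ℝ (Fib m) := by
    have h1 := h.equiv.toLinearEquiv.finrank_eq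
    rw [Module.finrank_prod, Module.finrank_prod] at h1
    exact (Nat.add_left_cancel h1).symm
  let e : F ≃L[ℝ] Fib m := ContinuousLinearEquiv.ofFinrankEq hdim
  let T : (Base n × Fib m) ≃L[ℝ] (Base n × Fib m) :=
    h.equiv.trans ((ContinuousLinearEquiv.refl ℝ (Base n)).prodCongr e)
  refine ⟨⟨h.codChart, h.domChart.transHomeomorph T.toHomeomorph, h.codChart_mem_maximalAtlas, ?_,
    fun z hz => h.source_subset_preimage_source hz, ?_⟩, h.mem_domChart_source⟩
  · have hd := h.domChart_mem_maximalAtlas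
    apply OpenPartialHomeomorph.mem_maximalAtlas_of_contMDiffOn
    · exact T.contDiff.contMDiff.comp_contMDiffOn (contMDiffOn_of_mem_maximalAtlas hd)
    · exact (contMDiffOn_symm_of_mem_maximalAtlas hd).comp
        (t := h.domChart.target) T.symm.contDiff.contMDiff.contMDiffOn (fun z hz => hz)
  · intro z hz
    have hz' : z ∈ h.domChart.source := hz
    have hz2 : h.domChart z ∈ (h.domChart.extend (IY n m)).target := by
      simpa using h.domChart.map_source hz'
    have h1 := h.writtenInCharts hz2
    simp only [Function.comp_apply, OpenPartialHomeomorph.extend_coe, modelWithCornersSelf_coe,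
      OpenPartialHomeomorph.extend_coe_symm, modelWithCornersSelf_coe_symm, id_eq,
      h.domChart.left_inv hz'] at h1
    exact h1.symm

namespace FibredChart

variable {P : FibredManifold n m X Y} (φ : FibredChart P) {y : Y}

/-- The tangent map of the chart of the base, as an isomorphism. -/
def baseEquiv (hy : y ∈ φ.total.source) : P.TX y ≃L[ℝ] Base n := (φ.dBase_isInvertible hy).choose

theorem coe_baseEquiv (hy : y ∈ φ.total.source) :
    (φ.baseEquiv hy : P.TX y →L[ℝ] Base n) = φ.dBase y :=
  (φ.dBase_isInvertible hy).choose_spec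

/-- The tangent map of the chart of the total space, as an isomorphism. -/
def totalEquiv (hy : y ∈ φ.total.source) : P.TY y ≃L[ℝ] Base n × Fib m :=
  (φ.dTotal_isInvertible hy).choose

theorem coe_totalEquiv (hy : y ∈ φ.total.source) :
    (φ.totalEquiv hy : P.TY y →L[ℝ] Base n × Fib m) = φ.dTotal y :=
  (φ.dTotal_isInvertible hy).choose_spec

theorem dBase_apply (hy : y ∈ φ.total.source) (u : P.TX y) : φ.dBase y u = φ.baseEquiv hy u := by
  rw [← coe_baseEquiv φ hy]; rfl

theorem dTotal_apply (hy : y ∈ φ.total.source) (w : P.TY y) :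
    φ.dTotal y w = φ.totalEquiv hy w := by
  rw [← coe_totalEquiv φ hy]; rfl

theorem frame_eq (hy : y ∈ φ.total.source) (lam : Fin n) :
    φ.frame y lam = (φ.baseEquiv hy).symm (EuclideanSpace.single lam 1) := by
  rw [frame, ← coe_baseEquiv φ hy, ContinuousLinearMap.inverse_equiv]; rfl

theorem vertVec_eq (hy : y ∈ φ.total.source) (i : Fin m) :
    φ.vertVec y i = (φ.totalEquiv hy).symm (0, EuclideanSpace.single i 1) := by
  rw [vertVec, ← coe_totalEquiv φ hy, ContinuousLinearMap.inverse_equiv]; rfl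

@[simp]
theorem dBase_frame (hy : y ∈ φ.total.source) (lam : Fin n) :
    φ.dBase y (φ.frame y lam) = EuclideanSpace.single lam 1 := by
  rw [frame_eq φ hy, dBase_apply φ hy, ContinuousLinearEquiv.apply_symm_apply]

@[simp]
theorem dTotal_vertVec (hy : y ∈ φ.total.source) (i : Fin m) :
    φ.dTotal y (φ.vertVec y i) = (0, EuclideanSpace.single i 1) := by
  rw [vertVec_eq φ hy, dTotal_apply φ hy, ContinuousLinearEquiv.apply_symm_apply]

/-- The coordinate frame as a basis of `T_x X`. -/
def frameBasis (hy : y ∈ φ.total.source) : Module.Basis (Fin n) ℝ (P.TX y) :=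
  (EuclideanSpace.basisFun (Fin n) ℝ).toBasis.map (φ.baseEquiv hy).symm.toLinearEquiv

theorem coe_frameBasis (hy : y ∈ φ.total.source) : ⇑(φ.frameBasis hy) = φ.frame y := by
  ext1 lam
  rw [frame_eq φ hy]
  simp [frameBasis]

theorem eq_sum_frame (hy : y ∈ φ.total.source) (u : P.TX y) :
    u = ∑ lam, φ.dBase y u lam • φ.frame y lam := by
  have h := (φ.frameBasis hy).sum_repr u
  rw [coe_frameBasis] at h
  conv_lhs => rw [← h]
  simp [frameBasis, dBase_apply φ hy]

/-- Alternating `n`-forms on an `n`-dimensional space form a line. Every identity between densities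
thereby becomes an identity between numbers, the values on the frame. -/
theorem density_ext (hy : y ∈ φ.total.source) {D D' : P.Density y}
    (h : D (φ.frame y) = D' (φ.frame y)) : D = D' := by
  rw [D.eq_smul_basis_det (φ.frameBasis hy), D'.eq_smul_basis_det (φ.frameBasis hy),
    coe_frameBasis, h]

/-- The volume form `ω` of the chart. -/
def vol (hy : y ∈ φ.total.source) : P.Density y := (φ.frameBasis hy).det

@[simp]
theorem vol_frame (hy : y ∈ φ.total.source) : φ.vol hy (φ.frame y) = 1 := by
  rw [vol, ← coe_frameBasis φ hy, Module.Basis.det_self]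

theorem density_eq (hy : y ∈ φ.total.source) (D : P.Density y) :
    D = D (φ.frame y) • φ.vol hy :=
  φ.density_ext hy (by simp [vol_frame φ hy])

theorem dTotal_fst_sold (hy : y ∈ φ.total.source) (v : P.Sold y) (u : P.TX y) :
    (φ.dTotal y (v u : P.TY y)).1 = 0 := by
  rw [← φ.dBase_dproj hy]
  have h : P.dproj y (v u : P.TY y) = 0 := (v u).2
  rw [h, map_zero]

theorem dTotal_fst_jet (hy : y ∈ φ.total.source) (j : P.Jet y) (u : P.TX y) :
    (φ.dTotal y (j.toLin u)).1 = φ.dBase y u := by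
  rw [← φ.dBase_dproj hy]
  have h : P.dproj y (j.toLin u) = u := by
    simpa using congrArg (fun f => f u) j.isSection
  rw [h]

variable (y) in
/-- The coordinates of an element of `T*X ⊗ VY`, as a linear map. -/
def soldCoordₗ : P.Sold y →ₗ[ℝ] Fin n → Fin m → ℝ where
  toFun := φ.soldCoord y
  map_add' v w := by ext; simp [soldCoord]
  map_smul' t v := by ext; simp [soldCoord]

@[simp] theorem soldCoordₗ_apply (v : P.Sold y) : φ.soldCoordₗ y v = φ.soldCoord y v := rfl

variable (y) in
/-- The coordinates of a momentum, as a linear map. -/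
def momCoordₗ : P.Mom y →ₗ[ℝ] Fin n → Fin m → ℝ where
  toFun := φ.momCoord y
  map_add' v w := by ext; simp [momCoord]
  map_smul' t v := by ext; simp [momCoord]

@[simp] theorem momCoordₗ_apply (p : P.Mom y) : φ.momCoordₗ y p = φ.momCoord y p := rfl

theorem soldCoord_unitSold (hy : y ∈ φ.total.source) (lam : Fin n) (i : Fin m) :
    φ.soldCoord y (φ.unitSold y lam i) = Pi.single lam (Pi.single i 1) := by
  ext mu j
  simp only [soldCoord, unitSold, hy, dif_pos, ContinuousLinearMap.smulRight_apply,
    ContinuousLinearMap.comp_apply, dBase_frame φ hy, Submodule.coe_smul, map_smul,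
    dTotal_vertVec φ hy]
  by_cases h : mu = lam <;> by_cases h' : j = i <;> simp [h, h']

theorem soldCoord_injective (hy : y ∈ φ.total.source) : Function.Injective (φ.soldCoord y) := by
  intro v w h
  have hb : ∀ lam, v (φ.frame y lam) = w (φ.frame y lam) := by
    intro lam
    apply Subtype.ext
    apply (φ.totalEquiv hy).injective
    rw [← dTotal_apply, ← dTotal_apply]
    refine Prod.ext ?_ ?_
    · rw [dTotal_fst_sold φ hy, dTotal_fst_sold φ hy]
    · ext i
      exact congrFun (congrFun h lam) i
  ext u
  rw [φ.eq_sum_frame hy u]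
  simp only [map_sum, map_smul, hb]

/-- The coordinates `y^i_lam` as a linear isomorphism. -/
def soldEquiv (hy : y ∈ φ.total.source) : P.Sold y ≃ₗ[ℝ] (Fin n → Fin m → ℝ) :=
  LinearEquiv.ofBijective (φ.soldCoordₗ y) ⟨φ.soldCoord_injective hy, fun z => by
    refine ⟨∑ lam, ∑ i, z lam i • φ.unitSold y lam i, ?_⟩
    ext mu j
    simp [soldCoord_unitSold φ hy, map_sum, Finset.sum_apply, Pi.single_apply, ite_apply]⟩

@[simp]
theorem soldCoord_soldEquiv_symm (hy : y ∈ φ.total.source) (z : Fin n → Fin m → ℝ) :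
    φ.soldCoord y ((φ.soldEquiv hy).symm z) = z := (φ.soldEquiv hy).apply_symm_apply z

theorem sold_eq_sum (hy : y ∈ φ.total.source) (v : P.Sold y) :
    v = ∑ lam, ∑ i, φ.soldCoord y v lam i • φ.unitSold y lam i := by
  apply φ.soldCoord_injective hy
  rw [← soldCoordₗ_apply, ← soldCoordₗ_apply]
  ext mu j
  simp [soldCoord_unitSold φ hy, map_sum, Finset.sum_apply, Pi.single_apply, ite_apply]

/-- The pairing of momenta with elements of `T*X ⊗ VY` in coordinates. -/
theorem mom_apply_frame (hy : y ∈ φ.total.source) (p : P.Mom y) (v : P.Sold y) :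
    p v (φ.frame y) = ∑ lam, ∑ i, φ.momCoord y p lam i * φ.soldCoord y v lam i := by
  let ev : P.Density y →ₗ[ℝ] ℝ :=
    { toFun := fun D => D (φ.frame y), map_add' := fun _ _ => rfl, map_smul' := fun _ _ => rfl }
  change (ev.comp p) v = _
  conv_lhs => rw [φ.sold_eq_sum hy v]
  simp only [map_sum, map_smul, smul_eq_mul]
  exact Finset.sum_congr rfl fun lam _ => Finset.sum_congr rfl fun i _ => mul_comm _ _

theorem momCoord_injective (hy : y ∈ φ.total.source) : Function.Injective (φ.momCoord y) := by
  intro p q h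
  ext1 v
  apply φ.density_ext hy
  rw [φ.mom_apply_frame hy, φ.mom_apply_frame hy, h]

/-- The coordinates `p^lam_i` as a linear isomorphism. -/
def momEquiv (hy : y ∈ φ.total.source) : P.Mom y ≃ₗ[ℝ] (Fin n → Fin m → ℝ) :=
  LinearEquiv.ofBijective (φ.momCoordₗ y) ⟨φ.momCoord_injective hy, fun z => by
    -- The momentum sought is contraction with `z`, times the volume form of the chart.
    refine ⟨(∑ lam, ∑ i, z lam i • ((LinearMap.proj i).comp
      ((LinearMap.proj lam).comp (φ.soldCoordₗ y)))).smulRight (φ.vol hy), ?_⟩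
    ext mu j
    simp [momCoord, soldCoord_unitSold φ hy, vol_frame φ hy, Pi.single_apply, ite_apply]⟩

@[simp]
theorem momEquiv_apply (hy : y ∈ φ.total.source) (p : P.Mom y) :
    φ.momEquiv hy p = φ.momCoord y p := rfl

@[simp]
theorem momCoord_momEquiv_symm (hy : y ∈ φ.total.source) (z : Fin n → Fin m → ℝ) :
    φ.momCoord y ((φ.momEquiv hy).symm z) = z := (φ.momEquiv hy).apply_symm_apply z

theorem jetCoord_vadd (v : P.Sold y) (j : P.Jet y) :
    φ.jetCoord y (v +ᵥ j) = φ.soldCoord y v + φ.jetCoord y j := by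
  ext lam i
  change (φ.dTotal y ((v (φ.frame y lam) : P.TY y) + j.toLin (φ.frame y lam))).2 i = _
  rw [map_add]
  rfl

theorem soldCoord_vsub (j k : P.Jet y) :
    φ.soldCoord y (j -ᵥ k) = φ.jetCoord y j - φ.jetCoord y k := by
  ext lam i
  change (φ.dTotal y (j.toLin (φ.frame y lam) - k.toLin (φ.frame y lam))).2 i = _
  rw [map_sub]
  rfl

theorem jetCoord_injective (hy : y ∈ φ.total.source) : Function.Injective (φ.jetCoord y) := by
  intro j k h
  have h0 : j -ᵥ k = (0 : P.Sold y) := by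
    apply φ.soldCoord_injective hy
    rw [soldCoord_vsub, h, sub_self, ← soldCoordₗ_apply, map_zero]
  apply FibredManifold.Jet.ext
  ext u
  have h1 := congrArg (fun v : P.Sold y => (v u : P.TY y)) h0
  change j.toLin u - k.toLin u = 0 at h1
  exact sub_eq_zero.1 h1

/-- The jet with given coordinates. -/
def jetOfCoord (hy : y ∈ φ.total.source) (z : Fin n → Fin m → ℝ) : P.Jet y where
  toLin := ((φ.totalEquiv hy).symm : Base n × Fib m →L[ℝ] P.TY y).comp
    (((ContinuousLinearMap.id ℝ (Base n)).prod
      (∑ lam, ((EuclideanSpace.proj lam : Base n →L[ℝ] ℝ)).smulRight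
        (WithLp.toLp 2 (z lam) : Fib m))).comp (φ.dBase y))
  isSection := by
    ext u
    apply (φ.baseEquiv hy).injective
    rw [← dBase_apply, ← dBase_apply]
    change φ.dBase y (P.dproj y _) = _
    rw [φ.dBase_dproj hy, dTotal_apply φ hy]
    simp

@[simp]
theorem jetCoord_jetOfCoord (hy : y ∈ φ.total.source) (z : Fin n → Fin m → ℝ) :
    φ.jetCoord y (φ.jetOfCoord hy z) = z := by
  ext lam i
  rw [jetCoord, dTotal_apply φ hy]
  simp [jetOfCoord, dBase_frame φ hy]

end FibredChart

end

/-! ### Contractions of coordinate arrays -/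

/-- The contraction `z^λ_i w^i_λ` of two arrays. -/
def dot {n m : ℕ} : (Fin n → Fin m → ℝ) →ₗ[ℝ] (Fin n → Fin m → ℝ) →ₗ[ℝ] ℝ :=
  LinearMap.mk₂ ℝ (fun z w => ∑ lam, ∑ i, z lam i * w lam i)
    (fun z z' w => by simp [add_mul, Finset.sum_add_distrib])
    (fun t z w => by simp [Finset.mul_sum, mul_assoc])
    (fun z w w' => by simp [mul_add, Finset.sum_add_distrib])
    (fun t z w => by simp [Finset.mul_sum, mul_left_comm])

theorem dot_apply {n m : ℕ} (z w : Fin n → Fin m → ℝ) :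
    dot z w = ∑ lam, ∑ i, z lam i * w lam i := rfl

theorem dot_comm {n m : ℕ} (z w : Fin n → Fin m → ℝ) : dot z w = dot w z := by
  simp only [dot_apply, mul_comm]

theorem dot_single {n m : ℕ} (z : Fin n → Fin m → ℝ) (lam : Fin n) (i : Fin m) :
    dot z (Pi.single lam (Pi.single i 1)) = z lam i := by
  simp [dot_apply, Pi.single_apply, ite_apply]

/-- The linear map `z^i_λ ↦ A^{λμ}_{ij} z^j_μ` of arrays. -/
def act {n m : ℕ} (A : Fin n → Fin m → Fin n → Fin m → ℝ) :
    (Fin n → Fin m → ℝ) →ₗ[ℝ] (Fin n → Fin m → ℝ) where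
  toFun z lam i := dot (A lam i) z
  map_add' z w := by ext; simp
  map_smul' t z := by ext; simp

theorem act_apply {n m : ℕ} (A : Fin n → Fin m → Fin n → Fin m → ℝ) (z : Fin n → Fin m → ℝ)
    (lam : Fin n) (i : Fin m) : act A z lam i = ∑ mu, ∑ j, A lam i mu j * z mu j := rfl

theorem dot_act {n m : ℕ} (A : Fin n → Fin m → Fin n → Fin m → ℝ) (z w : Fin n → Fin m → ℝ) :
    dot (act A z) w = ∑ lam, ∑ i, ∑ mu, ∑ j, A lam i mu j * w lam i * z mu j := by
  simp only [dot_apply, act_apply, Finset.sum_mul]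
  refine Finset.sum_congr rfl fun _ _ => Finset.sum_congr rfl fun _ _ =>
    Finset.sum_congr rfl fun _ _ => Finset.sum_congr rfl fun _ _ => by ring

theorem act_single {n m : ℕ} (A : Fin n → Fin m → Fin n → Fin m → ℝ) (lam mu : Fin n)
    (i j : Fin m) : act A (Pi.single mu (Pi.single j 1)) lam i = A lam i mu j :=
  dot_single _ _ _

theorem dot_act_comm {n m : ℕ} {A : Fin n → Fin m → Fin n → Fin m → ℝ}
    (hA : ∀ lam i mu j, A lam i mu j = A mu j lam i) (z w : Fin n → Fin m → ℝ) :
    dot (act A z) w = dot (act A w) z := by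
  have key : ∀ z w : Fin n → Fin m → ℝ, dot (act A z) w =
      ∑ q : (Fin n × Fin m), ∑ r : (Fin n × Fin m), A q.1 q.2 r.1 r.2 * w q.1 q.2 * z r.1 r.2 := by
    intro z w
    simp only [dot_act, Fintype.sum_prod_type]
  rw [key, key, Finset.sum_comm]
  refine Finset.sum_congr rfl fun q _ => Finset.sum_congr rfl fun r _ => ?_
  rw [hA]
  ring

/-! ### The Legendre morphism in coordinates and the fibrewise algebra -/

section

variable {n m : ℕ} {X Y : Type*}
  [TopologicalSpace X] [ChartedSpace (Base n) X]
  [TopologicalSpace Y] [ChartedSpace (Base n × Fib m) Y]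

namespace FibredManifold

variable {P : FibredManifold n m X Y} {y : Y}

theorem add_vadd_jet (v w : P.Sold y) (j : P.Jet y) : (v + w) +ᵥ j = v +ᵥ (w +ᵥ j) := by
  apply Jet.ext
  ext u
  exact add_assoc (v u : P.TY y) (w u : P.TY y) (j.toLin u)

theorem zero_vadd_jet (j : P.Jet y) : (0 : P.Sold y) +ᵥ j = j := by
  apply Jet.ext
  ext u
  exact zero_add (j.toLin u)

theorem vadd_vsub_assoc_jet (v : P.Sold y) (j k : P.Jet y) :
    (v +ᵥ j) -ᵥ k = v + (j -ᵥ k) := by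
  ext u
  exact add_sub_assoc (v u : P.TY y) (j.toLin u) (k.toLin u)

theorem vsub_vadd_eq_jet (v : P.Sold y) (j k : P.Jet y) :
    j -ᵥ (v +ᵥ k) = (j -ᵥ k) - v := by
  ext u
  exact sub_add_eq_sub_sub_swap (j.toLin u) (v u : P.TY y) (k.toLin u)

theorem eq_neg_vadd_iff_jet (v : P.Sold y) (j k : P.Jet y) : k = -v +ᵥ j ↔ j = v +ᵥ k := by
  constructor
  · rintro rfl
    rw [← add_vadd_jet, add_neg_cancel, zero_vadd_jet]
  · rintro rfl
    rw [← add_vadd_jet, neg_add_cancel, zero_vadd_jet]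

end FibredManifold

open FibredManifold

variable {P : FibredManifold n m X Y} {L : LagDensity P}

section Chart

variable {φ : FibredChart P} {y : Y}
  {a : Y → Fin n → Fin m → Fin n → Fin m → ℝ} {b : Y → Fin n → Fin m → ℝ} {c : Y → ℝ}

theorem FibredChart.mom_apply_frame_dot (φ : FibredChart P) (hy : y ∈ φ.total.source)
    (p : P.Mom y) (v : P.Sold y) :
    p v (φ.frame y) = dot (φ.momCoord y p) (φ.soldCoord y v) :=
  φ.mom_apply_frame hy p v

theorem IsQuadExpr.apply_frame (h : IsQuadExpr φ L a b c) (hy : y ∈ φ.total.source)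
    (j : P.Jet y) :
    L y j (φ.frame y) = 1 / 2 * dot (act (a y) (φ.jetCoord y j)) (φ.jetCoord y j)
      + dot (b y) (φ.jetCoord y j) + c y := by
  rw [h.2 y hy j, dot_act]
  rfl

/-- This is the exact Taylor expansion along the fibre; symmetry of `a` merges the two mixed terms.
The Legendre morphism can be read off from the linear term. -/
theorem IsQuadExpr.apply_frame_vadd (h : IsQuadExpr φ L a b c) (hy : y ∈ φ.total.source)
    (v : P.Sold y) (j : P.Jet y) :
    L y (v +ᵥ j) (φ.frame y) = L y j (φ.frame y)
      + dot (act (a y) (φ.jetCoord y j) + b y) (φ.soldCoord y v)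
      + 1 / 2 * dot (act (a y) (φ.soldCoord y v)) (φ.soldCoord y v) := by
  rw [h.apply_frame hy, h.apply_frame hy, φ.jetCoord_vadd]
  simp only [map_add, LinearMap.add_apply]
  rw [dot_act_comm (h.1 y) (φ.soldCoord y v) (φ.jetCoord y j)]
  ring

theorem IsQuadExpr.momCoord_legendre (h : IsQuadExpr φ L a b c) (hy : y ∈ φ.total.source)
    (j : P.Jet y) :
    φ.momCoord y (legendre L y j) = act (a y) (φ.jetCoord y j) + b y := by
  rw [legendre_eq L y j ((φ.momEquiv hy).symm (act (a y) (φ.jetCoord y j) + b y)),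
    φ.momCoord_momEquiv_symm]
  intro v w
  -- The definition of `legendre` tests all tuples `w`; since densities form a line, the value on
  -- `w` is the value on the frame times a constant.
  have e1 : ∀ D : P.Density y, D w = D (φ.frame y) * φ.vol hy w := by
    intro D
    conv_lhs => rw [φ.density_eq hy D]
    rfl
  rw [e1, φ.mom_apply_frame_dot hy, φ.momCoord_momEquiv_symm]
  have e2 : (fun t : ℝ => L y ((t • v) +ᵥ j) w) = fun t : ℝ =>
      (L y j (φ.frame y) + t * dot (act (a y) (φ.jetCoord y j) + b y) (φ.soldCoord y v)
        + t ^ 2 * (1 / 2 * dot (act (a y) (φ.soldCoord y v)) (φ.soldCoord y v)))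
        * φ.vol hy w := by
    funext t
    rw [e1, h.apply_frame_vadd hy, ← φ.soldCoordₗ_apply, ← φ.soldCoordₗ_apply]
    simp only [map_smul, LinearMap.smul_apply, smul_eq_mul]
    ring
  rw [e2]
  refine HasDerivAt.mul_const ?_ _
  have h1 := ((hasDerivAt_id (0 : ℝ)).mul_const
    (dot (act (a y) (φ.jetCoord y j) + b y) (φ.soldCoord y v))).const_add (L y j (φ.frame y))
  have h2 := ((hasDerivAt_id (0 : ℝ)).pow 2).mul_const
    (1 / 2 * dot (act (a y) (φ.soldCoord y v)) (φ.soldCoord y v))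
  refine (h1.add h2).congr_deriv ?_
  simp

theorem IsQuadExpr.legendre_vadd_aux (h : IsQuadExpr φ L a b c) (hy : y ∈ φ.total.source)
    (v : P.Sold y) (j : P.Jet y) :
    legendre L y (v +ᵥ j) =
      (φ.momEquiv hy).symm (act (a y) (φ.soldCoord y v)) + legendre L y j := by
  apply φ.momCoord_injective hy
  rw [← φ.momCoordₗ_apply (_ + _), map_add, φ.momCoordₗ_apply, φ.momCoordₗ_apply,
    φ.momCoord_momEquiv_symm, h.momCoord_legendre hy, h.momCoord_legendre hy, φ.jetCoord_vadd,
    map_add, add_assoc]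

theorem IsQuadExpr.legendre_vadd (h : IsQuadExpr φ L a b c) (hy : y ∈ φ.total.source)
    (v : P.Sold y) (j : P.Jet y) :
    legendre L y (v +ᵥ j) = linLegendre L y v + legendre L y j := by
  -- An explicit linear part is needed to exclude the default value in the definition of
  -- `linLegendre`.
  have hex : ∃ A : P.Sold y →ₗ[ℝ] P.Mom y, ∀ (v : P.Sold y) (j : P.Jet y),
      legendre L y (v +ᵥ j) = A v + legendre L y j :=
    ⟨(φ.momEquiv hy).symm.toLinearMap.comp ((act (a y)).comp (φ.soldCoordₗ y)),
      h.legendre_vadd_aux hy⟩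
  rw [linLegendre, dif_pos hex]
  exact hex.choose_spec v j

/-- The linear part of an affine map is unique, so the chosen `linLegendre` agrees with the explicit
one; comparing them at a single jet suffices. -/
theorem IsQuadExpr.momCoord_linLegendre (h : IsQuadExpr φ L a b c) (hy : y ∈ φ.total.source)
    (v : P.Sold y) :
    φ.momCoord y (linLegendre L y v) = act (a y) (φ.soldCoord y v) := by
  have h1 := h.legendre_vadd hy v (φ.jetOfCoord hy 0)
  rw [h.legendre_vadd_aux hy] at h1
  have h2 := congrArg (φ.momCoordₗ y) h1
  rw [map_add, map_add, add_left_inj, φ.momCoordₗ_apply, φ.momCoordₗ_apply,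
    φ.momCoord_momEquiv_symm] at h2
  exact h2.symm

theorem IsFormExpr.soldCoord_eq {σ : ∀ y : Y, P.Mom y →ₗ[ℝ] P.Sold y}
    {s : Y → Fin n → Fin m → Fin n → Fin m → ℝ} (h : IsFormExpr φ σ s)
    (hy : y ∈ φ.total.source) (p : P.Mom y) :
    φ.soldCoord y (σ y p) = act (s y) (φ.momCoord y p) := by
  ext lam i
  exact h y hy p lam i

/-- Over the domain of the chart the coefficients are determined by `σ`, as its values on the unit
momenta. Symmetry of `σ` thus passes to any given array of coefficients. -/
theorem IsFormExpr.eq_soldCoord {σ : ∀ y : Y, P.Mom y →ₗ[ℝ] P.Sold y}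
    {s : Y → Fin n → Fin m → Fin n → Fin m → ℝ} (h : IsFormExpr φ σ s)
    (hy : y ∈ φ.total.source) (lam mu : Fin n) (i j : Fin m) :
    s y lam i mu j = φ.soldCoord y
      (σ y ((φ.momEquiv hy).symm (Pi.single mu (Pi.single j 1)))) lam i := by
  rw [h.soldCoord_eq hy, φ.momCoord_momEquiv_symm, act_single]

theorem LinForm.IsSymm.coeff_symm {σ : LinForm P} (hσ : σ.IsSymm)
    {s : Y → Fin n → Fin m → Fin n → Fin m → ℝ} (h : IsFormExpr φ σ.toFun s)
    (hy : y ∈ φ.total.source) (lam : Fin n) (i : Fin m) (mu : Fin n) (j : Fin m) :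
    s y lam i mu j = s y mu j lam i := by
  have h1 := congrArg (fun D => D (φ.frame y)) (hσ y
    ((φ.momEquiv hy).symm (Pi.single mu (Pi.single j 1)))
    ((φ.momEquiv hy).symm (Pi.single lam (Pi.single i 1))))
  simp only [φ.mom_apply_frame_dot hy, φ.momCoord_momEquiv_symm] at h1
  rwa [dot_comm, dot_single, dot_comm, dot_single, ← h.eq_soldCoord hy,
    ← h.eq_soldCoord hy] at h1

end Chart

section Algebra

variable [IsManifold (IY n m) ∞ Y] {y : Y}

theorem FibredManifold.nonempty_jet (P : FibredManifold n m X Y) (y : Y) : Nonempty (P.Jet y) := by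
  obtain ⟨φ, hy⟩ := P.exists_chart y
  exact ⟨φ.jetOfCoord hy 0⟩

/-- Momenta separate the elements of `T*X ⊗ VY`. -/
theorem FibredManifold.eq_zero_of_mom {v : P.Sold y} (h : ∀ p : P.Mom y, p v = 0) : v = 0 := by
  obtain ⟨φ, hy⟩ := P.exists_chart y
  apply φ.soldCoord_injective hy
  rw [← φ.soldCoordₗ_apply 0, map_zero]
  ext lam i
  have h1 := congrArg (fun D => D (φ.frame y))
    (h ((φ.momEquiv hy).symm (Pi.single lam (Pi.single i 1))))
  simp only [φ.mom_apply_frame_dot hy, φ.momCoord_momEquiv_symm] at h1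
  rw [dot_comm, dot_single] at h1
  exact h1

theorem IsQuadratic.legendre_vadd (hL : IsQuadratic L) (v : P.Sold y) (j : P.Jet y) :
    legendre L y (v +ᵥ j) = linLegendre L y v + legendre L y j := by
  obtain ⟨φ, hy⟩ := P.exists_chart y
  obtain ⟨a, b, c, h, -⟩ := hL φ
  exact h.legendre_vadd hy v j

theorem IsQuadratic.linLegendre_symm (hL : IsQuadratic L) (v w : P.Sold y) :
    linLegendre L y v w = linLegendre L y w v := by
  obtain ⟨φ, hy⟩ := P.exists_chart y
  obtain ⟨a, b, c, h, -⟩ := hL φ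
  apply φ.density_ext hy
  rw [φ.mom_apply_frame_dot hy, φ.mom_apply_frame_dot hy, h.momCoord_linLegendre hy,
    h.momCoord_linLegendre hy, dot_act_comm (h.1 y)]

theorem IsQuadratic.apply_vadd (hL : IsQuadratic L) (v : P.Sold y) (j : P.Jet y) :
    L y (v +ᵥ j) = L y j + legendre L y j v + (1 / 2 : ℝ) • linLegendre L y v v := by
  obtain ⟨φ, hy⟩ := P.exists_chart y
  obtain ⟨a, b, c, h, -⟩ := hL φ
  apply φ.density_ext hy
  simp only [AlternatingMap.add_apply, AlternatingMap.smul_apply, smul_eq_mul,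
    φ.mom_apply_frame_dot hy, h.momCoord_linLegendre hy, h.momCoord_legendre hy,
    h.apply_frame_vadd hy]

/-- With a zero `k` of the Legendre morphism as origin, the affine map `j ↦ A (j - k)` has the same
image as its linear part. -/
theorem IsQuadratic.constraint_eq (hL : IsQuadratic L)
    (hzero : (0 : P.Mom y) ∈ constraint L y) :
    constraint L y = (LinearMap.range (linLegendre L y) : Set (P.Mom y)) := by
  obtain ⟨k, hk⟩ := hzero
  ext p
  constructor
  · rintro ⟨j, rfl⟩
    refine ⟨j -ᵥ k, ?_⟩
    have h := hL.legendre_vadd (j -ᵥ k) k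
    rw [vsub_vadd_jet, hk, add_zero] at h
    exact h.symm
  · rintro ⟨v, rfl⟩
    refine ⟨v +ᵥ k, ?_⟩
    rw [hL.legendre_vadd, hk, add_zero]

/-- On `Q` the map `σ` has the left inverse `A`, so `Ker σ` meets `Q` only in `0`. By reflexivity `A
σ` is a projection along `Ker σ`, which splits `p` as `(p - A σ p) + A σ p`. -/
theorem isCompl_ker_range {σ : LinForm P} (hL : IsQuadratic L)
    (hzero : (0 : P.Mom y) ∈ constraint L y) (h1 : σ.SectionOn L) (h2 : σ.Reflexive L) :
    IsCompl (LinearMap.ker (σ.toFun y)) (LinearMap.range (linLegendre L y)) := by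
  have hQ := hL.constraint_eq hzero
  constructor
  · rw [Submodule.disjoint_def]
    intro p hp hp'
    have h3 := h1 y p (hQ ▸ hp')
    rw [LinearMap.mem_ker.1 hp, map_zero] at h3
    exact h3.symm
  · rw [codisjoint_iff, eq_top_iff]
    intro p _
    have h3 : p = (p + (-1 : ℝ) • linLegendre L y (σ.toFun y p))
        + linLegendre L y (σ.toFun y p) := by module
    rw [h3]
    refine Submodule.add_mem_sup ?_ ⟨_, rfl⟩
    rw [LinearMap.mem_ker, map_add, map_smul, h2]
    module

theorem legendre_gaugeProj {σ : LinForm P} (hL : IsQuadratic L) (h1 : σ.SectionOn L)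
    (j : P.Jet y) : legendre L y (gaugeProj L σ y j) = 0 := by
  rw [gaugeProj, hL.legendre_vadd, map_neg, dynProj, h1 y _ ⟨j, rfl⟩, neg_add_cancel]

/-- Uniqueness of the splitting: if `j = σ q + k` and the Legendre morphism kills `k`, it sends `j`
to `A σ q`, and reflexivity recovers `σ q = σ A σ q`. -/
theorem eq_vadd_iff_gaugeProj {σ : LinForm P} (hL : IsQuadratic L) (h2 : σ.Reflexive L)
    (j k : P.Jet y) (w : P.Sold y) (hk : legendre L y k = 0)
    (hw : w ∈ LinearMap.range (σ.toFun y)) :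
    j = w +ᵥ k ↔ k = gaugeProj L σ y j ∧ w = dynProj L σ y j := by
  constructor
  · intro h
    have h3 : w = dynProj L σ y j := by
      obtain ⟨q, rfl⟩ := hw
      rw [dynProj, h, hL.legendre_vadd, hk, add_zero, h2]
    exact ⟨by rw [gaugeProj, ← h3, eq_neg_vadd_iff_jet, h], h3⟩
  · rintro ⟨h3, h4⟩
    rw [← eq_neg_vadd_iff_jet, h4]
    exact h3

theorem legendre_affMor {Γ : Connection P} {σ : LinForm P} (hL : IsQuadratic L)
    (hΓ : Γ.InKer L) (h1 : σ.SectionOn L) (p : P.Mom y) (hp : p ∈ constraint L y) :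
    legendre L y (affMor Γ σ y p) = p := by
  rw [affMor, hL.legendre_vadd, hΓ y, add_zero, h1 y p hp]

/-- The linear term in the expansion of `L` at `Γ` vanishes, because `Γ` lies in the kernel. What
remains is `½ (A σ p)(σ p) - ½ p(σ p)`, and symmetry of `σ` rewrites the first pairing as `½ p(σ A σ
p)`. -/
theorem hamOf_affMor_apply {Γ : Connection P} {σ : LinForm P} (hL : IsQuadratic L)
    (hΓ : Γ.InKer L) (hσ : σ.IsSymm) (p : P.Mom y) (j : P.Jet y) :
    hamOf L (affMor Γ σ) y p j = quadHam L Γ σ y p j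
      + (1 / 2 : ℝ) • p (σ.toFun y (linLegendre L y (σ.toFun y p)) - σ.toFun y p) := by
  simp only [hamOf, quadHam, affMor, vsub_vadd_eq_jet, hL.apply_vadd, hΓ y, map_sub,
    LinearMap.zero_apply]
  rw [hσ y p (linLegendre L y (σ.toFun y p))]
  module

theorem quadHam_eq_hamOf_iff {Γ : Connection P} {σ : LinForm P} (hL : IsQuadratic L)
    (hΓ : Γ.InKer L) (hσ : σ.IsSymm) :
    quadHam L Γ σ = hamOf L (affMor Γ σ) ↔ σ.Reflexive L := by
  constructor
  · intro h y p
    let T : P.Mom y →ₗ[ℝ] P.Sold y :=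
      (σ.toFun y).comp ((linLegendre L y).comp (σ.toFun y)) - σ.toFun y
    have hT : ∀ q : P.Mom y, q (T q) = 0 := by
      intro q
      obtain ⟨j⟩ := P.nonempty_jet y
      have h3 := hamOf_affMor_apply hL hΓ hσ q j
      rw [h, left_eq_add, smul_eq_zero_iff_right (by norm_num)] at h3
      exact h3
    -- The defect `T = σ A σ - σ` is symmetric because `σ` and `A` are; its quadratic form vanishes,
    -- so polarization at `p + q` gives `T = 0`.
    have hTs : ∀ q r : P.Mom y, q (T r) = r (T q) := by
      intro q r
      change q (σ.toFun y (linLegendre L y (σ.toFun y r)) - σ.toFun y r) =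
        r (σ.toFun y (linLegendre L y (σ.toFun y q)) - σ.toFun y q)
      rw [map_sub, map_sub, hσ y _ q, hσ y _ r, hL.linLegendre_symm, hσ y r q]
    have hz : T p = 0 := by
      apply eq_zero_of_mom
      intro q
      have h4 := hT (p + q)
      rw [map_add, map_add, LinearMap.add_apply, LinearMap.add_apply, hT, hT, zero_add, add_zero,
        hTs p q] at h4
      have h5 : (2 : ℝ) • q (T p) = 0 := by rw [two_smul]; exact h4
      exact (smul_eq_zero_iff_right (by norm_num)).1 h5
    exact sub_eq_zero.1 hz
  · intro h
    funext y p j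
    rw [hamOf_affMor_apply hL hΓ hσ, h y p, sub_self, map_zero, smul_zero, add_zero]

end Algebra

end

/-! ### Sections built by a partition of unity -/

section PartitionOfUnity

open Function Set

variable {E : Type*} [NormedAddCommGroup E] [NormedSpace ℝ E] [FiniteDimensional ℝ E]
  {M : Type*} [TopologicalSpace M] [ChartedSpace E M] [IsManifold 𝓘(ℝ, E) ∞ M]
  [T2Space M] [SecondCountableTopology M]

/-- Local sections with values in convex sets of vector spaces `V y`, smooth in the sense that the
functionals `κ i` applied to them are smooth on the open sets `O i`, can be replaced by a global
section. -/
theorem exists_section_of_local {ι : Type*} (V : M → Type*) [∀ y, AddCommGroup (V y)]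
    [∀ y, Module ℝ (V y)] (O : ι → Set M) (hO : ∀ i, IsOpen (O i))
    (κ : ι → ∀ y, V y →ₗ[ℝ] ℝ) (t : ∀ y, Set (V y)) (ht : ∀ y, Convex ℝ (t y))
    (hloc : ∀ y₀ : M, ∃ U ∈ nhds y₀, ∃ S : ∀ y, V y,
      (∀ i, ContMDiffOn 𝓘(ℝ, E) 𝓘(ℝ, ℝ) ∞ (fun y => κ i y (S y)) (U ∩ O i)) ∧
      ∀ y ∈ U, S y ∈ t y) :
    ∃ S : ∀ y, V y, (∀ i, ContMDiffOn 𝓘(ℝ, E) 𝓘(ℝ, ℝ) ∞ (fun y => κ i y (S y)) (O i)) ∧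
      ∀ y, S y ∈ t y := by
  choose W hW S hS hSt using hloc
  have : LocallyCompactSpace M := Manifold.locallyCompact_of_finiteDimensional 𝓘(ℝ, E)
  obtain ⟨ρ, hρ⟩ : ∃ ρ : SmoothPartitionOfUnity M 𝓘(ℝ, E) M univ,
      ρ.IsSubordinate (fun x => interior (W x)) :=
    SmoothPartitionOfUnity.exists_isSubordinate 𝓘(ℝ, E) isClosed_univ _
      (fun x => isOpen_interior)
      (fun x _ => mem_iUnion.2 ⟨x, mem_interior_iff_mem_nhds.2 (hW x)⟩)
  have hmem : ∀ (y z : M), ρ z y ≠ 0 → y ∈ W z := fun y z h =>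
    interior_subset (hρ z (subset_closure (mem_support.2 h)))
  refine ⟨fun y => ∑ᶠ z, ρ z y • S z y, fun i y hy => ?_, fun y => ?_⟩
  · have h1 : (fun y => κ i y (∑ᶠ z, ρ z y • S z y)) =
        fun y => ∑ᶠ z, ρ z y • κ i y (S z y) := by
      funext y
      have hfin : (support fun z => ρ z y • S z y).Finite :=
        (ρ.locallyFinite.point_finite y).subset fun z hz => left_ne_zero_of_smul hz
      have h2 := (κ i y).toAddMonoidHom.map_finsum hfin
      simpa using h2
    rw [h1]
    -- Smoothness of a local section is only needed on the support of its weight, which lies in the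
    -- interior of the set where that section is controlled.
    refine (ρ.contMDiffAt_finsum fun z hz => ?_).contMDiffWithinAt
    refine ((hS z i) y ⟨interior_subset (hρ z hz), hy⟩).contMDiffAt ?_
    exact Filter.inter_mem (mem_interior_iff_mem_nhds.1 (hρ z hz)) ((hO i).mem_nhds hy)
  · exact (ht y).finsum_mem (fun z => ρ.nonneg z y) (ρ.sum_eq_one (mem_univ y))
      fun z hz => hSt z y (hmem y z hz)

end PartitionOfUnity

/-! ### Changes of coordinates -/

section Charts

variable {E : Type*} [NormedAddCommGroup E] [NormedSpace ℝ E]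
  {M : Type*} [TopologicalSpace M] [ChartedSpace E M]
  {e e' : OpenPartialHomeomorph M E}

theorem contDiffOn_coordChange (he : e ∈ IsManifold.maximalAtlas 𝓘(ℝ, E) ∞ M)
    (he' : e' ∈ IsManifold.maximalAtlas 𝓘(ℝ, E) ∞ M) :
    ContDiffOn ℝ ∞ (e' ∘ e.symm) (e.target ∩ e.symm ⁻¹' e'.source) := by
  rw [← contMDiffOn_iff_contDiffOn]
  exact (contMDiffOn_of_mem_maximalAtlas he').comp
    ((contMDiffOn_symm_of_mem_maximalAtlas he).mono Set.inter_subset_left)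
    Set.inter_subset_right

theorem contMDiffOn_fderiv_coordChange (he : e ∈ IsManifold.maximalAtlas 𝓘(ℝ, E) ∞ M)
    (he' : e' ∈ IsManifold.maximalAtlas 𝓘(ℝ, E) ∞ M) :
    ContMDiffOn 𝓘(ℝ, E) 𝓘(ℝ, E →L[ℝ] E) ∞ (fun x => fderiv ℝ (e' ∘ e.symm) (e x))
      (e.source ∩ e'.source) := by
  have h1 : ContDiffOn ℝ ∞ (fderiv ℝ (e' ∘ e.symm)) (e.target ∩ e.symm ⁻¹' e'.source) :=
    (contDiffOn_coordChange he he').fderiv_of_isOpen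
      (e.isOpen_inter_preimage_symm e'.open_source) (by simp)
  refine h1.contMDiffOn.comp
    ((contMDiffOn_of_mem_maximalAtlas he).mono Set.inter_subset_left) fun x hx => ?_
  refine ⟨e.map_source hx.1, ?_⟩
  rw [Set.mem_preimage, e.left_inv hx.1]
  exact hx.2

theorem mfderiv_eq_fderiv_coordChange (he : e ∈ IsManifold.maximalAtlas 𝓘(ℝ, E) ∞ M)
    (he' : e' ∈ IsManifold.maximalAtlas 𝓘(ℝ, E) ∞ M) {x : M} (hx : x ∈ e.source)
    (hx' : x ∈ e'.source) :
    mfderiv 𝓘(ℝ, E) 𝓘(ℝ, E) e' x =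
      (mfderiv 𝓘(ℝ, E) 𝓘(ℝ, E) (e' ∘ e.symm) (e x)).comp (mfderiv 𝓘(ℝ, E) 𝓘(ℝ, E) e x) := by
  have hd : MDifferentiableAt 𝓘(ℝ, E) 𝓘(ℝ, E) e x :=
    (contMDiffAt_of_mem_maximalAtlas he hx).mdifferentiableAt (by simp)
  have hmem : e.target ∩ e.symm ⁻¹' e'.source ∈ nhds (e x) :=
    (e.isOpen_inter_preimage_symm e'.open_source).mem_nhds
      ⟨e.map_source hx, by rwa [Set.mem_preimage, e.left_inv hx]⟩
  have ht : MDifferentiableAt 𝓘(ℝ, E) 𝓘(ℝ, E) (e' ∘ e.symm) (e x) :=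
    (((contDiffOn_coordChange he he').contDiffAt hmem).differentiableAt
      (by simp)).mdifferentiableAt
  have heq : (e' ∘ e.symm) ∘ e =ᶠ[nhds x] e' := by
    filter_upwards [e.open_source.mem_nhds hx] with z hz
    simp [e.left_inv hz]
  rw [← mfderiv_comp x ht hd, heq.mfderiv_eq]

end Charts

/-! ### Transition laws for jets, soldering forms and momenta -/

section

variable {n m : ℕ} {X Y : Type*}
  [TopologicalSpace X] [ChartedSpace (Base n) X]
  [TopologicalSpace Y] [ChartedSpace (Base n × Fib m) Y]

namespace FibredChart

variable {P : FibredManifold n m X Y} (φ ψ : FibredChart P) {y : Y}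

theorem dTotal_eq (hy : y ∈ φ.total.source) (hy' : y ∈ ψ.total.source) (w : P.TY y) :
    φ.dTotal y w = fderiv ℝ (φ.total ∘ ψ.total.symm) (ψ.total y) (ψ.dTotal y w) := by
  have h := congrArg (fun f => f w)
    (mfderiv_eq_fderiv_coordChange ψ.total_mem φ.total_mem hy' hy)
  rw [mfderiv_eq_fderiv] at h
  exact h

theorem dBase_eq (hy : y ∈ φ.total.source) (hy' : y ∈ ψ.total.source) (u : P.TX y) :
    φ.dBase y u = fderiv ℝ (φ.base ∘ ψ.base.symm) (ψ.base (P.proj y)) (ψ.dBase y u) := by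
  have h := congrArg (fun f => f u)
    (mfderiv_eq_fderiv_coordChange ψ.base_mem φ.base_mem (ψ.mapsTo y hy') (φ.mapsTo y hy))
  rw [mfderiv_eq_fderiv] at h
  exact h

/-- The coordinates in `ψ` of the vector `∂_lam` of the chart `φ` are smooth functions. -/
theorem contMDiffOn_dBase_frame (lam mu : Fin n) :
    ContMDiffOn (IY n m) 𝓘(ℝ, ℝ) ∞ (fun y => ψ.dBase y (φ.frame y lam) mu)
      (φ.total.source ∩ ψ.total.source) := by
  have h1 := contMDiffOn_fderiv_coordChange φ.base_mem ψ.base_mem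
  have h2 : ContMDiffOn (IY n m) 𝓘(ℝ, Base n →L[ℝ] Base n) ∞
      (fun y => fderiv ℝ (ψ.base ∘ φ.base.symm) (φ.base (P.proj y)))
      (φ.total.source ∩ ψ.total.source) :=
    h1.comp P.submersion.contMDiff.contMDiffOn
      fun y hy => ⟨φ.mapsTo y hy.1, ψ.mapsTo y hy.2⟩
  have h3 : ContMDiffOn (IY n m) 𝓘(ℝ, ℝ) ∞
      (fun y => (EuclideanSpace.proj mu : Base n →L[ℝ] ℝ)
        (fderiv ℝ (ψ.base ∘ φ.base.symm) (φ.base (P.proj y)) (EuclideanSpace.single lam 1)))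
      (φ.total.source ∩ ψ.total.source) :=
    (EuclideanSpace.proj mu : Base n →L[ℝ] ℝ).contMDiff.comp_contMDiffOn
      (h2.clm_apply contMDiffOn_const)
  refine h3.congr fun y hy => ?_
  rw [ψ.dBase_eq φ hy.2 hy.1, φ.dBase_frame hy.1]
  rfl

/-- The fibre coordinates of a smooth vector field are smooth after a change of chart. -/
theorem contMDiffOn_fderiv_snd {S : Set Y} (hS : S ⊆ φ.total.source ∩ ψ.total.source)
    {f : Y → Base n} {g : Y → Fin m → ℝ}
    (hf : ∀ lam, ContMDiffOn (IY n m) 𝓘(ℝ, ℝ) ∞ (fun y => f y lam) S)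
    (hg : ∀ i, ContMDiffOn (IY n m) 𝓘(ℝ, ℝ) ∞ (fun y => g y i) S) (i : Fin m) :
    ContMDiffOn (IY n m) 𝓘(ℝ, ℝ) ∞
      (fun y => (fderiv ℝ (φ.total ∘ ψ.total.symm) (ψ.total y)
        (f y, (WithLp.toLp 2 (g y) : Fib m))).2 i) S := by
  have h1 : ContMDiffOn (IY n m) 𝓘(ℝ, (Base n × Fib m) →L[ℝ] (Base n × Fib m)) ∞
      (fun y => fderiv ℝ (φ.total ∘ ψ.total.symm) (ψ.total y)) S :=
    (contMDiffOn_fderiv_coordChange ψ.total_mem φ.total_mem).mono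
      fun y hy => ⟨(hS hy).2, (hS hy).1⟩
  have hf' : ContMDiffOn (IY n m) 𝓘(ℝ, Base n) ∞ f S := by
    have h2 : ContMDiffOn (IY n m) 𝓘(ℝ, Fin n → ℝ) ∞ (fun y lam => f y lam) S :=
      contMDiffOn_pi_space.2 hf
    exact (EuclideanSpace.equiv (Fin n) ℝ).symm.contDiff.contMDiff.comp_contMDiffOn h2
  have hg' : ContMDiffOn (IY n m) 𝓘(ℝ, Fib m) ∞
      (fun y => (WithLp.toLp 2 (g y) : Fib m)) S := by
    have h2 : ContMDiffOn (IY n m) 𝓘(ℝ, Fin m → ℝ) ∞ g S := contMDiffOn_pi_space.2 hg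
    exact (EuclideanSpace.equiv (Fin m) ℝ).symm.contDiff.contMDiff.comp_contMDiffOn h2
  have h3 := h1.clm_apply (hf'.prodMk_space hg')
  exact ((EuclideanSpace.proj i : Fib m →L[ℝ] ℝ).comp
    (ContinuousLinearMap.snd ℝ (Base n) (Fib m))).contMDiff.comp_contMDiffOn h3

/-- A jet is a right inverse of the projection, so the base component of the image of `∂_lam` is
that of `∂_lam` itself. This inhomogeneous part makes the transition law affine; for differences of
jets, in `soldCoord_eq`, it is `0`. -/
theorem jetCoord_eq (hy : y ∈ φ.total.source) (hy' : y ∈ ψ.total.source) (j : P.Jet y)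
    (lam : Fin n) (i : Fin m) :
    φ.jetCoord y j lam i = (fderiv ℝ (φ.total ∘ ψ.total.symm) (ψ.total y)
      (ψ.dBase y (φ.frame y lam), (WithLp.toLp 2 (fun k => ∑ mu,
        ψ.dBase y (φ.frame y lam) mu * ψ.jetCoord y j mu k) : Fib m))).2 i := by
  rw [jetCoord, φ.dTotal_eq ψ hy hy']
  have key : ψ.dTotal y (j.toLin (φ.frame y lam)) = (ψ.dBase y (φ.frame y lam), (WithLp.toLp 2 (fun k => ∑ mu,
      ψ.dBase y (φ.frame y lam) mu * ψ.jetCoord y j mu k) : Fib m)) := by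
    refine Prod.ext (ψ.dTotal_fst_jet hy' j _) ?_
    ext k
    conv_lhs => rw [ψ.eq_sum_frame hy' (φ.frame y lam)]
    simp [map_sum, jetCoord, Prod.snd_sum]
  rw [key]

theorem soldCoord_eq (hy : y ∈ φ.total.source) (hy' : y ∈ ψ.total.source) (v : P.Sold y)
    (lam : Fin n) (i : Fin m) :
    φ.soldCoord y v lam i = (fderiv ℝ (φ.total ∘ ψ.total.symm) (ψ.total y)
      (0, (WithLp.toLp 2 (fun k => ∑ mu,
        ψ.dBase y (φ.frame y lam) mu * ψ.soldCoord y v mu k) : Fib m))).2 i := by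
  rw [soldCoord, φ.dTotal_eq ψ hy hy']
  have key : ψ.dTotal y (v (φ.frame y lam) : P.TY y) = (0, (WithLp.toLp 2 (fun k => ∑ mu,
      ψ.dBase y (φ.frame y lam) mu * ψ.soldCoord y v mu k) : Fib m)) := by
    refine Prod.ext (ψ.dTotal_fst_sold hy' v _) ?_
    ext k
    conv_lhs => rw [ψ.eq_sum_frame hy' (φ.frame y lam)]
    simp [map_sum, soldCoord, Prod.snd_sum]
  rw [key]

theorem momCoord_eq (hy' : y ∈ ψ.total.source) (p : P.Mom y)
    (lam : Fin n) (i : Fin m) :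
    φ.momCoord y p lam i =
      dot (ψ.momCoord y p) (ψ.soldCoord y (φ.unitSold y lam i)) *
        Matrix.det (Matrix.of fun mu nu => ψ.dBase y (φ.frame y nu) mu) := by
  rw [momCoord]
  conv_lhs => rw [ψ.density_eq hy' (p (φ.unitSold y lam i))]
  rw [AlternatingMap.smul_apply, ψ.mom_apply_frame_dot hy', smul_eq_mul]
  congr 1
  -- The Jacobian determinant of the base appears because momenta take values in densities: it is
  -- the volume form of `ψ` evaluated on the frame of `φ`.
  rw [vol, Module.Basis.det_apply]
  congr 1
  ext mu nu
  simp [Module.Basis.toMatrix_apply, frameBasis, dBase_apply ψ hy']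

/-- Smoothness in one chart implies smoothness in every other, so a local construction in a single
chart meets the requirement on connections in all charts. -/
theorem contMDiffOn_jetCoord {J : ∀ y, P.Jet y} {U : Set Y}
    (h : ∀ lam i, ContMDiffOn (IY n m) 𝓘(ℝ, ℝ) ∞ (fun y => ψ.jetCoord y (J y) lam i)
      (U ∩ ψ.total.source)) (lam : Fin n) (i : Fin m) :
    ContMDiffOn (IY n m) 𝓘(ℝ, ℝ) ∞ (fun y => φ.jetCoord y (J y) lam i)
      ((U ∩ ψ.total.source) ∩ φ.total.source) := by
  have hS : (U ∩ ψ.total.source) ∩ φ.total.source ⊆ φ.total.source ∩ ψ.total.source :=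
    fun y hy => ⟨hy.2, hy.1.2⟩
  have hB := fun mu => (φ.contMDiffOn_dBase_frame ψ lam mu).mono hS
  refine (φ.contMDiffOn_fderiv_snd ψ hS (f := fun y => ψ.dBase y (φ.frame y lam)) hB
    (g := fun y k => ∑ mu, ψ.dBase y (φ.frame y lam) mu * ψ.jetCoord y (J y) mu k)
    (fun k => ?_) i).congr fun y hy => φ.jetCoord_eq ψ hy.2 hy.1.2 _ _ _
  exact contMDiffOn_finsetSum fun mu _ => (hB mu).mul ((h mu k).mono fun y hy => hy.1)

theorem contMDiffOn_soldCoord {v : ∀ y, P.Sold y} {S : Set Y}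
    (hS : S ⊆ φ.total.source ∩ ψ.total.source)
    (h : ∀ lam i, ContMDiffOn (IY n m) 𝓘(ℝ, ℝ) ∞ (fun y => ψ.soldCoord y (v y) lam i) S)
    (lam : Fin n) (i : Fin m) :
    ContMDiffOn (IY n m) 𝓘(ℝ, ℝ) ∞ (fun y => φ.soldCoord y (v y) lam i) S := by
  have hB := fun mu => (φ.contMDiffOn_dBase_frame ψ lam mu).mono hS
  refine (φ.contMDiffOn_fderiv_snd ψ hS (f := fun _ => 0) (fun _ => contMDiffOn_const)
    (g := fun y k => ∑ mu, ψ.dBase y (φ.frame y lam) mu * ψ.soldCoord y (v y) mu k)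
    (fun k => ?_) i).congr fun y hy => φ.soldCoord_eq ψ (hS hy).1 (hS hy).2 _ _ _
  exact contMDiffOn_finsetSum fun mu _ => (hB mu).mul (h mu k)

theorem contMDiffOn_momCoord {p : ∀ y, P.Mom y} {S : Set Y}
    (hS : S ⊆ φ.total.source ∩ ψ.total.source)
    (h : ∀ lam i, ContMDiffOn (IY n m) 𝓘(ℝ, ℝ) ∞ (fun y => ψ.momCoord y (p y) lam i) S)
    (lam : Fin n) (i : Fin m) :
    ContMDiffOn (IY n m) 𝓘(ℝ, ℝ) ∞ (fun y => φ.momCoord y (p y) lam i) S := by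
  have hB := fun nu mu => (φ.contMDiffOn_dBase_frame ψ nu mu).mono hS
  -- The fields `dx^lam ⊗ ∂_i` of `φ` have constant coordinates in `φ`, hence smooth ones in `ψ`.
  have hu : ∀ mu k, ContMDiffOn (IY n m) 𝓘(ℝ, ℝ) ∞
      (fun y => ψ.soldCoord y (φ.unitSold y lam i) mu k) S := by
    refine ψ.contMDiffOn_soldCoord φ (fun y hy => ⟨(hS hy).2, (hS hy).1⟩) fun mu k => ?_
    refine (contMDiffOn_const
      (c := (Pi.single lam (Pi.single i 1) : Fin n → Fin m → ℝ) mu k)).congr fun y hy => ?_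
    rw [φ.soldCoord_unitSold (hS hy).1]
  have hdet : ContMDiffOn (IY n m) 𝓘(ℝ, ℝ) ∞
      (fun y => Matrix.det (Matrix.of fun mu nu => ψ.dBase y (φ.frame y nu) mu)) S := by
    simp only [Matrix.det_apply', Matrix.of_apply]
    exact contMDiffOn_finsetSum fun τ _ => contMDiffOn_const.mul
      (contMDiffOn_finsetProd fun nu _ => hB nu _)
  refine ContMDiffOn.congr ?_ fun y hy => φ.momCoord_eq ψ (hS hy).2 _ _ _
  simp only [dot_apply]
  exact (contMDiffOn_finsetSum fun mu _ => contMDiffOn_finsetSum fun k _ =>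
    (h mu k).mul (hu mu k)).mul hdet

end FibredChart

end

section

variable {n m : ℕ} {X Y : Type*}
  [TopologicalSpace X] [ChartedSpace (Base n) X]
  [TopologicalSpace Y] [ChartedSpace (Base n × Fib m) Y]

variable {P : FibredManifold n m X Y}

/-! ### Prolongation of sections in coordinates -/

/-- The coordinate expression of a section of `Y → X`. -/
def Sec.rep (s : Sec P) (φ : FibredChart P) (u : Base n) : Base n × Fib m :=
  φ.total (s.toFun (φ.base.symm u))

theorem FibredChart.base_mem_source (φ : FibredChart P) (s : Sec P) {x : X}
    (hx : s.toFun x ∈ φ.total.source) : x ∈ φ.base.source := by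
  have h := φ.mapsTo _ hx
  rwa [s.isSection] at h

theorem Sec.contDiffAt_rep (s : Sec P) (φ : FibredChart P) {x : X}
    (hx : s.toFun x ∈ φ.total.source) : ContDiffAt ℝ ∞ (s.rep φ) (φ.base x) := by
  have hb := φ.base_mem_source s hx
  have hinv := φ.base.left_inv hb
  rw [← contMDiffAt_iff_contDiffAt]
  have h1 : ContMDiffAt (IX n) (IX n) ∞ φ.base.symm (φ.base x) :=
    contMDiffAt_symm_of_mem_maximalAtlas φ.base_mem (φ.base.map_source hb)
  have h2 : ContMDiffAt (IX n) (IY n m) ∞ s.toFun (φ.base.symm (φ.base x)) := s.smooth _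
  have h3 : ContMDiffAt (IY n m) (IY n m) ∞ φ.total (s.toFun (φ.base.symm (φ.base x))) :=
    contMDiffAt_of_mem_maximalAtlas φ.total_mem (by rwa [hinv])
  exact h3.comp (φ.base x) (h2.comp (φ.base x) h1)

/-- The points `π(s(x))` and `x` are equal but not by definition; this removes the transport of
tangent vectors built into `Sec.prolong`. -/
theorem fromTangentSpace_mfderiv_tangentCongr (f : X → Base n) {x x' : X} (h : x' = x)
    (u : TangentSpace (IX n) x') :
    NormedSpace.fromTangentSpace (𝕜 := ℝ) (f x) (mfderiv (IX n) (IX n) f x (tangentCongr h u)) =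
      NormedSpace.fromTangentSpace (𝕜 := ℝ) (f x') (mfderiv (IX n) (IX n) f x' u) := by
  subst h
  rfl

/-- This is the chain rule for `s.rep φ ∘ φ.base = φ.total ∘ s` near `x`. -/
theorem Sec.dTotal_prolong (s : Sec P) (φ : FibredChart P) {x : X}
    (hx : s.toFun x ∈ φ.total.source) (u : P.TX (s.toFun x)) :
    φ.dTotal (s.toFun x) ((s.prolong x).toLin u) =
      fderiv ℝ (s.rep φ) (φ.base x) (φ.dBase (s.toFun x) u) := by
  have hb := φ.base_mem_source s hx
  have hd1 : MDifferentiableAt (IX n) (IX n) φ.base x :=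
    (contMDiffAt_of_mem_maximalAtlas φ.base_mem hb).mdifferentiableAt (by simp)
  have hd2 : MDifferentiableAt (IX n) (IY n m) s.toFun x := (s.smooth x).mdifferentiableAt (by simp)
  have hd3 : MDifferentiableAt (IY n m) (IY n m) φ.total (s.toFun x) :=
    (contMDiffAt_of_mem_maximalAtlas φ.total_mem hx).mdifferentiableAt (by simp)
  have hd4 : MDifferentiableAt (IX n) (IY n m) (s.rep φ) (φ.base x) :=
    ((s.contDiffAt_rep φ hx).differentiableAt (by simp)).mdifferentiableAt
  have heq : s.rep φ ∘ φ.base =ᶠ[nhds x] φ.total ∘ s.toFun := by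
    filter_upwards [φ.base.open_source.mem_nhds hb] with z hz
    simp [Sec.rep, φ.base.left_inv hz]
  have h1 := mfderiv_comp x hd4 hd1
  rw [heq.mfderiv_eq, mfderiv_comp x hd3 hd2, mfderiv_eq_fderiv] at h1
  have h2 := congrArg (fun f => f (tangentCongr (s.isSection x) u)) h1
  have h3 := fromTangentSpace_mfderiv_tangentCongr φ.base (s.isSection x) u
  change φ.dTotal (s.toFun x) ((s.prolong x).toLin u) = fderiv ℝ (s.rep φ) (φ.base x)
    (NormedSpace.fromTangentSpace (𝕜 := ℝ) _ (mfderiv (IX n) (IX n) φ.base _ u))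
  rw [← h3]
  exact h2

theorem Sec.jetCoord_prolong (s : Sec P) (φ : FibredChart P) {x : X}
    (hx : s.toFun x ∈ φ.total.source) (lam : Fin n) (i : Fin m) :
    φ.jetCoord (s.toFun x) (s.prolong x) lam i =
      (fderiv ℝ (s.rep φ) (φ.base x) (EuclideanSpace.single lam 1)).2 i := by
  rw [FibredChart.jetCoord, s.dTotal_prolong φ hx, φ.dBase_frame hx]

/-- This is the bridge between the partial derivatives in the field equations and the intrinsic jet
`J¹s`. -/
theorem Sec.pdBase_rep (s : Sec P) (φ : FibredChart P) {x : X}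
    (hx : s.toFun x ∈ φ.total.source) (lam : Fin n) (i : Fin m) :
    pdBase (fun u => (s.rep φ u).2 i) (φ.base x) lam =
      φ.jetCoord (s.toFun x) (s.prolong x) lam i := by
  have h1 : HasFDerivAt (s.rep φ) (fderiv ℝ (s.rep φ) (φ.base x)) (φ.base x) :=
    ((s.contDiffAt_rep φ hx).differentiableAt (by simp)).hasFDerivAt
  have h2 := ((EuclideanSpace.proj i : Fib m →L[ℝ] ℝ).comp
    (ContinuousLinearMap.snd ℝ (Base n) (Fib m))).hasFDerivAt.comp (φ.base x) h1
  rw [s.jetCoord_prolong φ hx, pdBase]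
  exact congrArg (fun f => f (EuclideanSpace.single lam 1)) h2.fderiv

theorem Sec.contMDiffAt_jetCoord_prolong (s : Sec P) (φ : FibredChart P) {x : X}
    (hx : s.toFun x ∈ φ.total.source) (lam : Fin n) (i : Fin m) :
    ContMDiffAt (IX n) 𝓘(ℝ, ℝ) ∞
      (fun x => φ.jetCoord (s.toFun x) (s.prolong x) lam i) x := by
  have h1 : ContDiffAt ℝ ∞ (fderiv ℝ (s.rep φ)) (φ.base x) :=
    (s.contDiffAt_rep φ hx).fderiv_right (by simp)
  have h2 : ContDiffAt ℝ ∞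
      (fun u => (fderiv ℝ (s.rep φ) u (EuclideanSpace.single lam 1)).2 i) (φ.base x) :=
    ((EuclideanSpace.proj i : Fib m →L[ℝ] ℝ).comp
      (ContinuousLinearMap.snd ℝ (Base n) (Fib m))).contDiff.contDiffAt.comp (φ.base x)
        (h1.clm_apply contDiffAt_const)
  have h3 := h2.contMDiffAt.comp x
    (contMDiffAt_of_mem_maximalAtlas φ.base_mem (φ.base_mem_source s hx))
  refine h3.congr_of_eventuallyEq ?_
  filter_upwards [s.smooth.continuous.continuousAt.preimage_mem_nhds
    (φ.total.open_source.mem_nhds hx)] with z hz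
  exact s.jetCoord_prolong φ hz lam i

/-! ### Existence of connections -/

section Exists

variable [IsManifold (IY n m) ∞ Y] [T2Space Y] [SecondCountableTopology Y]

theorem exists_connection_of_local (t : ∀ y, Set (P.TX y →L[ℝ] P.TY y))
    (ht : ∀ y, Convex ℝ (t y))
    (hloc : ∀ y₀, ∃ ψ : FibredChart P, y₀ ∈ ψ.total.source ∧ ∃ U ∈ nhds y₀,
      ∃ z : Y → Fin n → Fin m → ℝ,
        (∀ lam i, ContMDiffOn (IY n m) 𝓘(ℝ, ℝ) ∞ (fun y => z y lam i) (U ∩ ψ.total.source)) ∧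
        ∀ y ∈ U, ∀ hy : y ∈ ψ.total.source, (ψ.jetOfCoord hy (z y)).toLin ∈ t y) :
    ∃ Γ : Connection P, ∀ y, (Γ.toFun y).toLin ∈ t y := by
  classical
  let κ : (FibredChart P × Fin n × Fin m) → ∀ y, (P.TX y →L[ℝ] P.TY y) →ₗ[ℝ] ℝ := fun k y =>
    { toFun := fun A => (k.1.dTotal y (A (k.1.frame y k.2.1))).2 k.2.2
      map_add' := fun A B => by simp
      map_smul' := fun r A => by simp }
  -- Gluing takes place in the vector spaces of all linear maps `TX → TY`. Being a jet is an affine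
  -- condition there, so it survives convex combinations.
  let t' : ∀ y, Set (P.TX y →L[ℝ] P.TY y) := fun y =>
    t y ∩ {A | (P.dproj y).comp A = ContinuousLinearMap.id ℝ (P.TX y)}
  have ht' : ∀ y, Convex ℝ (t' y) := by
    intro y
    refine (ht y).inter fun A hA B hB r q _ _ hrq => ?_
    change (P.dproj y).comp (r • A + q • B) = _
    change (P.dproj y).comp A = _ at hA
    change (P.dproj y).comp B = _ at hB
    rw [ContinuousLinearMap.comp_add, ContinuousLinearMap.comp_smul,
      ContinuousLinearMap.comp_smul, hA, hB, ← add_smul, hrq, one_smul]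
  obtain ⟨S, hS, hSt⟩ := exists_section_of_local (E := Base n × Fib m) (M := Y)
    (fun y => P.TX y →L[ℝ] P.TY y) (fun k : FibredChart P × Fin n × Fin m => k.1.total.source)
    (fun k => k.1.total.open_source) κ t' ht' (by
      intro y₀
      obtain ⟨ψ, hψ, U, hU, z, hz, hzt⟩ := hloc y₀
      let J : ∀ y, P.Jet y := fun y =>
        if hy : y ∈ ψ.total.source then ψ.jetOfCoord hy (z y) else (P.nonempty_jet y).some
      have hJ : ∀ y (hy : y ∈ ψ.total.source), J y = ψ.jetOfCoord hy (z y) := fun y hy =>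
        dif_pos hy
      refine ⟨U ∩ ψ.total.source, Filter.inter_mem hU (ψ.total.open_source.mem_nhds hψ),
        fun y => (J y).toLin, fun k => ?_, fun y hy => ⟨?_, (J y).isSection⟩⟩
      · refine k.1.contMDiffOn_jetCoord ψ (J := J) (fun lam i => ?_) k.2.1 k.2.2
        exact (hz lam i).congr fun y hy => by rw [hJ y hy.2, ψ.jetCoord_jetOfCoord]
      · change (J y).toLin ∈ t y
        rw [hJ y hy.2]
        exact hzt y hy.1 hy.2)
  exact ⟨⟨fun y => ⟨S y, (hSt y).2⟩, fun φ lam i => hS (φ, lam, i)⟩, fun y => (hSt y).1⟩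

theorem exists_connection (P : FibredManifold n m X Y) : Nonempty (Connection P) := by
  obtain ⟨Γ, -⟩ := exists_connection_of_local (P := P) (fun _ => Set.univ)
    (fun _ => convex_univ) (fun y₀ => by
      obtain ⟨ψ, hψ⟩ := P.exists_chart y₀
      exact ⟨ψ, hψ, Set.univ, Filter.univ_mem, fun _ => 0, fun _ _ => contMDiffOn_const,
        fun _ _ _ => Set.mem_univ _⟩)
  exact ⟨Γ⟩

/-- Every section of `Y → X` is an integral section of some connection. -/
theorem exists_connection_prolong (s : Sec P) :
    ∃ Γ : Connection P, ∀ x, Γ.toFun (s.toFun x) = s.prolong x := by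
  obtain ⟨Γ, hΓ⟩ := exists_connection_of_local (P := P)
    -- The condition fixes the value on the image of `s` and is void elsewhere. Equality of pairs
    -- avoids transport between the fibres over `y` and `s(x)`.
    (fun y => {A | ∀ x (j : P.Jet y), (⟨y, j⟩ : Σ y : Y, P.Jet y) = ⟨s.toFun x, s.prolong x⟩ →
      A = j.toLin})
    (fun y A hA B hB r q _ _ hrq x j hj => by
      rw [hA x j hj, hB x j hj, ← add_smul, hrq, one_smul])
    (fun y₀ => by
      obtain ⟨ψ, hψ⟩ := P.exists_chart y₀
      have hcont : Continuous fun y => s.toFun (P.proj y) :=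
        s.smooth.continuous.comp P.submersion.contMDiff.continuous
      refine ⟨ψ, hψ, ?_⟩
      -- Near a point of the image of `s`, the coordinates of `J¹s` are pulled back along the
      -- projection. The image is the fixed point set of `s ∘ π`, closed because `Y` is Hausdorff,
      -- so away from it any jet will do.
      by_cases h0 : s.toFun (P.proj y₀) = y₀
      · refine ⟨{y | s.toFun (P.proj y) ∈ ψ.total.source},
          (ψ.total.open_source.preimage hcont).mem_nhds (by
            change s.toFun (P.proj y₀) ∈ ψ.total.source
            rwa [h0]),
          fun y => ψ.jetCoord (s.toFun (P.proj y)) (s.prolong (P.proj y)), fun lam i y hy => ?_,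
          fun y hyU hy x j hj => ?_⟩
        · exact ((s.contMDiffAt_jetCoord_prolong ψ hy.1 lam i).comp y
            (P.submersion.contMDiff y)).contMDiffWithinAt
        · obtain ⟨rfl, hj'⟩ := Sigma.mk.inj_iff.1 hj
          obtain rfl := eq_of_heq hj'
          congr 1
          apply ψ.jetCoord_injective hy
          rw [ψ.jetCoord_jetOfCoord]
          change ψ.jetCoord (s.toFun (P.proj (s.toFun x))) (s.prolong (P.proj (s.toFun x))) = _
          rw [s.isSection]
      · refine ⟨{y | s.toFun (P.proj y) ≠ y},
          (isOpen_ne_fun hcont continuous_id).mem_nhds h0, fun _ => 0,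
          fun _ _ => contMDiffOn_const, fun y hyU hy x j hj => ?_⟩
        obtain ⟨rfl, -⟩ := Sigma.mk.inj_iff.1 hj
        exact absurd (by rw [s.isSection]) hyU)
  exact ⟨Γ, fun x => FibredManifold.Jet.ext (hΓ (s.toFun x) x (s.prolong x) rfl)⟩

end Exists

end

/-! ### Smooth generalized inverses of symmetric operators of constant rank -/

section GeneralizedInverse

open Module

variable {E : Type*} [NormedAddCommGroup E] [InnerProductSpace ℝ E] [FiniteDimensional ℝ E]

/-- Let `Q` be the orthogonal projection onto the range of `A₀`. As `A₀` is invertible on its range,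
`B(A) = Q A Q + (1 - Q)` is invertible for `A` near `A₀`, and `F(A) = B(A)⁻¹ Q` depends smoothly on
`A`. If `A` has the rank of `A₀`, the range of `A Q` is all of the range of `A`, and `F(A) A Q = Q`
gives `A F(A) A = A`. -/
theorem exists_smooth_generalized_inverse (A₀ : E →L[ℝ] E) (hA₀ : IsSelfAdjoint A₀) :
    ∃ F : (E →L[ℝ] E) → (E →L[ℝ] E), ∀ᶠ A in nhds A₀, ContDiffAt ℝ ∞ F A ∧
      (IsSelfAdjoint A → finrank ℝ (LinearMap.ker (A : E →ₗ[ℝ] E)) =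
        finrank ℝ (LinearMap.ker (A₀ : E →ₗ[ℝ] E)) → IsSelfAdjoint (F A) ∧ A * F A * A = A) := by
  have : CompleteSpace E := FiniteDimensional.complete ℝ E
  let R := LinearMap.range (A₀ : E →ₗ[ℝ] E)
  let Q : E →L[ℝ] E := R.starProjection
  have hQR : ∀ v, Q v ∈ R := fun v => R.starProjection_apply_mem v
  have hQv : ∀ v ∈ R, Q v = v := fun v hv => Submodule.starProjection_eq_self_iff.2 hv
  have hQQ : Q * Q = Q := by
    ext v
    exact hQv _ (hQR v)
  have hQs : IsSelfAdjoint Q := isSelfAdjoint_starProjection R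
  have hQrange : LinearMap.range (Q : E →ₗ[ℝ] E) = R := by
    ext v
    exact ⟨by rintro ⟨w, rfl⟩; exact hQR w, fun hv => ⟨v, hQv v hv⟩⟩
  let B : (E →L[ℝ] E) → (E →L[ℝ] E) := fun A => Q * A * Q + (1 - Q)
  have hBsmooth : ContDiff ℝ ∞ B :=
    ((contDiff_const.mul contDiff_id).mul contDiff_const).add contDiff_const
  have hB₀ : IsUnit (B A₀) := by
    rw [ContinuousLinearMap.isUnit_iff_bijective]
    have hinj : Function.Injective (B A₀) := by
      rw [injective_iff_map_eq_zero]
      intro v hv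
      have h1 : Q (A₀ (Q v)) + (v - Q v) = 0 := hv
      have h2 : Q (A₀ (Q v)) = A₀ (Q v) := hQv _ ⟨Q v, rfl⟩
      have h3 : A₀ (Q v) = 0 := by
        have h4 := congrArg Q h1
        rw [map_add, map_sub, map_zero, hQv _ (hQR v), sub_self, add_zero, h2, h2] at h4
        exact h4
      rw [h2, h3, zero_add, sub_eq_zero] at h1
      -- Now `v` lies both in the range and in the kernel of the self-adjoint `A₀`, and these are
      -- orthogonal.
      obtain ⟨w, hw⟩ : v ∈ R := h1 ▸ hQR v
      have h5 : inner ℝ v v = 0 := by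
        have h6 := (ContinuousLinearMap.isSelfAdjoint_iff_isSymmetric.1 hA₀) w v
        rw [hw, ContinuousLinearMap.coe_coe, h1, h3, inner_zero_right, ← h1] at h6
        exact h6
      exact inner_self_eq_zero.1 h5
    exact ⟨hinj, LinearMap.surjective_of_injective (f := (B A₀ : E →ₗ[ℝ] E)) hinj⟩
  refine ⟨fun A => Ring.inverse (B A) * Q, ?_⟩
  have hev : ∀ᶠ A in nhds A₀, IsUnit (B A) :=
    hBsmooth.continuous.continuousAt.eventually (Units.isOpen.mem_nhds hB₀)
  filter_upwards [hev] with A hA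
  have hBi : Ring.inverse (B A) * B A = 1 := Ring.inverse_mul_cancel _ hA
  refine ⟨?_, fun hAs hrank => ⟨?_, ?_⟩⟩
  · obtain ⟨u, hu⟩ := hA
    have h1 : ContDiffAt ℝ ∞ Ring.inverse (B A) := hu ▸ contDiffAt_ringInverse ℝ u
    exact (h1.comp A hBsmooth.contDiffAt).mul contDiffAt_const
  · have hBs : IsSelfAdjoint (B A) := by
      refine IsSelfAdjoint.add ?_ ((IsSelfAdjoint.one _).sub hQs)
      have h1 := hAs.conjugate Q
      rwa [hQs.star_eq] at h1
    have hBQ : Q * B A = B A * Q := by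
      simp only [B, mul_add, add_mul, mul_sub, sub_mul, mul_one, one_mul, hQQ, ← mul_assoc]
      rw [mul_assoc (Q * A) Q Q, hQQ]
    -- `B A` is block diagonal for `Q`, so its inverse commutes with `Q`, and the product of the two
    -- commuting self-adjoint operators is self-adjoint.
    have hcomm : Q * Ring.inverse (B A) = Ring.inverse (B A) * Q :=
      ((Ring.inverse_mul_eq_iff_eq_mul _ _ _ hA).2 (by
        rw [← mul_assoc, ← hBQ, mul_assoc, Ring.mul_inverse_cancel _ hA, mul_one])).symm
    have hBis : star (Ring.inverse (B A)) = Ring.inverse (B A) := by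
      rw [← Ring.inverse_star, hBs.star_eq]
    rw [IsSelfAdjoint, star_mul, hBis, hQs.star_eq, hcomm]
  · have hQAQ : Q * A * Q = B A * Q := by
      simp only [B, add_mul, sub_mul, one_mul, hQQ, sub_self, add_zero]
      rw [mul_assoc (Q * A) Q Q, hQQ]
    have hle : LinearMap.range ((A * Q : E →L[ℝ] E) : E →ₗ[ℝ] E) ≤
        LinearMap.range (A : E →ₗ[ℝ] E) := by
      rintro _ ⟨w, rfl⟩
      exact ⟨Q w, rfl⟩
    have hBinj : Function.Injective (B A : E →ₗ[ℝ] E) :=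
      ((ContinuousLinearMap.isUnit_iff_bijective).1 hA).1
    have h1 : finrank ℝ (LinearMap.range ((Q * A * Q : E →L[ℝ] E) : E →ₗ[ℝ] E)) =
        finrank ℝ R := by
      rw [hQAQ]
      have h2 : LinearMap.range ((B A * Q : E →L[ℝ] E) : E →ₗ[ℝ] E) =
          R.map (B A : E →ₗ[ℝ] E) := by
        rw [← hQrange]
        exact LinearMap.range_comp _ _
      rw [h2]
      exact (R.equivMapOfInjective _ hBinj).finrank_eq.symm
    have h3 : finrank ℝ (LinearMap.range ((Q * A * Q : E →L[ℝ] E) : E →ₗ[ℝ] E)) ≤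
        finrank ℝ (LinearMap.range ((A * Q : E →L[ℝ] E) : E →ₗ[ℝ] E)) := by
      have h4 : LinearMap.range ((Q * A * Q : E →L[ℝ] E) : E →ₗ[ℝ] E) =
          (LinearMap.range ((A * Q : E →L[ℝ] E) : E →ₗ[ℝ] E)).map (Q : E →ₗ[ℝ] E) := by
        rw [mul_assoc]
        exact LinearMap.range_comp _ _
      rw [h4]
      exact Submodule.finrank_map_le _ _
    have h5 : finrank ℝ (LinearMap.range (A : E →ₗ[ℝ] E)) = finrank ℝ R := by
      have h6 := LinearMap.finrank_range_add_finrank_ker (A : E →ₗ[ℝ] E)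
      have h7 := LinearMap.finrank_range_add_finrank_ker (A₀ : E →ₗ[ℝ] E)
      have h8 : finrank ℝ R = finrank ℝ (LinearMap.range (A₀ : E →ₗ[ℝ] E)) := rfl
      omega
    -- The dimensions are squeezed: `dim R = rank (Q A Q) ≤ rank (A Q) ≤ rank A = dim R`.
    have heq := Submodule.eq_of_le_of_finrank_le hle (by rw [h5, ← h1]; exact h3)
    ext v
    obtain ⟨w, hw⟩ : A v ∈ LinearMap.range ((A * Q : E →L[ℝ] E) : E →ₗ[ℝ] E) := by
      rw [heq]
      exact ⟨v, rfl⟩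
    have hw' : A (Q w) = A v := hw
    change A (Ring.inverse (B A) (Q (A v))) = A v
    rw [← hw']
    have h8 : Q (A (Q w)) = B A (Q w) := congrArg (fun f => f w) hQAQ
    have h9 : Ring.inverse (B A) (B A (Q w)) = Q w := congrArg (fun f => f (Q w)) hBi
    rw [h8, h9]

end GeneralizedInverse

/-! ### Coefficient arrays as operators on a Euclidean space -/

/-- Arrays as vectors of a Euclidean space. -/
def arrayEquiv (n m : ℕ) : (Fin n → Fin m → ℝ) ≃ₗ[ℝ] EuclideanSpace ℝ (Fin n × Fin m) :=
  (LinearEquiv.curry ℝ ℝ (Fin n) (Fin m)).symm.trans (WithLp.linearEquiv 2 ℝ _).symm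

theorem inner_arrayEquiv {n m : ℕ} (z w : Fin n → Fin m → ℝ) :
    inner ℝ (arrayEquiv n m z) (arrayEquiv n m w) = dot z w := by
  simp [PiLp.inner_apply, arrayEquiv, Fintype.sum_prod_type, dot_apply, mul_comm]

/-- The map `act`, as a linear map. -/
def actₗ (n m : ℕ) : (Fin n → Fin m → Fin n → Fin m → ℝ) →ₗ[ℝ]
    ((Fin n → Fin m → ℝ) →ₗ[ℝ] (Fin n → Fin m → ℝ)) where
  toFun := act
  map_add' A A' := by ext z lam i; simp [act]
  map_smul' t A := by ext z lam i; simp [act]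

/-- The operator on a Euclidean space given by the array `A`. -/
def arrayOp (n m : ℕ) : (Fin n → Fin m → Fin n → Fin m → ℝ) →ₗ[ℝ]
    (EuclideanSpace ℝ (Fin n × Fin m) →L[ℝ] EuclideanSpace ℝ (Fin n × Fin m)) :=
  ((arrayEquiv n m).conj.trans LinearMap.toContinuousLinearMap).toLinearMap.comp (actₗ n m)

theorem arrayOp_apply {n m : ℕ} (A : Fin n → Fin m → Fin n → Fin m → ℝ)
    (z : Fin n → Fin m → ℝ) :
    arrayOp n m A (arrayEquiv n m z) = arrayEquiv n m (act A z) := by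
  simp [arrayOp, actₗ, LinearEquiv.conj_apply]

theorem isSelfAdjoint_arrayOp {n m : ℕ} {A : Fin n → Fin m → Fin n → Fin m → ℝ}
    (hA : ∀ lam i mu j, A lam i mu j = A mu j lam i) : IsSelfAdjoint (arrayOp n m A) := by
  rw [ContinuousLinearMap.isSelfAdjoint_iff_isSymmetric]
  intro v w
  obtain ⟨v, rfl⟩ := (arrayEquiv n m).surjective v
  obtain ⟨w, rfl⟩ := (arrayEquiv n m).surjective w
  rw [ContinuousLinearMap.coe_coe, arrayOp_apply, arrayOp_apply, inner_arrayEquiv,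
    inner_arrayEquiv, dot_act_comm hA, dot_comm]

theorem finrank_ker_arrayOp {n m : ℕ} (A : Fin n → Fin m → Fin n → Fin m → ℝ) :
    Module.finrank ℝ (LinearMap.ker (arrayOp n m A :
      EuclideanSpace ℝ (Fin n × Fin m) →ₗ[ℝ] EuclideanSpace ℝ (Fin n × Fin m))) =
      Module.finrank ℝ (LinearMap.ker (act A)) := by
  have h : LinearMap.ker (arrayOp n m A :
      EuclideanSpace ℝ (Fin n × Fin m) →ₗ[ℝ] EuclideanSpace ℝ (Fin n × Fin m)) =
      (LinearMap.ker (act A)).map (arrayEquiv n m).toLinearMap := by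
    ext v
    obtain ⟨v, rfl⟩ := (arrayEquiv n m).surjective v
    simp [arrayOp_apply]
  rw [h]
  exact LinearEquiv.finrank_map_eq _ _

/-- The array of an operator on the Euclidean space of arrays. -/
def opArray (n m : ℕ) (lam : Fin n) (i : Fin m) (mu : Fin n) (j : Fin m) :
    (EuclideanSpace ℝ (Fin n × Fin m) →L[ℝ] EuclideanSpace ℝ (Fin n × Fin m)) →L[ℝ] ℝ :=
  (EuclideanSpace.proj (lam, i) : EuclideanSpace ℝ (Fin n × Fin m) →L[ℝ] ℝ).comp
    (ContinuousLinearMap.apply ℝ _ (arrayEquiv n m (Pi.single mu (Pi.single j 1))))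

theorem opArray_eq_dot {n m : ℕ}
    (T : EuclideanSpace ℝ (Fin n × Fin m) →L[ℝ] EuclideanSpace ℝ (Fin n × Fin m))
    (lam : Fin n) (i : Fin m) (mu : Fin n) (j : Fin m) : opArray n m lam i mu j T =
      dot ((arrayEquiv n m).symm (T (arrayEquiv n m (Pi.single mu (Pi.single j 1)))))
        (Pi.single lam (Pi.single i 1)) := by
  rw [dot_single]
  rfl

theorem linear_eq_sum {n m : ℕ} (f : (Fin n → Fin m → ℝ) →ₗ[ℝ] (Fin n → Fin m → ℝ))
    (z : Fin n → Fin m → ℝ) (lam : Fin n) (i : Fin m) :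
    f z lam i = ∑ mu, ∑ j, f (Pi.single mu (Pi.single j 1)) lam i * z mu j := by
  have h : z = ∑ mu, ∑ j, z mu j • (Pi.single mu (Pi.single j 1) : Fin n → Fin m → ℝ) := by
    ext mu j
    simp [Finset.sum_apply, Pi.single_apply, ite_apply]
  conv_lhs => rw [h]
  simp [map_sum, Finset.sum_apply, mul_comm]

theorem act_opArray {n m : ℕ}
    (T : EuclideanSpace ℝ (Fin n × Fin m) →L[ℝ] EuclideanSpace ℝ (Fin n × Fin m))
    (z : Fin n → Fin m → ℝ) :
    act (fun lam i mu j => opArray n m lam i mu j T) z =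
      (arrayEquiv n m).symm (T (arrayEquiv n m z)) := by
  ext lam i
  rw [act_apply]
  exact (linear_eq_sum ((arrayEquiv n m).symm.toLinearMap.comp
    ((T : EuclideanSpace ℝ (Fin n × Fin m) →ₗ[ℝ] EuclideanSpace ℝ (Fin n × Fin m)).comp
      (arrayEquiv n m).toLinearMap)) z lam i).symm

theorem opArray_symm {n m : ℕ}
    {T : EuclideanSpace ℝ (Fin n × Fin m) →L[ℝ] EuclideanSpace ℝ (Fin n × Fin m)}
    (hT : IsSelfAdjoint T) (lam : Fin n) (i : Fin m) (mu : Fin n) (j : Fin m) :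
    opArray n m lam i mu j T = opArray n m mu j lam i T := by
  have h := (ContinuousLinearMap.isSelfAdjoint_iff_isSymmetric.1 hT)
    (arrayEquiv n m (Pi.single mu (Pi.single j 1))) (arrayEquiv n m (Pi.single lam (Pi.single i 1)))
  rw [opArray_eq_dot, opArray_eq_dot, ← inner_arrayEquiv, ← inner_arrayEquiv,
    LinearEquiv.apply_symm_apply, LinearEquiv.apply_symm_apply]
  rw [ContinuousLinearMap.coe_coe] at h
  rw [h, real_inner_comm]

/-! ### Almost regularity and the constancy of rank -/

/-- The straightening is a local diffeomorphism, so composing with it does not change the kernel of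
the differential, and rank-nullity applies. The nullity is thus governed by `K` alone, which one
slice chart shares among all its points. -/
theorem IsSliceChart.finrank_add_finrank_ker {V : Type*} [NormedAddCommGroup V] [NormedSpace ℝ V]
    [FiniteDimensional ℝ V] {S : Set V} {p : V} {Φ : OpenPartialHomeomorph V V}
    {K : Submodule ℝ V} (h : IsSliceChart S p Φ K) {g : V → V} {c : V} (hc : g c = p)
    (hg : DifferentiableAt ℝ g c)
    (hK : LinearMap.range (fderiv ℝ (Φ ∘ g) c : V →ₗ[ℝ] V) = K) :
    Module.finrank ℝ K + Module.finrank ℝ (LinearMap.ker (fderiv ℝ g c : V →ₗ[ℝ] V)) =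
      Module.finrank ℝ V := by
  subst hc
  obtain ⟨hp, hΦ, hΦ', -⟩ := h
  have h1 : DifferentiableAt ℝ Φ (g c) :=
    (hΦ.contDiffAt (Φ.open_source.mem_nhds hp)).differentiableAt (by simp)
  have h2 : DifferentiableAt ℝ Φ.symm (Φ (g c)) :=
    (hΦ'.contDiffAt (Φ.open_target.mem_nhds (Φ.map_source hp))).differentiableAt (by simp)
  have h3 : (fderiv ℝ Φ.symm (Φ (g c))).comp (fderiv ℝ Φ (g c)) = ContinuousLinearMap.id ℝ V := by
    rw [← fderiv_comp (g c) h2 h1]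
    have heq : Φ.symm ∘ Φ =ᶠ[nhds (g c)] id := by
      filter_upwards [Φ.open_source.mem_nhds hp] with z hz
      exact Φ.left_inv hz
    rw [heq.fderiv_eq, fderiv_id]
  have hker : LinearMap.ker (fderiv ℝ g c : V →ₗ[ℝ] V) =
      LinearMap.ker (fderiv ℝ (Φ ∘ g) c : V →ₗ[ℝ] V) := by
    rw [fderiv_comp c h1 hg]
    ext v
    simp only [LinearMap.mem_ker, ContinuousLinearMap.coe_coe, ContinuousLinearMap.comp_apply]
    constructor
    · intro hv
      rw [hv, map_zero]
    · intro hv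
      have h4 := congrArg (fun f => f (fderiv ℝ g c v)) h3
      simp only [ContinuousLinearMap.comp_apply, hv, map_zero] at h4
      exact h4.symm
  rw [hker, ← hK]
  exact LinearMap.finrank_range_add_finrank_ker _

/-- The kernel of the differential of a bundle map which is affine in the fibres. -/
theorem ker_fderiv_affine {U Z : Type*} [NormedAddCommGroup U] [NormedSpace ℝ U]
    [NormedAddCommGroup Z] [NormedSpace ℝ Z] [FiniteDimensional ℝ Z] {g : U × Z → U × Z}
    (T : U → Z →ₗ[ℝ] Z) (β : U → Z) (hg : ∀ c, g c = (c.1, T c.1 c.2 + β c.1)) {c : U × Z}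
    (hd : DifferentiableAt ℝ g c) :
    LinearMap.ker (fderiv ℝ g c : U × Z →ₗ[ℝ] U × Z) =
      (LinearMap.ker (T c.1)).map (LinearMap.inr ℝ U Z) := by
  -- The map covers the identity, so a kernel vector is vertical; on vertical vectors the
  -- differential is `T`. Differentiability of `T` and `β` separately is not involved.
  have h1 : ∀ v, (fderiv ℝ g c v).1 = v.1 := by
    intro v
    have h2 := (ContinuousLinearMap.fst ℝ U Z).hasFDerivAt.comp c hd.hasFDerivAt
    have h3 : (ContinuousLinearMap.fst ℝ U Z) ∘ g = ContinuousLinearMap.fst ℝ U Z := by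
      ext w
      simp [hg]
    rw [h3] at h2
    exact (congrArg (fun f => f v)
      (h2.unique (ContinuousLinearMap.fst ℝ U Z).hasFDerivAt))
  have h4 : ∀ w : Z, fderiv ℝ g c (0, w) = (0, T c.1 w) := by
    intro w
    have h5 : HasFDerivAt (fun z : Z => ((c.1, z) : U × Z))
        (ContinuousLinearMap.inr ℝ U Z) c.2 := hasFDerivAt_prodMk_right c.1 c.2
    have h6 := HasFDerivAt.comp (f := fun z : Z => ((c.1, z) : U × Z)) c.2
      (g := g) (g' := fderiv ℝ g c) hd.hasFDerivAt h5
    have h7 : g ∘ (fun z : Z => ((c.1, z) : U × Z)) = fun z => (c.1, T c.1 z + β c.1) := by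
      ext1 z
      simp [hg]
    rw [h7] at h6
    have h8 : HasFDerivAt (fun z : Z => ((c.1, T c.1 z + β c.1) : U × Z))
        ((0 : Z →L[ℝ] U).prod (LinearMap.toContinuousLinearMap (T c.1))) c.2 :=
      (hasFDerivAt_const c.1 c.2).prodMk
        ((LinearMap.toContinuousLinearMap (T c.1)).hasFDerivAt.add_const (β c.1))
    exact congrArg (fun f => f w) (h6.unique h8)
  ext ⟨u, w⟩
  simp only [LinearMap.mem_ker, Submodule.mem_map, LinearMap.inr_apply,
    ContinuousLinearMap.coe_coe]
  constructor
  · intro h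
    have hu : u = 0 := by
      have h9 := h1 (u, w)
      rw [h] at h9
      exact h9.symm
    subst hu
    rw [h4] at h
    exact ⟨w, congrArg Prod.snd h, rfl⟩
  · rintro ⟨w', hw', h⟩
    rw [← h, h4, hw']
    rfl

section

variable {n m : ℕ} {X Y : Type*}
  [TopologicalSpace X] [ChartedSpace (Base n) X]
  [TopologicalSpace Y] [ChartedSpace (Base n × Fib m) Y]

variable {P : FibredManifold n m X Y} {L : LagDensity P}

theorem FibredChart.contDiffOn_comp_symm (φ : FibredChart P) {F : Type*} [NormedAddCommGroup F]
    [NormedSpace ℝ F] {f : Y → F}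
    (hf : ContMDiffOn (IY n m) 𝓘(ℝ, F) ∞ f φ.total.source) :
    ContDiffOn ℝ ∞ (fun u => f (φ.total.symm u)) φ.total.target := by
  rw [← contMDiffOn_iff_contDiffOn]
  exact hf.comp (contMDiffOn_symm_of_mem_maximalAtlas φ.total_mem) φ.total.mapsTo_symm

theorem FibredChart.isOpen_dom (φ : FibredChart P) : IsOpen φ.dom :=
  φ.total.open_target.preimage continuous_fst

/-- Smooth functions on `Y` as smooth functions on the domain of coordinates. -/
theorem FibredChart.contDiffOn_dom (φ : FibredChart P) {F : Type*} [NormedAddCommGroup F]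
    [NormedSpace ℝ F] {f : Y → F}
    (hf : ContMDiffOn (IY n m) 𝓘(ℝ, F) ∞ f φ.total.source) :
    ContDiffOn ℝ ∞ (fun c : Coord n m => f (φ.total.symm c.1)) φ.dom :=
  (φ.contDiffOn_comp_symm hf).comp contDiffOn_fst fun _ hc => hc

theorem contDiffOn_coord_apply {s : Set (Coord n m)} (lam : Fin n) (i : Fin m) :
    ContDiffOn ℝ ∞ (fun c : Coord n m => c.2 lam i) s :=
  (contDiff_apply_apply ℝ ℝ lam i |>.comp contDiff_snd).contDiffOn

section

variable {φ : FibredChart P}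
  {a : Y → Fin n → Fin m → Fin n → Fin m → ℝ} {b : Y → Fin n → Fin m → ℝ} {c : Y → ℝ}

/-- The rank of the Hessian of an almost regular quadratic Lagrangian is locally constant. -/
theorem IsQuadExpr.eventually_finrank_ker (h : IsQuadExpr φ L a b c) (hreg : IsAlmostRegular L)
    (ha : ∀ lam i mu j,
      ContMDiffOn (IY n m) 𝓘(ℝ, ℝ) ∞ (fun y => a y lam i mu j) φ.total.source)
    (hb : ∀ lam i, ContMDiffOn (IY n m) 𝓘(ℝ, ℝ) ∞ (fun y => b y lam i) φ.total.source)
    {y₀ : Y} (hy₀ : y₀ ∈ φ.total.source) :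
    ∀ᶠ y in nhds y₀, Module.finrank ℝ (LinearMap.ker (act (a y))) =
      Module.finrank ℝ (LinearMap.ker (act (a y₀))) := by
  let g : Coord n m → Coord n m := fun q =>
    (q.1, act (a (φ.total.symm q.1)) q.2 + b (φ.total.symm q.1))
  have hgs : ContDiffOn ℝ ∞ g φ.dom := by
    refine contDiff_fst.contDiffOn.prodMk (contDiffOn_pi.2 fun lam => contDiffOn_pi.2 fun i => ?_)
    simp only [Pi.add_apply, act_apply]
    exact (ContDiffOn.sum fun mu _ => ContDiffOn.sum fun j _ =>
      (φ.contDiffOn_dom (ha lam i mu j)).mul (contDiffOn_coord_apply mu j)).add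
        (φ.contDiffOn_dom (hb lam i))
  have hgd : ∀ q ∈ φ.dom, DifferentiableAt ℝ g q := fun q hq =>
    (hgs.contDiffAt (φ.isOpen_dom.mem_nhds hq)).differentiableAt (by simp)
  obtain ⟨hemb, hrange⟩ := hreg φ g (fun y hy j => by
    rw [h.momCoord_legendre hy]
    simp only [g, φ.total.left_inv hy])
  -- The kernel of the differential of `g` depends only on `y`, so the jet with zero coordinates
  -- serves as a continuous choice over each point.
  let q₀ : Y → Coord n m := fun y => (φ.total y, 0)
  have hq₀ : ∀ y ∈ φ.total.source, q₀ y ∈ φ.dom := fun y hy => φ.total.map_source hy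
  obtain ⟨Φ, K, hΦ⟩ := hemb (g (q₀ y₀)) ⟨_, hq₀ y₀ hy₀, rfl⟩
  have key : ∀ y ∈ φ.total.source, g (q₀ y) ∈ Φ.source →
      Module.finrank ℝ K + Module.finrank ℝ (LinearMap.ker (act (a y))) =
        Module.finrank ℝ (Coord n m) := by
    intro y hy hyΦ
    -- The slice chart chosen at `y₀` is also one at every nearby image point, with the same `K`.
    have hsl : IsSliceChart (g '' φ.dom) (g (q₀ y)) Φ K := ⟨hyΦ, hΦ.2⟩
    have h1 := hsl.finrank_add_finrank_ker rfl (hgd _ (hq₀ y hy))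
      (hrange _ (hq₀ y hy) Φ K hsl)
    rw [ker_fderiv_affine (fun u => act (a (φ.total.symm u))) (fun u => b (φ.total.symm u))
      (fun _ => rfl) (hgd _ (hq₀ y hy))] at h1
    rw [← h1]
    congr 1
    have h2 : φ.total.symm (q₀ y).1 = y := φ.total.left_inv hy
    rw [h2]
    exact (Submodule.equivMapOfInjective _ LinearMap.inr_injective _).finrank_eq
  have hcont : ContinuousAt (fun y => g (q₀ y)) y₀ := by
    have h3 : ContinuousAt q₀ y₀ := (φ.total.continuousAt hy₀).prodMk continuousAt_const
    exact ContinuousAt.comp (g := g) (hgd _ (hq₀ y₀ hy₀)).continuousAt h3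
  filter_upwards [φ.total.open_source.mem_nhds hy₀,
    hcont.preimage_mem_nhds (Φ.open_source.mem_nhds hΦ.1)] with y hy hyΦ
  have h4 := key y hy hyΦ
  have h5 := key y₀ hy₀ hΦ.1
  omega

theorem IsQuadExpr.exists_local_generalized_inverse (h : IsQuadExpr φ L a b c)
    (hreg : IsAlmostRegular L)
    (ha : ∀ lam i mu j,
      ContMDiffOn (IY n m) 𝓘(ℝ, ℝ) ∞ (fun y => a y lam i mu j) φ.total.source)
    (hb : ∀ lam i, ContMDiffOn (IY n m) 𝓘(ℝ, ℝ) ∞ (fun y => b y lam i) φ.total.source)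
    {y₀ : Y} (hy₀ : y₀ ∈ φ.total.source) :
    ∃ U ∈ nhds y₀, ∃ s : Y → Fin n → Fin m → Fin n → Fin m → ℝ,
      (∀ lam i mu j, ContMDiffOn (IY n m) 𝓘(ℝ, ℝ) ∞ (fun y => s y lam i mu j)
        (U ∩ φ.total.source)) ∧
      ∀ y ∈ U, (∀ lam i mu j, s y lam i mu j = s y mu j lam i) ∧
        ∀ z, act (a y) (act (s y) (act (a y) z)) = act (a y) z := by
  obtain ⟨F, hF⟩ := exists_smooth_generalized_inverse (arrayOp n m (a y₀))
    (isSelfAdjoint_arrayOp (h.1 y₀))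
  have hT : ContMDiffOn (IY n m) 𝓘(ℝ, EuclideanSpace ℝ (Fin n × Fin m) →L[ℝ]
      EuclideanSpace ℝ (Fin n × Fin m)) ∞ (fun y => arrayOp n m (a y)) φ.total.source := by
    have h1 : ContMDiffOn (IY n m) 𝓘(ℝ, Fin n → Fin m → Fin n → Fin m → ℝ) ∞ a φ.total.source :=
      contMDiffOn_pi_space.2 fun lam => contMDiffOn_pi_space.2 fun i =>
        contMDiffOn_pi_space.2 fun mu => contMDiffOn_pi_space.2 fun j => ha lam i mu j
    exact (LinearMap.toContinuousLinearMap (arrayOp n m)).contMDiff.comp_contMDiffOn h1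
  have hcont : ContinuousAt (fun y => arrayOp n m (a y)) y₀ :=
    hT.continuousOn.continuousAt (φ.total.open_source.mem_nhds hy₀)
  have hU := hcont.eventually hF
  -- The neighbourhood ensures both that `F` is smooth at the Hessian of `y` and that this Hessian
  -- has the rank it has at `y₀`.
  refine ⟨_, Filter.inter_mem hU (h.eventually_finrank_ker hreg ha hb hy₀),
    fun y lam i mu j => opArray n m lam i mu j (F (arrayOp n m (a y))), fun lam i mu j y hy => ?_,
    fun y hy => ?_⟩
  · have h2 := hy.1.1.1.contMDiffAt.comp_contMDiffWithinAt y (hT y hy.2)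
    exact ((opArray n m lam i mu j).contMDiff.contMDiffAt.comp_contMDiffWithinAt y h2).mono
      Set.inter_subset_right
  · obtain ⟨hs, hAA⟩ := hy.1.2 (isSelfAdjoint_arrayOp (h.1 y)) (by
      rw [finrank_ker_arrayOp, finrank_ker_arrayOp]
      exact hy.2)
    refine ⟨fun lam i mu j => opArray_symm hs lam i mu j, fun z => ?_⟩
    apply (arrayEquiv n m).injective
    rw [← arrayOp_apply, act_opArray, LinearEquiv.apply_symm_apply, ← arrayOp_apply]
    exact congrArg (fun f => f (arrayEquiv n m z)) hAA

end

end

/-! ### Existence of the form `σ` -/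

section

variable {n m : ℕ} {X Y : Type*}
  [TopologicalSpace X] [ChartedSpace (Base n) X]
  [TopologicalSpace Y] [ChartedSpace (Base n × Fib m) Y]

variable {P : FibredManifold n m X Y} {L : LagDensity P}

theorem contMDiffOn_act {E M : Type*} [NormedAddCommGroup E] [NormedSpace ℝ E]
    [TopologicalSpace M] [ChartedSpace E M] {A : M → Fin n → Fin m → Fin n → Fin m → ℝ}
    {z : M → Fin n → Fin m → ℝ} {S : Set M}
    (hA : ∀ lam i mu j, ContMDiffOn 𝓘(ℝ, E) 𝓘(ℝ, ℝ) ∞ (fun y => A y lam i mu j) S)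
    (hz : ∀ lam i, ContMDiffOn 𝓘(ℝ, E) 𝓘(ℝ, ℝ) ∞ (fun y => z y lam i) S)
    (lam : Fin n) (i : Fin m) :
    ContMDiffOn 𝓘(ℝ, E) 𝓘(ℝ, ℝ) ∞ (fun y => act (A y) (z y) lam i) S := by
  simp only [act_apply]
  exact contMDiffOn_finsetSum fun mu _ => contMDiffOn_finsetSum fun j _ =>
    (hA lam i mu j).mul (hz mu j)

open Classical in
/-- The momentum at `y` whose only nonzero coordinate is `p^mu_j = 1`. -/
def FibredChart.unitMom (φ : FibredChart P) (y : Y) (mu : Fin n) (j : Fin m) : P.Mom y :=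
  if hy : y ∈ φ.total.source then (φ.momEquiv hy).symm (Pi.single mu (Pi.single j 1)) else 0

theorem FibredChart.momCoord_unitMom (φ : FibredChart P) {y : Y} (hy : y ∈ φ.total.source)
    (mu : Fin n) (j : Fin m) :
    φ.momCoord y (φ.unitMom y mu j) = Pi.single mu (Pi.single j 1) := by
  rw [unitMom, dif_pos hy, φ.momCoord_momEquiv_symm]

/-- Every linear map of a fibre of `Π` to a fibre of `T*X ⊗ VY` has coordinates. -/
theorem FibredChart.isFormExpr (φ : FibredChart P) (σ : ∀ y : Y, P.Mom y →ₗ[ℝ] P.Sold y) :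
    IsFormExpr φ σ (fun y lam i mu j => φ.soldCoord y (σ y (φ.unitMom y mu j)) lam i) := by
  intro y hy p lam i
  have h := linear_eq_sum ((φ.soldCoordₗ y).comp ((σ y).comp (φ.momEquiv hy).symm.toLinearMap))
    (φ.momCoord y p) lam i
  simp only [LinearMap.comp_apply, LinearEquiv.coe_coe, φ.soldCoordₗ_apply] at h
  rw [← φ.momEquiv_apply hy, LinearEquiv.symm_apply_apply] at h
  simp only [unitMom, dif_pos hy]
  exact h

theorem FibredChart.contMDiffOn_formCoeff (φ ψ : FibredChart P)
    {σ : ∀ y : Y, P.Mom y →ₗ[ℝ] P.Sold y} {s : Y → Fin n → Fin m → Fin n → Fin m → ℝ}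
    (h : IsFormExpr ψ σ s) {S : Set Y} (hS : S ⊆ φ.total.source ∩ ψ.total.source)
    (hs : ∀ lam i mu j, ContMDiffOn (IY n m) 𝓘(ℝ, ℝ) ∞ (fun y => s y lam i mu j) S)
    (lam : Fin n) (i : Fin m) (mu : Fin n) (j : Fin m) :
    ContMDiffOn (IY n m) 𝓘(ℝ, ℝ) ∞
      (fun y => φ.soldCoord y (σ y (φ.unitMom y mu j)) lam i) S := by
  refine φ.contMDiffOn_soldCoord ψ hS (fun rho k => ?_) lam i
  have h1 : ∀ rho k, ContMDiffOn (IY n m) 𝓘(ℝ, ℝ) ∞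
      (fun y => ψ.momCoord y (φ.unitMom y mu j) rho k) S := by
    refine ψ.contMDiffOn_momCoord φ (fun y hy => ⟨(hS hy).2, (hS hy).1⟩) fun rho k => ?_
    refine (contMDiffOn_const
      (c := (Pi.single mu (Pi.single j 1) : Fin n → Fin m → ℝ) rho k)).congr fun y hy => ?_
    rw [φ.momCoord_unitMom (hS hy).1]
  exact (contMDiffOn_act hs h1 rho k).congr fun y hy => by rw [h.soldCoord_eq (hS hy).2]

/-- Both conditions are affine in `σ`, so they can be glued. Reflexivity is quadratic in `σ` and is
therefore arranged after the gluing. -/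
theorem convex_symm_sectionOn (L : LagDensity P) (y : Y) :
    Convex ℝ {σ : P.Mom y →ₗ[ℝ] P.Sold y | (∀ p q : P.Mom y, q (σ p) = p (σ q)) ∧
      ∀ p ∈ constraint L y, linLegendre L y (σ p) = p} := by
  rintro σ ⟨hσ, hσ'⟩ τ ⟨hτ, hτ'⟩ r q - - hrq
  refine ⟨fun p p' => ?_, fun p hp => ?_⟩
  · rw [LinearMap.add_apply, LinearMap.smul_apply, LinearMap.smul_apply, map_add, map_smul,
      map_smul, LinearMap.add_apply, LinearMap.smul_apply, LinearMap.smul_apply, map_add, map_smul,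
      map_smul, hσ p p', hτ p p']
  · rw [LinearMap.add_apply, LinearMap.smul_apply, LinearMap.smul_apply, map_add, map_smul,
      map_smul, hσ' p hp, hτ' p hp, ← add_smul, hrq, one_smul]

section Exists

variable [IsManifold (IY n m) ∞ Y] [T2Space Y] [SecondCountableTopology Y]

theorem exists_linForm_of_local (t : ∀ y, Set (P.Mom y →ₗ[ℝ] P.Sold y))
    (ht : ∀ y, Convex ℝ (t y))
    (hloc : ∀ y₀, ∃ ψ : FibredChart P, y₀ ∈ ψ.total.source ∧ ∃ U ∈ nhds y₀,
      ∃ (σ : ∀ y : Y, P.Mom y →ₗ[ℝ] P.Sold y) (s : Y → Fin n → Fin m → Fin n → Fin m → ℝ),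
        IsFormExpr ψ σ s ∧
        (∀ lam i mu j, ContMDiffOn (IY n m) 𝓘(ℝ, ℝ) ∞ (fun y => s y lam i mu j)
          (U ∩ ψ.total.source)) ∧
        ∀ y ∈ U ∩ ψ.total.source, σ y ∈ t y) :
    ∃ σ : LinForm P, ∀ y, σ.toFun y ∈ t y := by
  let κ : (FibredChart P × (Fin n × Fin m) × Fin n × Fin m) →
      ∀ y, (P.Mom y →ₗ[ℝ] P.Sold y) →ₗ[ℝ] ℝ := fun k y =>
    { toFun := fun σ =>
        k.1.soldCoordₗ y (σ (k.1.unitMom y k.2.2.1 k.2.2.2)) k.2.1.1 k.2.1.2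
      map_add' := fun σ τ => by rw [LinearMap.add_apply, map_add]; rfl
      map_smul' := fun r σ => by rw [LinearMap.smul_apply, map_smul]; rfl }
  obtain ⟨S, hS, hSt⟩ := exists_section_of_local (E := Base n × Fib m) (M := Y)
    (fun y => P.Mom y →ₗ[ℝ] P.Sold y)
    (fun k : FibredChart P × (Fin n × Fin m) × Fin n × Fin m => k.1.total.source)
    (fun k => k.1.total.open_source) κ t ht (by
      intro y₀
      obtain ⟨ψ, hψ, U, hU, σ, s, hform, hs, hσ⟩ := hloc y₀
      refine ⟨U ∩ ψ.total.source, Filter.inter_mem hU (ψ.total.open_source.mem_nhds hψ), σ,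
        fun k => ?_, hσ⟩
      exact k.1.contMDiffOn_formCoeff ψ hform (fun y hy => ⟨hy.2, hy.1.2⟩)
        (fun lam i mu j => (hs lam i mu j).mono Set.inter_subset_left) _ _ _ _)
  exact ⟨⟨S, fun φ => ⟨_, φ.isFormExpr S, fun lam i mu j => hS (φ, (lam, i), mu, j)⟩⟩, hSt⟩

theorem exists_linForm_symm_sectionOn (hL : IsQuadratic L) (hreg : IsAlmostRegular L)
    (hzero : ∀ y : Y, (0 : P.Mom y) ∈ constraint L y) :
    ∃ σ : LinForm P, σ.IsSymm ∧ σ.SectionOn L := by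
  classical
  obtain ⟨σ, hσ⟩ := exists_linForm_of_local (P := P) _ (convex_symm_sectionOn L) (by
    intro y₀
    obtain ⟨ψ, hψ⟩ := P.exists_chart y₀
    obtain ⟨a, b, c, h, ha, hb, -⟩ := hL ψ
    obtain ⟨U, hU, s, hs, hsU⟩ := h.exists_local_generalized_inverse hreg ha hb hψ
    let σ : ∀ y, P.Mom y →ₗ[ℝ] P.Sold y := fun y =>
      if hy : y ∈ ψ.total.source then
        (ψ.soldEquiv hy).symm.toLinearMap.comp ((act (s y)).comp (ψ.momCoordₗ y))
      else 0
    have hσ : ∀ y ∈ ψ.total.source, ∀ p : P.Mom y,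
        ψ.soldCoord y (σ y p) = act (s y) (ψ.momCoord y p) := by
      intro y hy p
      simp only [σ, dif_pos hy]
      exact ψ.soldCoord_soldEquiv_symm hy _
    refine ⟨ψ, hψ, U, hU, σ, s, fun y hy p lam i => by rw [hσ y hy p, act_apply], hs,
      fun y hy => ⟨fun p q => ?_, fun p hp => ?_⟩⟩
    · apply ψ.density_ext hy.2
      rw [ψ.mom_apply_frame_dot hy.2, ψ.mom_apply_frame_dot hy.2, hσ y hy.2, hσ y hy.2,
        dot_comm, dot_act_comm (hsU y hy.1).1, dot_comm]
    -- As `Q = Im A`, the section property is the identity `A σ A = A` of the local generalized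
    -- inverse.
    · rw [hL.constraint_eq (hzero y)] at hp
      obtain ⟨v, rfl⟩ := hp
      apply ψ.momCoord_injective hy.2
      rw [h.momCoord_linLegendre hy.2, hσ y hy.2, h.momCoord_linLegendre hy.2,
        (hsU y hy.1).2])
  exact ⟨σ, fun y => (hσ y).1, fun y => (hσ y).2⟩

/-- If `σ` is symmetric and `A σ A = A`, then `σ A σ` keeps both properties and satisfies `(σ A σ) A
(σ A σ) = σ A σ`. -/
theorem exists_linForm (hL : IsQuadratic L) (hreg : IsAlmostRegular L)
    (hzero : ∀ y : Y, (0 : P.Mom y) ∈ constraint L y) :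
    ∃ σ : LinForm P, σ.IsSymm ∧ σ.SectionOn L ∧ σ.Reflexive L := by
  obtain ⟨σ, hσ, hσL⟩ := exists_linForm_symm_sectionOn hL hreg hzero
  have hmem : ∀ (y : Y) (v : P.Sold y), linLegendre L y v ∈ constraint L y := by
    intro y v
    rw [hL.constraint_eq (hzero y)]
    exact ⟨v, rfl⟩
  refine ⟨⟨fun y => (σ.toFun y).comp ((linLegendre L y).comp (σ.toFun y)), fun φ => ?_⟩, ?_, ?_, ?_⟩
  · obtain ⟨s, hs, hss⟩ := σ.smooth φ
    obtain ⟨a, b, c, h, ha, hb, -⟩ := hL φ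
    refine ⟨_, φ.isFormExpr _, fun lam i mu j => ?_⟩
    refine (contMDiffOn_act hss (contMDiffOn_act ha (contMDiffOn_act hss (fun rho k =>
      contMDiffOn_const
        (c := (Pi.single mu (Pi.single j 1) : Fin n → Fin m → ℝ) rho k)))) lam i).congr
      fun y hy => ?_
    simp only [LinearMap.comp_apply]
    rw [hs.soldCoord_eq hy, h.momCoord_linLegendre hy, hs.soldCoord_eq hy,
      φ.momCoord_unitMom hy]
  · intro y p q
    simp only [LinearMap.comp_apply]
    rw [hσ y _ q, hL.linLegendre_symm, hσ y _ p]
  · intro y p hp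
    simp only [LinearMap.comp_apply]
    rw [hσL y _ (hmem y _), hσL y p hp]
  · intro y p
    simp only [LinearMap.comp_apply]
    rw [hσL y _ (hmem y _), hσL y _ (hmem y _)]

end Exists

end

section

variable {n m : ℕ} {X Y : Type*}
  [TopologicalSpace X] [ChartedSpace (Base n) X]
  [TopologicalSpace Y] [ChartedSpace (Base n × Fib m) Y]

variable {P : FibredManifold n m X Y} {L : LagDensity P}

/-! ### Connections with values in the kernel of the Legendre morphism -/

/-- The coordinates `Γ^i_λ` of a connection. -/
def Connection.coord (Γ : Connection P) (φ : FibredChart P) (y : Y) : Fin n → Fin m → ℝ :=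
  φ.jetCoord y (Γ.toFun y)

/-- The connection `S ∘ Γ`. -/
def Connection.gauge (Γ : Connection P) (hL : IsQuadratic L) (σ : LinForm P) : Connection P where
  toFun y := gaugeProj L σ y (Γ.toFun y)
  smooth φ lam i := by
    obtain ⟨a, b, c, h, ha, hb, -⟩ := hL φ
    obtain ⟨s, hs, hss⟩ := σ.smooth φ
    have h1 : ContMDiffOn (IY n m) 𝓘(ℝ, ℝ) ∞
        (fun y => -act (s y) (act (a y) (φ.jetCoord y (Γ.toFun y)) + b y) lam i
          + φ.jetCoord y (Γ.toFun y) lam i) φ.total.source :=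
      (contMDiffOn_act hss (fun mu j =>
        (contMDiffOn_act ha (Γ.smooth φ) mu j).add (hb mu j)) lam i).neg.add (Γ.smooth φ lam i)
    refine h1.congr fun y hy => ?_
    rw [gaugeProj, φ.jetCoord_vadd, ← φ.soldCoordₗ_apply, map_neg, φ.soldCoordₗ_apply, dynProj,
      hs.soldCoord_eq hy, h.momCoord_legendre hy]
    rfl

theorem Connection.gauge_inKer [IsManifold (IY n m) ∞ Y] (Γ : Connection P) (hL : IsQuadratic L)
    {σ : LinForm P} (hσ : σ.SectionOn L) : (Γ.gauge hL σ).InKer L :=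
  fun y => legendre_gaugeProj hL hσ (Γ.toFun y)

/-! ### Functions which are quadratic in the fibre coordinates -/

/-- The function `½ A^{λμ}_{ij} z^i_λ z^j_μ + B^λ_i z^i_λ + C` of the coordinates. -/
def quadFun (A : Base n × Fib m → Fin n → Fin m → Fin n → Fin m → ℝ)
    (B : Base n × Fib m → Fin n → Fin m → ℝ) (C : Base n × Fib m → ℝ) (q : Coord n m) : ℝ :=
  1 / 2 * dot (act (A q.1) q.2) q.2 + dot (B q.1) q.2 + C q.1

theorem contDiffOn_act_dom {φ : FibredChart P} {A : Y → Fin n → Fin m → Fin n → Fin m → ℝ}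
    (hA : ∀ lam i mu j,
      ContMDiffOn (IY n m) 𝓘(ℝ, ℝ) ∞ (fun y => A y lam i mu j) φ.total.source)
    (lam : Fin n) (i : Fin m) :
    ContDiffOn ℝ ∞ (fun q : Coord n m => act (A (φ.total.symm q.1)) q.2 lam i) φ.dom := by
  simp only [act_apply]
  exact ContDiffOn.sum fun mu _ => ContDiffOn.sum fun j _ =>
    (φ.contDiffOn_dom (hA lam i mu j)).mul (contDiffOn_coord_apply mu j)

theorem contDiffOn_quadFun {φ : FibredChart P} {A : Y → Fin n → Fin m → Fin n → Fin m → ℝ}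
    {B : Y → Fin n → Fin m → ℝ} {C : Y → ℝ}
    (hA : ∀ lam i mu j,
      ContMDiffOn (IY n m) 𝓘(ℝ, ℝ) ∞ (fun y => A y lam i mu j) φ.total.source)
    (hB : ∀ lam i, ContMDiffOn (IY n m) 𝓘(ℝ, ℝ) ∞ (fun y => B y lam i) φ.total.source)
    (hC : ContMDiffOn (IY n m) 𝓘(ℝ, ℝ) ∞ C φ.total.source) :
    ContDiffOn ℝ ∞ (quadFun (fun u => A (φ.total.symm u)) (fun u => B (φ.total.symm u))
      (fun u => C (φ.total.symm u))) φ.dom := by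
  refine ((contDiffOn_const.mul ?_).add ?_).add (φ.contDiffOn_dom hC)
  · simp only [dot_apply]
    exact ContDiffOn.sum fun lam _ => ContDiffOn.sum fun i _ =>
      (contDiffOn_act_dom hA lam i).mul (contDiffOn_coord_apply lam i)
  · simp only [dot_apply]
    exact ContDiffOn.sum fun lam _ => ContDiffOn.sum fun i _ =>
      (φ.contDiffOn_dom (hB lam i)).mul (contDiffOn_coord_apply lam i)

/-- The derivative of a quadratic function along the fibre. -/
theorem fderiv_quadFun_fibre {A : Base n × Fib m → Fin n → Fin m → Fin n → Fin m → ℝ}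
    {B : Base n × Fib m → Fin n → Fin m → ℝ} {C : Base n × Fib m → ℝ} {q : Coord n m}
    (hA : ∀ lam i mu j, A q.1 lam i mu j = A q.1 mu j lam i)
    (hd : DifferentiableAt ℝ (quadFun A B C) q) (z : Fin n → Fin m → ℝ) :
    fderiv ℝ (quadFun A B C) q (0, z) = dot (act (A q.1) q.2 + B q.1) z := by
  -- Along a fibre direction the base point is frozen and the function is an explicit quadratic
  -- polynomial in `t`.
  rw [← hd.lineDeriv_eq_fderiv]
  refine HasLineDerivAt.lineDeriv ?_
  have h1 : (fun t : ℝ => quadFun A B C (q + t • ((0, z) : Coord n m))) = fun t =>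
      quadFun A B C q + t * dot (act (A q.1) q.2 + B q.1) z
        + t ^ 2 * (1 / 2 * dot (act (A q.1) z) z) := by
    funext t
    simp only [quadFun, Prod.fst_add, Prod.snd_add, Prod.smul_fst, Prod.smul_snd, smul_zero,
      add_zero, map_add, map_smul, LinearMap.add_apply, LinearMap.smul_apply, smul_eq_mul]
    rw [dot_act_comm hA z q.2]
    ring
  rw [HasLineDerivAt, h1]
  have h2 := ((hasDerivAt_id (0 : ℝ)).mul_const (dot (act (A q.1) q.2 + B q.1) z)).const_add
    (quadFun A B C q)
  have h3 := ((hasDerivAt_id (0 : ℝ)).pow 2).mul_const (1 / 2 * dot (act (A q.1) z) z)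
  refine (h2.add h3).congr_deriv ?_
  simp

theorem pd_quadFun_dirZ {A : Base n × Fib m → Fin n → Fin m → Fin n → Fin m → ℝ}
    {B : Base n × Fib m → Fin n → Fin m → ℝ} {C : Base n × Fib m → ℝ} {q : Coord n m}
    (hA : ∀ lam i mu j, A q.1 lam i mu j = A q.1 mu j lam i)
    (hd : DifferentiableAt ℝ (quadFun A B C) q) (lam : Fin n) (i : Fin m) :
    pd (quadFun A B C) q (dirZ lam i) = act (A q.1) q.2 lam i + B q.1 lam i := by
  refine (fderiv_quadFun_fibre hA hd (Pi.single lam (Pi.single i 1))).trans ?_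
  rw [dot_single]
  rfl

/-! ### Hamiltonian forms -/

/-- Each point of the domain consists of the coordinates of some momentum, so `H` determines its
local Hamiltonian there. Statements about all `η` can therefore be checked on one smooth
representative. -/
theorem IsHamExpr.eqOn [IsManifold (IY n m) ∞ Y] {φ : FibredChart P} {H : HamForm P}
    {η η' : Coord n m → ℝ} (h : IsHamExpr φ H η) (h' : IsHamExpr φ H η') :
    Set.EqOn η η' φ.dom := by
  rintro ⟨u, z⟩ hu
  have hy := φ.total.map_target hu
  obtain ⟨j⟩ := P.nonempty_jet (φ.total.symm u)
  have h1 := h _ hy ((φ.momEquiv hy).symm z) j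
  rw [h' _ hy, sub_right_inj, φ.momCoord_momEquiv_symm, φ.total.right_inv hu] at h1
  exact h1.symm

theorem IsHamExpr.fderiv_eq [IsManifold (IY n m) ∞ Y] {φ : FibredChart P} {H : HamForm P}
    {η η' : Coord n m → ℝ} (h : IsHamExpr φ H η) (h' : IsHamExpr φ H η') {q : Coord n m}
    (hq : q ∈ φ.dom) : fderiv ℝ η q = fderiv ℝ η' q :=
  ((h.eqOn h').eventuallyEq_of_mem (φ.isOpen_dom.mem_nhds hq)).fderiv_eq

theorem FibredChart.mem_dom (φ : FibredChart P) {y : Y} (hy : y ∈ φ.total.source)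
    (z : Fin n → Fin m → ℝ) : ((φ.total y, z) : Coord n m) ∈ φ.dom := φ.total.map_source hy

theorem IsMomMorphismOf.unique [IsManifold (IY n m) ∞ Y] {H : HamForm P} {Φ Φ' : MomMorphism P}
    (hH : IsHamiltonian H) (h : IsMomMorphismOf H Φ) (h' : IsMomMorphismOf H Φ') : Φ = Φ' := by
  funext y p
  obtain ⟨φ, hy⟩ := P.exists_chart y
  obtain ⟨η, hη, -⟩ := hH.2 φ
  apply φ.jetCoord_injective hy
  ext lam i
  rw [h φ η hη y hy, h' φ η hη y hy]

section QuadHam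

variable {Γ : Connection P} {σ : LinForm P}

theorem quadHam_apply_frame {φ : FibredChart P} {a s : Y → Fin n → Fin m → Fin n → Fin m → ℝ}
    {b : Y → Fin n → Fin m → ℝ} {c : Y → ℝ} (hΓ : Γ.InKer L) (h : IsQuadExpr φ L a b c)
    (hs : IsFormExpr φ σ.toFun s) {y : Y} (hy : y ∈ φ.total.source) (p : P.Mom y) (j : P.Jet y) :
    quadHam L Γ σ y p j (φ.frame y) = dot (φ.momCoord y p) (φ.jetCoord y j) -
      (dot (φ.jetCoord y (Γ.toFun y)) (φ.momCoord y p - (1 / 2 : ℝ) • b y)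
        + 1 / 2 * dot (act (s y) (φ.momCoord y p)) (φ.momCoord y p) - c y) := by
  -- `Γ` in the kernel means `a Γ + b = 0`, so `½ a Γ Γ + b Γ` reduces to `½ b Γ`; this is the
  -- origin of the shift by `½ b` in `H`.
  have hk : act (a y) (φ.jetCoord y (Γ.toFun y)) = -b y := by
    have h1 := h.momCoord_legendre hy (Γ.toFun y)
    rw [hΓ y, ← φ.momCoordₗ_apply, map_zero] at h1
    exact (neg_eq_of_add_eq_zero_left h1.symm).symm
  simp only [quadHam, AlternatingMap.add_apply, AlternatingMap.sub_apply,
    AlternatingMap.smul_apply, φ.mom_apply_frame_dot hy, φ.soldCoord_vsub, hs.soldCoord_eq hy,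
    h.apply_frame hy, hk, map_sub, map_smul, map_neg, LinearMap.neg_apply, smul_eq_mul]
  rw [dot_comm (act (s y) (φ.momCoord y p)), dot_comm (b y),
    dot_comm (φ.jetCoord y (Γ.toFun y)) (φ.momCoord y p)]
  ring

theorem isQuadHamExpr_quadHam {φ : FibredChart P} {a s : Y → Fin n → Fin m → Fin n → Fin m → ℝ}
    {b : Y → Fin n → Fin m → ℝ} {c : Y → ℝ} (hΓ : Γ.InKer L) (h : IsQuadExpr φ L a b c)
    (hs : IsFormExpr φ σ.toFun s) : IsQuadHamExpr φ (quadHam L Γ σ) Γ s b c := by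
  intro y hy p j
  rw [quadHam_apply_frame hΓ h hs hy, dot_act]
  rfl

theorem isHamExpr_quadHam {φ : FibredChart P} {a s : Y → Fin n → Fin m → Fin n → Fin m → ℝ}
    {b : Y → Fin n → Fin m → ℝ} {c : Y → ℝ} (hΓ : Γ.InKer L) (h : IsQuadExpr φ L a b c)
    (hs : IsFormExpr φ σ.toFun s) :
    IsHamExpr φ (quadHam L Γ σ) (quadFun (fun u => s (φ.total.symm u))
      (fun u => Γ.coord φ (φ.total.symm u))
      (fun u => -(1 / 2 * dot (Γ.coord φ (φ.total.symm u)) (b (φ.total.symm u))) - c (φ.total.symm u))) := by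
  intro y hy p j
  rw [quadHam_apply_frame hΓ h hs hy]
  change _ - (dot (Γ.coord φ y) _ + _ - _) = _
  simp only [quadFun, φ.total.left_inv hy, map_sub, map_smul, smul_eq_mul]
  rw [dot_apply (φ.momCoord y p) (φ.jetCoord y j)]
  ring

theorem contDiffOn_quadHam_expr {φ : FibredChart P} {s : Y → Fin n → Fin m → Fin n → Fin m → ℝ}
    {b : Y → Fin n → Fin m → ℝ} {c : Y → ℝ}
    (hs : ∀ lam i mu j,
      ContMDiffOn (IY n m) 𝓘(ℝ, ℝ) ∞ (fun y => s y lam i mu j) φ.total.source)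
    (hb : ∀ lam i, ContMDiffOn (IY n m) 𝓘(ℝ, ℝ) ∞ (fun y => b y lam i) φ.total.source)
    (hc : ContMDiffOn (IY n m) 𝓘(ℝ, ℝ) ∞ c φ.total.source) :
    ContDiffOn ℝ ∞ (quadFun (fun u => s (φ.total.symm u))
      (fun u => Γ.coord φ (φ.total.symm u))
      (fun u => -(1 / 2 * dot (Γ.coord φ (φ.total.symm u)) (b (φ.total.symm u))) - c (φ.total.symm u))) φ.dom := by
  refine contDiffOn_quadFun hs (B := Γ.coord φ) (Γ.smooth φ)
    (C := fun y => -(1 / 2 * dot (Γ.coord φ y) (b y)) - c y) ?_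
  simp only [dot_apply]
  exact (contMDiffOn_const.mul (contMDiffOn_finsetSum fun lam _ =>
    contMDiffOn_finsetSum fun i _ => (Γ.smooth φ lam i).mul (hb lam i))).neg.sub hc

theorem isHamiltonian_quadHam (hL : IsQuadratic L) (hΓ : Γ.InKer L) :
    IsHamiltonian (quadHam L Γ σ) := by
  refine ⟨fun y p v j => ?_, fun φ => ?_⟩
  · simp only [quadHam, FibredManifold.vadd_vsub_assoc_jet, map_add]
    module
  · obtain ⟨a, b, c, h, ha, hb, hc⟩ := hL φ
    obtain ⟨s, hs, hss⟩ := σ.smooth φ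
    exact ⟨_, isHamExpr_quadHam hΓ h hs, contDiffOn_quadHam_expr hss hb hc⟩

/-- The gradient of `½ σ p p + Γ p` in `p` is `σ p + Γ` by the symmetry of `σ`. -/
theorem isMomMorphismOf_quadHam [IsManifold (IY n m) ∞ Y] (hL : IsQuadratic L) (hΓ : Γ.InKer L)
    (hσ : σ.IsSymm) : IsMomMorphismOf (quadHam L Γ σ) (affMor Γ σ) := by
  intro φ η hη y hy p lam i
  obtain ⟨a, b, c, h, ha, hb, hc⟩ := hL φ
  obtain ⟨s, hs, hss⟩ := σ.smooth φ
  have hq := φ.mem_dom hy (φ.momCoord y p)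
  have hd := ((contDiffOn_quadHam_expr (Γ := Γ) hss hb hc).contDiffAt
    (φ.isOpen_dom.mem_nhds hq)).differentiableAt (by simp)
  rw [pd, hη.fderiv_eq (isHamExpr_quadHam hΓ h hs) hq]
  refine Eq.trans ?_ (pd_quadFun_dirZ ?_ hd lam i).symm
  · simp only [affMor, φ.jetCoord_vadd, hs.soldCoord_eq hy, φ.total.left_inv hy, Pi.add_apply]
    rfl
  · intro lam i mu j
    simp only [φ.total.left_inv hy]
    exact hσ.coeff_symm hs hy lam i mu j

/-- A Hamiltonian form has at most one momentum morphism, here `Γ + σ`. It inverts the Legendre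
morphism on `Q` by the section property, so only `H = H_Φ + L ∘ Φ` is at stake. -/
theorem isAssociated_quadHam_iff [IsManifold (IY n m) ∞ Y] (hL : IsQuadratic L) (hΓ : Γ.InKer L)
    (hσ : σ.IsSymm) (hσL : σ.SectionOn L) :
    IsAssociated L (quadHam L Γ σ) ↔ σ.Reflexive L := by
  rw [← quadHam_eq_hamOf_iff hL hΓ hσ]
  constructor
  · rintro ⟨hH, Φ, hΦ, -, h⟩
    rwa [hΦ.unique hH (isMomMorphismOf_quadHam hL hΓ hσ)] at h
  · intro h
    exact ⟨isHamiltonian_quadHam hL hΓ, _, isMomMorphismOf_quadHam hL hΓ hσ,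
      fun y p hp => legendre_affMor hL hΓ hσL p hp, h⟩

end QuadHam

end

/-! ### Fibres of the Legendre morphism and semiregularity -/

/-- Translates of linear subspaces are connected embedded submanifolds. -/
theorem isConnected_isEmbeddedSubmanifold_translate {V : Type*} [NormedAddCommGroup V]
    [NormedSpace ℝ V] {S : Set V} (c : V) (K : Submodule ℝ V) (h : ∀ q, q ∈ S ↔ q - c ∈ K) :
    IsConnected S ∧ IsEmbeddedSubmanifold S := by
  constructor
  · have hS : S = (fun v => v + c) '' (K : Set V) := by
      ext q
      rw [h]
      exact ⟨fun hq => ⟨q - c, hq, sub_add_cancel q c⟩, by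
        rintro ⟨v, hv, rfl⟩
        simpa using hv⟩
    rw [hS]
    exact (K.convex.isConnected ⟨0, K.zero_mem⟩).image _ (by fun_prop)
  · intro p _
    refine ⟨(Homeomorph.subRight c).toOpenPartialHomeomorph, K, Set.mem_univ _, ?_, ?_, ?_⟩
    · exact (contDiff_id.sub contDiff_const).contDiffOn
    · exact (contDiff_id.add contDiff_const).contDiffOn
    · exact fun q _ => h q

theorem pdBase_clm_comp {n : ℕ} {V : Type*} [NormedAddCommGroup V] [NormedSpace ℝ V]
    {f : Base n → V} {R : Base n →L[ℝ] V} {u : Base n} (hf : HasFDerivAt f R u) (ℓ : V →L[ℝ] ℝ)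
    (lam : Fin n) :
    pdBase (fun u' => ℓ (f u')) u lam = ℓ (R (EuclideanSpace.single lam 1)) :=
  congrArg (fun T => T (EuclideanSpace.single lam 1)) (ℓ.hasFDerivAt.comp u hf).fderiv

/-- Applied to the derivative of a local section along `x^lam`, this is the expansion of the total
derivative into partial derivatives. -/
theorem coord_eq_sum {n m : ℕ} (v : Coord n m) (lam : Fin n)
    (hv : v.1.1 = EuclideanSpace.single lam 1) :
    v = dirX lam + (∑ j, v.1.2 j • (dirY j : Coord n m)) + ∑ mu, ∑ j, v.2 mu j • dirZ mu j := by
  refine Prod.ext (Prod.ext ?_ ?_) ?_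
  · simp [dirX, dirY, dirZ, Prod.fst_sum, hv]
  · ext k
    simp [dirX, dirY, dirZ, Prod.fst_sum, Prod.snd_sum, Pi.single_apply]
  · ext mu k
    simp [dirX, dirY, dirZ, Prod.snd_sum, Finset.sum_apply, Pi.single_apply]

section

variable {n m : ℕ} {X Y : Type*}
  [TopologicalSpace X] [ChartedSpace (Base n) X]
  [TopologicalSpace Y] [ChartedSpace (Base n × Fib m) Y]

variable {P : FibredManifold n m X Y} {L : LagDensity P}

/-- A nonempty fibre of an affine map is a translate of the kernel of its linear part. -/
theorem IsQuadratic.isSemiregular (hL : IsQuadratic L) : IsSemiregular L := by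
  rintro φ y hy p ⟨j₀, rfl⟩
  obtain ⟨a, b, c, h, -⟩ := hL φ
  refine isConnected_isEmbeddedSubmanifold_translate ((φ.total y, φ.jetCoord y j₀) : Coord n m)
    ((LinearMap.ker (act (a y))).map (LinearMap.inr ℝ (Base n × Fib m) _)) fun q => ?_
  have hiff : ∀ j : P.Jet y, legendre L y j = legendre L y j₀ ↔
      act (a y) (φ.jetCoord y j - φ.jetCoord y j₀) = 0 := by
    intro j
    rw [← (φ.momCoord_injective hy).eq_iff, h.momCoord_legendre hy, h.momCoord_legendre hy,
      add_left_inj, map_sub, sub_eq_zero]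
  constructor
  · rintro ⟨j, hj, rfl⟩
    refine ⟨φ.jetCoord y j - φ.jetCoord y j₀, (hiff j).1 hj, ?_⟩
    simp
  · rintro ⟨w, hw, hq⟩
    refine ⟨φ.jetOfCoord hy (w + φ.jetCoord y j₀), (hiff _).2 ?_, ?_⟩
    · rw [φ.jetCoord_jetOfCoord, add_sub_cancel_right]
      exact hw
    · simp only [φ.jetCoord_jetOfCoord]
      rw [← sub_add_cancel q (φ.total y, φ.jetCoord y j₀), ← hq]
      simp

/-! ### The first group of Hamilton equations -/

theorem MomSec.rep_base (r : MomSec P) (φ : FibredChart P) {x : X}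
    (hx : (r.toFun x).1 ∈ φ.total.source) :
    r.rep φ (φ.base x) = (φ.total (r.toFun x).1, φ.momCoord (r.toFun x).1 (r.toFun x).2) := by
  rw [MomSec.rep, φ.base.left_inv (φ.base_mem_source r.toSec hx)]

/-- The left sides `∂_lam r^i` are the coordinates of `J¹s`, and the right sides `∂η/∂p` are those
of the momentum morphism along `r`. -/
theorem solvesHamiltonFst_iff [IsManifold (IY n m) ∞ Y] {H : HamForm P} {Φ : MomMorphism P}
    (hH : IsHamiltonian H) (hΦ : IsMomMorphismOf H Φ) (r : MomSec P) :
    SolvesHamiltonFst H r ↔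
      ∀ x, r.toSec.prolong x = Φ (r.toSec.toFun x) (r.toFun x).2 := by
  constructor
  · intro h x
    obtain ⟨φ, hy⟩ := P.exists_chart (r.toSec.toFun x)
    obtain ⟨η, hη, -⟩ := hH.2 φ
    apply φ.jetCoord_injective hy
    ext lam i
    refine (r.toSec.pdBase_rep φ hy lam i).symm.trans (Eq.trans ?_
      (hΦ φ η hη _ hy (r.toFun x).2 lam i).symm)
    have h1 := h φ η hη x hy lam i
    rw [r.rep_base φ hy] at h1
    exact h1
  · intro h φ η hη x hy lam i
    rw [r.rep_base φ hy]
    refine Eq.trans ?_ (hΦ φ η hη _ hy _ lam i)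
    exact (r.toSec.pdBase_rep φ hy lam i).trans
      (congrArg (fun j => φ.jetCoord (r.toSec.toFun x) j lam i) (h x))

/-! ### The second group of Hamilton equations -/

theorem IsQuadExpr.isLagExpr {φ : FibredChart P} {a : Y → Fin n → Fin m → Fin n → Fin m → ℝ}
    {b : Y → Fin n → Fin m → ℝ} {c : Y → ℝ} (h : IsQuadExpr φ L a b c) :
    IsLagExpr φ L (quadFun (fun u => a (φ.total.symm u)) (fun u => b (φ.total.symm u))
      (fun u => c (φ.total.symm u))) := by
  intro y hy j
  rw [h.apply_frame hy]
  simp only [quadFun, φ.total.left_inv hy]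

/-- On the constraint space, `∂η/∂y^i = -∂ℓ/∂y^i` for a Hamiltonian form associated with `L`. -/
theorem pd_quadHam_dirY [IsManifold (IY n m) ∞ Y] {Γ : Connection P} {σ : LinForm P}
    (hL : IsQuadratic L) (hΓ : Γ.InKer L) (hσ : σ.IsSymm) (hσL : σ.SectionOn L)
    (hσR : σ.Reflexive L) {φ : FibredChart P}
    {a : Y → Fin n → Fin m → Fin n → Fin m → ℝ} {b : Y → Fin n → Fin m → ℝ} {c : Y → ℝ}
    (h : IsQuadExpr φ L a b c)
    (ha : ∀ lam i mu j,
      ContMDiffOn (IY n m) 𝓘(ℝ, ℝ) ∞ (fun y => a y lam i mu j) φ.total.source)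
    (hb : ∀ lam i, ContMDiffOn (IY n m) 𝓘(ℝ, ℝ) ∞ (fun y => b y lam i) φ.total.source)
    (hc : ContMDiffOn (IY n m) 𝓘(ℝ, ℝ) ∞ c φ.total.source)
    {η : Coord n m → ℝ} (hη : IsHamExpr φ (quadHam L Γ σ) η) {y : Y}
    (hy : y ∈ φ.total.source) {p : P.Mom y} (hp : p ∈ constraint L y) (i : Fin m) :
    pd η (φ.total y, φ.momCoord y p) (dirY i) =
      -pd (quadFun (fun u => a (φ.total.symm u)) (fun u => b (φ.total.symm u))
        (fun u => c (φ.total.symm u))) (φ.total y, φ.jetCoord y (affMor Γ σ y p)) (dirY i) := by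
  set l := quadFun (fun u => a (φ.total.symm u)) (fun u => b (φ.total.symm u))
    (fun u => c (φ.total.symm u)) with hl
  obtain ⟨s, hs, hss⟩ := σ.smooth φ
  -- `W` is `Φ = Γ + σ` in coordinates. By `H = H_Φ + L ∘ Φ`, the function `p·W - ℓ(W)` is a local
  -- Hamiltonian of `H`.
  let W : Coord n m → Coord n m := fun q =>
    (q.1, act (s (φ.total.symm q.1)) q.2 + Γ.coord φ (φ.total.symm q.1))
  let η' : Coord n m → ℝ := fun q => dot q.2 (W q).2 - l (W q)
  have hWy : ∀ y ∈ φ.total.source, ∀ p : P.Mom y,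
      W (φ.total y, φ.momCoord y p) = (φ.total y, φ.jetCoord y (affMor Γ σ y p)) := by
    intro y hy p
    simp only [W, φ.total.left_inv hy, affMor, φ.jetCoord_vadd, hs.soldCoord_eq hy]
    rfl
  have hη' : IsHamExpr φ (quadHam L Γ σ) η' := by
    rw [(quadHam_eq_hamOf_iff hL hΓ hσ).2 hσR]
    intro y hy p j
    simp only [η', hWy y hy]
    rw [hamOf, AlternatingMap.add_apply, φ.mom_apply_frame_dot hy, φ.soldCoord_vsub,
      h.isLagExpr y hy, map_sub, dot_apply (φ.momCoord y p) (φ.jetCoord y j)]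
    ring
  set q : Coord n m := (φ.total y, φ.momCoord y p) with hq
  have hqd : q ∈ φ.dom := φ.mem_dom hy _
  have hnhds := φ.isOpen_dom.mem_nhds hqd
  have hd' : DifferentiableAt ℝ η' q := by
    have hd := ((contDiffOn_quadHam_expr (Γ := Γ) hss hb hc).contDiffAt hnhds).differentiableAt
      (by simp)
    exact hd.congr_of_eventuallyEq
      ((hη'.eqOn (isHamExpr_quadHam hΓ h hs)).eventuallyEq_of_mem hnhds)
  have hWd : DifferentiableAt ℝ W q := by
    have hWs : ContDiffOn ℝ ∞ W φ.dom := by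
      refine contDiff_fst.contDiffOn.prodMk
        (contDiffOn_pi.2 fun lam => contDiffOn_pi.2 fun k => ?_)
      exact (contDiffOn_act_dom hss lam k).add
        (φ.contDiffOn_dom (f := fun y => Γ.coord φ y lam k) (Γ.smooth φ lam k))
    exact (hWs.contDiffAt hnhds).differentiableAt (by simp)
  have hWq : W q = (φ.total y, φ.jetCoord y (affMor Γ σ y p)) := hWy y hy p
  have hld : DifferentiableAt ℝ l (W q) := by
    rw [hWq]
    exact ((contDiffOn_quadFun ha hb hc).contDiffAt
      (φ.isOpen_dom.mem_nhds (φ.mem_dom hy _))).differentiableAt (by simp)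
  -- `W` covers the identity of `Y`, so its derivative along `∂_i` is `∂_i` plus a vertical
  -- correction `ζ`.
  have hW1 : (fderiv ℝ W q (dirY i)).1 = (dirY i : Coord n m).1 := by
    have h1 := (ContinuousLinearMap.fst ℝ (Base n × Fib m) (Fin n → Fin m → ℝ)).hasFDerivAt.comp q
      hWd.hasFDerivAt
    exact congrArg (fun f => f (dirY i)) (h1.unique
      (ContinuousLinearMap.fst ℝ (Base n × Fib m) (Fin n → Fin m → ℝ)).hasFDerivAt)
  set ζ := (fderiv ℝ W q (dirY i)).2 with hζ
  have hWv : fderiv ℝ W q (dirY i) = (dirY i : Coord n m) + (0, ζ) := by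
    refine Prod.ext ?_ ?_
    · rw [hW1]; simp
    · simp [dirY, hζ]
  have hWline : HasLineDerivAt ℝ W (fderiv ℝ W q (dirY i)) q (dirY i) :=
    hWd.hasFDerivAt.hasLineDerivAt _
  have hline : HasLineDerivAt ℝ η' (dot q.2 ζ - fderiv ℝ l (W q) (fderiv ℝ W q (dirY i))) q
      (dirY i) := by
    have h1 : HasDerivAt (fun t : ℝ => dot q.2 (W (q + t • dirY i)).2) (dot q.2 ζ) 0 := by
      have h2 := (((LinearMap.toContinuousLinearMap (dot q.2)).comp
        (ContinuousLinearMap.snd ℝ (Base n × Fib m) (Fin n → Fin m → ℝ))).hasFDerivAt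
          (x := W (q + (0 : ℝ) • dirY i))).comp_hasDerivAt (0 : ℝ) hWline
      exact h2
    have h3 : HasDerivAt (fun t : ℝ => l (W (q + t • dirY i)))
        (fderiv ℝ l (W q) (fderiv ℝ W q (dirY i))) 0 := by
      have h4 : HasFDerivAt l (fderiv ℝ l (W q)) (W (q + (0 : ℝ) • dirY i)) := by
        rw [zero_smul, add_zero]
        exact hld.hasFDerivAt
      exact h4.comp_hasDerivAt (0 : ℝ) hWline
    refine (h1.sub h3).congr_of_eventuallyEq (Filter.Eventually.of_forall fun t => ?_)
    simp [η', dirY]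
  -- The fibre derivative of `ℓ` at `Φ(p)` is the Legendre image of `Φ(p)`, which is `p` because `p`
  -- lies in `Q`. The two terms in `ζ` therefore cancel.
  have hfib : fderiv ℝ l (W q) (0, ζ) = dot q.2 ζ := by
    rw [hl, fderiv_quadFun_fibre ?_ hld]
    · rw [hWq]
      simp only [φ.total.left_inv hy]
      rw [← h.momCoord_legendre hy, legendre_affMor hL hΓ hσL p hp]
    · exact h.1 _
  rw [pd, hη.fderiv_eq hη' hqd, ← hd'.lineDeriv_eq_fderiv, hline.lineDeriv, hWv, map_add, hfib,
    pd, hWq]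
  ring

/-! ### Solutions of the Euler-Lagrange equations -/

/-- The projection of a section of `J¹Y → X` to a section of `Y → X`. -/
def JetSec.toSec (sb : JetSec P) : Sec P :=
  ⟨fun x => (sb.toFun x).1, sb.isSection, sb.smooth_base⟩

theorem JetSec.rep_base (sb : JetSec P) (φ : FibredChart P) {x : X}
    (hx : (sb.toFun x).1 ∈ φ.total.source) :
    sb.rep φ (φ.base x) = (φ.total (sb.toFun x).1, φ.jetCoord (sb.toFun x).1 (sb.toFun x).2) := by
  rw [JetSec.rep, φ.base.left_inv (φ.base_mem_source sb.toSec hx)]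

theorem JetSec.isOpen_preimage (sb : JetSec P) (φ : FibredChart P) :
    IsOpen {x | (sb.toFun x).1 ∈ φ.total.source} :=
  φ.total.open_source.preimage sb.smooth_base.continuous

theorem JetSec.differentiableAt_rep (sb : JetSec P) (φ : FibredChart P) {x : X}
    (hx : (sb.toFun x).1 ∈ φ.total.source) : DifferentiableAt ℝ (sb.rep φ) (φ.base x) := by
  have hb := φ.base_mem_source sb.toSec hx
  refine DifferentiableAt.prodMk ((sb.toSec.contDiffAt_rep φ hx).differentiableAt (by simp))
    (differentiableAt_pi.2 fun lam => differentiableAt_pi.2 fun i => ?_)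
  have h1 : ContMDiffAt (IX n) 𝓘(ℝ, ℝ) ∞
      (fun x => φ.jetCoord (sb.toFun x).1 (sb.toFun x).2 lam i) (φ.base.symm (φ.base x)) := by
    rw [φ.base.left_inv hb]
    exact (sb.smooth_coord φ lam i).contMDiffAt ((sb.isOpen_preimage φ).mem_nhds hx)
  have h2 := h1.comp (φ.base x)
    (contMDiffAt_symm_of_mem_maximalAtlas φ.base_mem (φ.base.map_source hb))
  exact (contMDiffAt_iff_contDiffAt.1 h2).differentiableAt (by simp)

theorem SolvesEulerLagrange.eq_prolong [IsManifold (IY n m) ∞ Y] (hL : IsQuadratic L)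
    {sb : JetSec P} (h : SolvesEulerLagrange L sb) (x : X) :
    (sb.toFun x).2 = sb.toSec.prolong x := by
  obtain ⟨φ, hy⟩ := P.exists_chart (sb.toFun x).1
  obtain ⟨a, b, c, hq, -⟩ := hL φ
  apply φ.jetCoord_injective hy
  ext lam i
  have h1 := (h φ _ hq.isLagExpr x hy).1 lam i
  rw [sb.rep_base φ hy] at h1
  exact h1.symm.trans (sb.toSec.pdBase_rep φ hy lam i)

/-- The image of a section of `J¹Y → X` under the Legendre morphism. -/
def JetSec.legendreSec (sb : JetSec P) (hL : IsQuadratic L) : MomSec P where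
  toFun x := ⟨(sb.toFun x).1, legendre L _ (sb.toFun x).2⟩
  isSection := sb.isSection
  smooth_base := sb.smooth_base
  smooth_coord φ lam i := by
    obtain ⟨a, b, c, h, ha, hb, -⟩ := hL φ
    have hmaps : Set.MapsTo (fun x => (sb.toFun x).1) {x | (sb.toFun x).1 ∈ φ.total.source}
        φ.total.source := fun x hx => hx
    have h1 := (contMDiffOn_act
      (fun lam i mu j => (ha lam i mu j).comp sb.smooth_base.contMDiffOn hmaps)
      (sb.smooth_coord φ) lam i).add ((hb lam i).comp sb.smooth_base.contMDiffOn hmaps)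
    refine h1.congr fun x hx => ?_
    rw [h.momCoord_legendre hx]
    rfl

/-- The momenta of the Legendre image are `∂ℓ/∂y^i_λ` along the section. By the chain rule, the
second Euler-Lagrange group says that their divergence is `∂ℓ/∂y^i`. -/
theorem SolvesEulerLagrange.sum_pdBase_legendreSec {sb : JetSec P}
    (h : SolvesEulerLagrange L sb) (hL : IsQuadratic L) {φ : FibredChart P}
    {a : Y → Fin n → Fin m → Fin n → Fin m → ℝ} {b : Y → Fin n → Fin m → ℝ} {c : Y → ℝ}
    (hq : IsQuadExpr φ L a b c)
    (ha : ∀ lam i mu j,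
      ContMDiffOn (IY n m) 𝓘(ℝ, ℝ) ∞ (fun y => a y lam i mu j) φ.total.source)
    (hb : ∀ lam i, ContMDiffOn (IY n m) 𝓘(ℝ, ℝ) ∞ (fun y => b y lam i) φ.total.source)
    (hc : ContMDiffOn (IY n m) 𝓘(ℝ, ℝ) ∞ c φ.total.source)
    {x : X} (hx : (sb.toFun x).1 ∈ φ.total.source) (i : Fin m) :
    (∑ lam, pdBase (fun u => ((sb.legendreSec hL).rep φ u).2 lam i) (φ.base x) lam) =
      pd (quadFun (fun u => a (φ.total.symm u)) (fun u => b (φ.total.symm u))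
        (fun u => c (φ.total.symm u))) (sb.rep φ (φ.base x)) (dirY i) := by
  set l := quadFun (fun u => a (φ.total.symm u)) (fun u => b (φ.total.symm u))
    (fun u => c (φ.total.symm u)) with hl
  obtain ⟨h1, h2⟩ := h φ l hq.isLagExpr x hx
  have hxb := φ.base_mem_source sb.toSec hx
  have hR := (sb.differentiableAt_rep φ hx).hasFDerivAt
  set R := fderiv ℝ (sb.rep φ) (φ.base x) with hRdef
  have hdom : sb.rep φ (φ.base x) ∈ φ.dom := by
    rw [sb.rep_base φ hx]
    exact φ.mem_dom hx _
  have hnhds := φ.isOpen_dom.mem_nhds hdom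
  have hev : ∀ᶠ u in nhds (φ.base x), u ∈ φ.base.target ∧
      (sb.toFun (φ.base.symm u)).1 ∈ φ.total.source := by
    refine Filter.Eventually.and (φ.base.open_target.mem_nhds (φ.base.map_source hxb)) ?_
    have hcont := φ.base.continuousAt_symm (φ.base.map_source hxb)
    have h3 : {x | (sb.toFun x).1 ∈ φ.total.source} ∈
        nhds (φ.base.symm (φ.base x)) := by
      rw [φ.base.left_inv hxb]
      exact (sb.isOpen_preimage φ).mem_nhds hx
    exact hcont.preimage_mem_nhds h3
  -- The `x`-coordinates of the local expression of a section at `u` are `u` itself.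
  have hR1 : ∀ lam, (R (EuclideanSpace.single lam 1)).1.1 = EuclideanSpace.single lam 1 := by
    intro lam
    have h3 := ((ContinuousLinearMap.fst ℝ (Base n) (Fib m)).comp
      (ContinuousLinearMap.fst ℝ (Base n × Fib m) (Fin n → Fin m → ℝ))).hasFDerivAt.comp
        (φ.base x) hR
    have h4 : HasFDerivAt (fun u : Base n => u) (ContinuousLinearMap.id ℝ (Base n)) (φ.base x) :=
      hasFDerivAt_id _
    refine congrArg (fun f => f (EuclideanSpace.single lam 1))
      (h3.unique (h4.congr_of_eventuallyEq ?_))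
    filter_upwards [hev] with u hu
    change (φ.total (sb.toFun (φ.base.symm u)).1).1 = u
    rw [φ.fst_eq _ hu.2, sb.isSection, φ.base.right_inv hu.1]
  have hkey : ∀ lam, pdBase (fun u => ((sb.legendreSec hL).rep φ u).2 lam i) (φ.base x) lam =
      fderiv ℝ (fun q => pd l q (dirZ lam i)) (sb.rep φ (φ.base x))
        (R (EuclideanSpace.single lam 1)) := by
    intro lam
    have hMl : ∀ q ∈ φ.dom, pd l q (dirZ lam i) =
        act (a (φ.total.symm q.1)) q.2 lam i + b (φ.total.symm q.1) lam i := fun q hqd =>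
      pd_quadFun_dirZ (hq.1 _) (((contDiffOn_quadFun ha hb hc).contDiffAt
        (φ.isOpen_dom.mem_nhds hqd)).differentiableAt (by simp)) lam i
    have hMd : DifferentiableAt ℝ (fun q => pd l q (dirZ lam i)) (sb.rep φ (φ.base x)) := by
      have h5 : ContDiffOn ℝ ∞ (fun q : Coord n m => act (a (φ.total.symm q.1)) q.2 lam i
          + b (φ.total.symm q.1) lam i) φ.dom :=
        (contDiffOn_act_dom ha lam i).add (φ.contDiffOn_dom (hb lam i))
      exact ((h5.congr hMl).contDiffAt hnhds).differentiableAt (by simp)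
    have h6 := hMd.hasFDerivAt.comp (φ.base x) hR
    refine congrArg (fun f => f (EuclideanSpace.single lam 1))
      (h6.congr_of_eventuallyEq ?_).fderiv
    filter_upwards [hev] with u hu
    have hud : sb.rep φ u ∈ φ.dom := φ.mem_dom hu.2 _
    refine Eq.trans ?_ (hMl _ hud).symm
    change φ.momCoord _ (legendre L _ _) lam i = _
    rw [hq.momCoord_legendre hu.2]
    simp only [JetSec.rep, φ.total.left_inv hu.2]
    rfl
  refine (sub_eq_zero.1 ((congrArg₂ (· - ·) rfl (Finset.sum_congr rfl fun lam _ => ?_)).trans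
    (h2 i))).symm
  rw [hkey]
  conv_lhs => rw [coord_eq_sum (R (EuclideanSpace.single lam 1)) lam (hR1 lam)]
  -- The equations spell the total derivative with `s^j_λ` in place of `∂_λ s^j`; the first group
  -- identifies the two.
  have hj : ∀ j, (R (EuclideanSpace.single lam 1)).1.2 j = (sb.rep φ (φ.base x)).2 lam j := by
    intro j
    rw [← h1 lam j]
    exact (pdBase_clm_comp hR ((EuclideanSpace.proj j : Fib m →L[ℝ] ℝ).comp
      ((ContinuousLinearMap.snd ℝ (Base n) (Fib m)).comp
        (ContinuousLinearMap.fst ℝ (Base n × Fib m) (Fin n → Fin m → ℝ)))) lam).symm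
  have hz : ∀ mu j, (R (EuclideanSpace.single lam 1)).2 mu j =
      pdBase (fun u => (sb.rep φ u).2 mu j) (φ.base x) lam := by
    intro mu j
    exact (pdBase_clm_comp hR ((ContinuousLinearMap.proj j : (Fin m → ℝ) →L[ℝ] ℝ).comp
      ((ContinuousLinearMap.proj mu : (Fin n → Fin m → ℝ) →L[ℝ] (Fin m → ℝ)).comp
        (ContinuousLinearMap.snd ℝ (Base n × Fib m) (Fin n → Fin m → ℝ)))) lam).symm
  simp only [hj, hz, map_add, map_sum, map_smul, smul_eq_mul]
  rfl

/-! ### The complete family -/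

section Family

variable [IsManifold (IY n m) ∞ Y] [T2Space Y] [SecondCountableTopology Y]

/-- Take a connection through `J¹s` and apply `S` to it. The result agrees with `S ∘ J¹s` along `s`,
and adding `σ` of the Legendre image of `J¹s` restores `J¹s`. -/
theorem exists_connection_gaugeProj (hL : IsQuadratic L) {σ : LinForm P} (hσL : σ.SectionOn L)
    (s : Sec P) : ∃ Γ : Connection P, Γ.InKer L ∧
      (∀ x : X, gaugeProj L σ (s.toFun x) (s.prolong x) = Γ.toFun (s.toFun x)) ∧
      (∀ x : X, affMor Γ σ (s.toFun x) (legendre L (s.toFun x) (s.prolong x)) = s.prolong x) := by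
  obtain ⟨Γ, hΓ⟩ := exists_connection_prolong s
  have h1 : ∀ x : X, gaugeProj L σ (s.toFun x) (s.prolong x) =
      (Γ.gauge hL σ).toFun (s.toFun x) := by
    intro x
    rw [← hΓ x]
    rfl
  refine ⟨Γ.gauge hL σ, Γ.gauge_inKer hL hσL, h1, fun x => ?_⟩
  rw [affMor, ← h1 x]
  exact ((FibredManifold.eq_neg_vadd_iff_jet _ _ _).1 rfl).symm

theorem isCompleteFamily_quadHam (hL : IsQuadratic L) {σ : LinForm P} (hσ : σ.IsSymm)
    (hσL : σ.SectionOn L) (hσR : σ.Reflexive L) :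
    IsCompleteFamily L {H | ∃ Γ : Connection P, Γ.InKer L ∧ H = quadHam L Γ σ} := by
  refine ⟨hL.isSemiregular, ?_, fun sb hsb => ?_⟩
  · rintro _ ⟨Γ, hΓ, rfl⟩
    exact (isAssociated_quadHam_iff hL hΓ hσ hσL).2 hσR
  -- The member of the family is adapted to the projection `s` of the given solution, so that `Φ`
  -- carries the Legendre image of `J¹s` back to `J¹s`.
  obtain ⟨Γ, hΓ, -, hΓs⟩ := exists_connection_gaugeProj hL hσL sb.toSec
  have hpro := hsb.eq_prolong hL
  have hmor : ∀ x, affMor Γ σ (sb.toFun x).1 (legendre L _ (sb.toFun x).2) = (sb.toFun x).2 := by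
    intro x
    rw [hpro x]
    exact hΓs x
  have hΦ := isMomMorphismOf_quadHam (σ := σ) hL hΓ hσ
  refine ⟨_, ⟨Γ, hΓ, rfl⟩, affMor Γ σ, sb.legendreSec hL, hΦ, ?_, ?_, fun x => ⟨rfl, ?_, ?_⟩⟩
  · rw [solvesHamiltonFst_iff (isHamiltonian_quadHam hL hΓ) hΦ]
    exact fun x => (hpro x).symm.trans (hmor x).symm
  · intro φ η hη x hx i
    obtain ⟨a, b, c, h, ha, hb, hc⟩ := hL φ
    rw [hsb.sum_pdBase_legendreSec hL h ha hb hc hx, (sb.legendreSec hL).rep_base φ hx,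
      sb.rep_base φ hx]
    refine Eq.trans ?_ (congrArg Neg.neg (pd_quadHam_dirY hL hΓ hσ hσL hσR h ha hb hc hη hx
      (p := legendre L _ (sb.toFun x).2) ⟨_, rfl⟩ i)).symm
    rw [neg_neg]
    exact congrArg (fun j => pd (quadFun (fun u => a (φ.total.symm u))
      (fun u => b (φ.total.symm u)) (fun u => c (φ.total.symm u)))
        (φ.total (sb.toFun x).1, φ.jetCoord (sb.toFun x).1 j) (dirY i)) (hmor x).symm
  · exact Sigma.ext rfl (heq_of_eq (hmor x).symm)
  · exact Sigma.ext rfl (heq_of_eq (hpro x))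

end Family

end

end Multimomentum

end

open Multimomentum in
theorem mainTheorem3 {n m : ℕ} {X Y : Type*}
    [TopologicalSpace X] [T2Space X] [SecondCountableTopology X]
    [ChartedSpace (Base n) X] [IsManifold (IX n) ∞ X]
    [TopologicalSpace Y] [T2Space Y] [SecondCountableTopology Y]
    [ChartedSpace (Base n × Fib m) Y] [IsManifold (IY n m) ∞ Y]
    (P : FibredManifold n m X Y) (L : LagDensity P)
    (hquad : IsQuadratic L) (hreg : IsAlmostRegular L)
    (hzero : ∀ y : Y, (0 : P.Mom y) ∈ constraint L y) :
    -- the objects `Γ` and `σ` of the construction exist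
    (∃ Γ : Connection P, Γ.InKer L) ∧
    (∃ σ : LinForm P, σ.IsSymm ∧ σ.SectionOn L ∧ σ.Reflexive L) ∧
    -- the form `H` has the stated coordinate expression and is Hamiltonian
    (∀ (Γ : Connection P) (σ : LinForm P), Γ.InKer L →
      IsHamiltonian (quadHam L Γ σ) ∧
      ∀ (φ : FibredChart P) (a : Y → Fin n → Fin m → Fin n → Fin m → ℝ)
        (b : Y → Fin n → Fin m → ℝ) (c : Y → ℝ) (s : Y → Fin n → Fin m → Fin n → Fin m → ℝ),
        IsQuadExpr φ L a b c → IsFormExpr φ σ.toFun s →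
          IsQuadHamExpr φ (quadHam L Γ σ) Γ s b c) ∧
    -- for symmetric `σ`, its momentum morphism is `Φ = Γ + σ`, and `H` is associated with `L`
    -- precisely when `σ = σ ∘ L̄ ∘ σ`
    (∀ (Γ : Connection P) (σ : LinForm P), Γ.InKer L → σ.IsSymm → σ.SectionOn L →
      IsMomMorphismOf (quadHam L Γ σ) (affMor Γ σ) ∧
      (∀ (y : Y), ∀ p ∈ constraint L y, legendre L y (affMor Γ σ y p) = p) ∧
      (IsAssociated L (quadHam L Γ σ) ↔ σ.Reflexive L)) ∧
    (∀ σ : LinForm P, σ.IsSymm → σ.SectionOn L → σ.Reflexive L →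
      -- the splittings `J¹Y = Ker ⊕ Im σ` and `Π = Ker σ ⊕ Q`
      (∀ (y : Y) (j : P.Jet y), legendre L y (gaugeProj L σ y j) = 0 ∧
        ∀ (k : P.Jet y) (w : P.Sold y), legendre L y k = 0 → w ∈ LinearMap.range (σ.toFun y) →
          (j = w +ᵥ k ↔ k = gaugeProj L σ y j ∧ w = dynProj L σ y j)) ∧
      (∀ y : Y, constraint L y = (LinearMap.range (linLegendre L y) : Set (P.Mom y)) ∧
        IsCompl (LinearMap.ker (σ.toFun y)) (LinearMap.range (linLegendre L y))) ∧
      (∀ Γ : Connection P, Γ.InKer L →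
        -- `H = H_Φ + L ∘ Φ` is associated with `L`
        quadHam L Γ σ = hamOf L (affMor Γ σ) ∧
        IsAssociated L (quadHam L Γ σ) ∧
        -- the Hamilton equations `J¹s = (Γ + σ) ∘ r`, and their splitting
        ∀ r : MomSec P,
          (SolvesHamiltonFst (quadHam L Γ σ) r ↔
            ∀ x : X, r.toSec.prolong x = affMor Γ σ (r.toSec.toFun x) (r.toFun x).2) ∧
          (SolvesHamiltonFst (quadHam L Γ σ) r ↔
            (∀ x : X, gaugeProj L σ (r.toSec.toFun x) (r.toSec.prolong x)
              = Γ.toFun (r.toSec.toFun x)) ∧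
            (∀ x : X, dynProj L σ (r.toSec.toFun x) (r.toSec.prolong x)
              = σ.toFun (r.toSec.toFun x) (r.toFun x).2))) ∧
      -- every section satisfies the gauge-type conditions of some `Γ`
      (∀ s : Sec P, ∃ Γ : Connection P, Γ.InKer L ∧
        (∀ x : X, gaugeProj L σ (s.toFun x) (s.prolong x) = Γ.toFun (s.toFun x)) ∧
        (∀ x : X, affMor Γ σ (s.toFun x) (legendre L (s.toFun x) (s.prolong x))
          = s.prolong x)) ∧
      -- for fixed `σ`, the forms `H` of all `Γ` make a complete family
      IsCompleteFamily L {H | ∃ Γ : Connection P, Γ.InKer L ∧ H = quadHam L Γ σ}) := by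
  obtain ⟨σ₀, hσ₀, hσ₀L, hσ₀R⟩ := exists_linForm hquad hreg hzero
  refine ⟨?_, ⟨σ₀, hσ₀, hσ₀L, hσ₀R⟩, fun Γ σ hΓ => ⟨isHamiltonian_quadHam hquad hΓ,
      fun φ a b c s h hs => isQuadHamExpr_quadHam hΓ h hs⟩,
    fun Γ σ hΓ hσ hσL => ⟨isMomMorphismOf_quadHam hquad hΓ hσ,
      fun y p hp => legendre_affMor hquad hΓ hσL p hp,
      isAssociated_quadHam_iff hquad hΓ hσ hσL⟩,
    fun σ hσ hσL hσR => ⟨fun y j => ⟨legendre_gaugeProj hquad hσL j,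
        fun k w hk hw => eq_vadd_iff_gaugeProj hquad hσR j k w hk hw⟩,
      fun y => ⟨hquad.constraint_eq (hzero y), isCompl_ker_range hquad (hzero y) hσL hσR⟩,
      fun Γ hΓ => ⟨(quadHam_eq_hamOf_iff hquad hΓ hσ).2 hσR,
        (isAssociated_quadHam_iff hquad hΓ hσ hσL).2 hσR, fun r => ?_⟩,
      exists_connection_gaugeProj hquad hσL,
      isCompleteFamily_quadHam hquad hσ hσL hσR⟩⟩
  -- An arbitrary connection is moved into the kernel of the Legendre morphism by the projection `S`
  -- of `σ₀`.
  · obtain ⟨Γ⟩ := exists_connection P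
    exact ⟨Γ.gauge hquad σ₀, Γ.gauge_inKer hquad hσ₀L⟩
  · have h1 := solvesHamiltonFst_iff (isHamiltonian_quadHam hquad hΓ)
      (isMomMorphismOf_quadHam hquad hΓ hσ) r
    refine ⟨h1, h1.trans ?_⟩
    rw [← forall_and]
    refine forall_congr' fun x => ?_
    -- At each point, `J¹s = Γ + σ(r)` decomposes uniquely into its components in the kernel of the
    -- Legendre morphism and in `Im σ`.
    exact (eq_vadd_iff_gaugeProj hquad hσR (r.toSec.prolong x) (Γ.toFun (r.toSec.toFun x))
      (σ.toFun (r.toSec.toFun x) (r.toFun x).2) (hΓ _) ⟨_, rfl⟩).trans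
      (and_congr eq_comm eq_comm)
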